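/- **Theorem.** Let $d\in\mathbf N$ and $s>0$. Notation: for $\alpha\in\mathbf N^d$ let $h_\alpha(x)=\pi^{-d/4}(-1)^{|\alpha|}(2^{|\alpha|}\alpha!)^{-1/2}e^{|x|^2/2}\,\partial^\alpha e^{-|x|^2}$ be the Hermite functions on $\mathbf R^d$, let $e_\alpha(z)=z^\alpha/\sqrt{\alpha!}$ on $\mathbf C^d$, and let $H=|x|^2-\Delta$. A formal Hermite series is a formal sum $f=\sum_\alpha c_\alpha(f)h_\alpha$ with arbitrary complex coefficients; its Bargmann transform is the formal power series $\mathfrak V_df=\sum_\alpha c_\alpha(f)e_\alpha$. The Pilipović space $\boldsymbol\Sigma_s(\mathbf R^d)$ is the set of all $f\in C^\infty(\mathbf R^d)$ such that $$\sup_{N\ge0}\frac{\|H^Nf\|_{L^\infty}}{h^N(N!)^{2s}}<\infty\qquad\text{for every }h>0,$$ with the topology defined by these norms; $f\in\boldsymbol\Sigma_s(\mathbf R^d)$ is identified with the formal Hermite series with the coefficients $c_\alpha(f)=\int f h_\alpha\,dx$. Let $\mathcal A_{0,s}(\mathbf C^d)$ be the set of all entire functions $F$ on $\mathbf C^d$ such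 that for every $r>0$ there is a constant $C$ with $|F(z)|\le C\,w_r(z)$ for all $z$, where, with $\langle z\rangle=(1+|z|^2)^{1/2}$ and $z=x+i\xi$, $x,\xi\in\mathbf R^d$, $$w_r(z)=\begin{cases}e^{r(\log\langle z\rangle)^{1/(1-2s)}}, & s<1/2,\\ e^{r|z|^2}, & s=1/2,\\ e^{|z|^2/2-r(|x|^{1/s}+|\xi|^{1/s})}, & s>1/2,\end{cases}$$ with the topology defined by the norms $\sup_z|F(z)|/w_r(z)$, $r>0$. For every formal Hermite series $f$ the following conditions are equivalent: 1. $f\in\boldsymbol\Sigma_s(\mathbf R^d)$; 2. $\mathfrak V_df\in\mathcal A_{0,s}(\mathbf C^d)$, that is, the power series $\mathfrak V_df$ converges on all of $\mathbf C^d$ and its sum belongs to $\mathcal A_{0,s}(\mathbf C^d)$ (for $s=1/2$: the sum $F$ is entire and for every $r>0$ it satisfies $|F(z)|\lesssim e^{r|z|^2}$); 3. for every $r>0$ there is a constant $C$ such that $|c_\alpha(f)|\le C e^{-r|\alpha|^{1/(2s)}}$ for all $\alpha\in\mathbf N^d$. Furthermore, the Bargmann transform restricts to a (linear) continuous and bijective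 map from $\boldsymbol\Sigma_s(\mathbf R^d)$ to $\mathcal A_{0,s}(\mathbf C^d)$, and on $\boldsymbol\Sigma_s(\mathbf R^d)$ it is given by $$(\mathfrak V_df)(z)=\pi^{-d/4}\int_{\mathbf R^d}\exp\Big(-\tfrac12\big(\langle z,z\rangle+|y|^2\big)+\sqrt2\,\langle z,y\rangle\Big)f(y)\,dy, \qquad \langle z,w\rangle=\sum_{j=1}^dz_jw_j .$$ -/

import Mathlib

open scoped ContDiff Laplacian

noncomputable section

namespace Pilipovic

/-! ### Euclidean spaces, multi-indices and Hermite functions -/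

/-- The real space `ℝ^d` with its Euclidean norm. -/
abbrev RSpace (d : ℕ) : Type := EuclideanSpace ℝ (Fin d)

/-- The complex space `ℂ^d` with its Euclidean norm. -/
abbrev CSpace (d : ℕ) : Type := EuclideanSpace ℂ (Fin d)

/-- Multi-indices in `ℕ^d`. -/
abbrev MultiIndex (d : ℕ) : Type := Fin d →₀ ℕ

/-- `|α| = α_1 + ⋯ + α_d`. -/
def MultiIndex.length {d : ℕ} (α : MultiIndex d) : ℕ := ∑ i, α i

/-- `α! = α_1! ⋯ α_d!`. -/
def MultiIndex.fact {d : ℕ} (α : MultiIndex d) : ℕ := ∏ i, (α i).factorial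

/-- The one-dimensional Hermite function
`π^{-1/4} (-1)^n (2^n n!)^{-1/2} e^{t²/2} (d/dt)^n e^{-t²}`. -/
def hermiteFun1 (n : ℕ) (t : ℝ) : ℝ :=
  Real.pi ^ (-(1 / 4) : ℝ) * (-1) ^ n * (Real.sqrt (2 ^ n * n.factorial))⁻¹ *
    Real.exp (t ^ 2 / 2) * iteratedDeriv n (fun u : ℝ => Real.exp (-u ^ 2)) t

/-- The Hermite function
`h_α(x) = π^{-d/4} (-1)^{|α|} (2^{|α|} α!)^{-1/2} e^{|x|²/2} ∂^α e^{-|x|²}`, written as the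
product of the one-dimensional Hermite functions of the coordinates. -/
def hermiteFun {d : ℕ} (α : MultiIndex d) (x : RSpace d) : ℝ :=
  ∏ i, hermiteFun1 (α i) (x i)

/-! ### The harmonic oscillator and the Pilipović space -/

/-- The harmonic oscillator `H f = |x|² f - Δ f`. -/
def harmOsc {d : ℕ} (f : RSpace d → ℂ) (x : RSpace d) : ℂ :=
  ((‖x‖ ^ 2 : ℝ) : ℂ) * f x - (Δ f) x

lemma two_le_infty : (2 : WithTop ℕ∞) ≤ ∞ :=
  WithTop.coe_le_coe.2 (le_top : (2 : ℕ∞) ≤ ⊤)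

lemma contDiff_harmOsc {d : ℕ} {f : RSpace d → ℂ} (hf : ContDiff ℝ ∞ f) :
    ContDiff ℝ ∞ (harmOsc f) := by
  have h1 : ContDiff ℝ ∞ (fun x : RSpace d => ((‖x‖ ^ 2 : ℝ) : ℂ)) :=
    Complex.ofRealCLM.contDiff.comp (contDiff_norm_sq ℝ)
  have h2 : ContDiff ℝ ∞ (Δ f) := by
    rw [InnerProductSpace.laplacian_eq_iteratedFDeriv_orthonormalBasis f
      (EuclideanSpace.basisFun (Fin d) ℝ)]
    refine ContDiff.sum fun i _ => ?_
    have h3 : ContDiff ℝ ∞ (iteratedFDeriv ℝ 2 f) := hf.iteratedFDeriv_right (by norm_cast)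
    exact (ContinuousMultilinearMap.apply ℝ (fun _ : Fin 2 => RSpace d) ℂ _).contDiff.comp h3
  exact (h1.mul hf).sub h2

lemma contDiff_harmOsc_iterate {d : ℕ} {f : RSpace d → ℂ} (hf : ContDiff ℝ ∞ f) (N : ℕ) :
    ContDiff ℝ ∞ (harmOsc^[N] f) := by
  induction N with
  | zero => exact hf
  | succ N ih => rw [Function.iterate_succ_apply']; exact contDiff_harmOsc ih

lemma harmOsc_add {d : ℕ} {f g : RSpace d → ℂ} (hf : ContDiff ℝ ∞ f) (hg : ContDiff ℝ ∞ g) :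
    harmOsc (f + g) = harmOsc f + harmOsc g := by
  funext x
  have h := ContDiffAt.laplacian_add (x := x) (hf.of_le two_le_infty).contDiffAt
    (hg.of_le two_le_infty).contDiffAt
  simp only [harmOsc, h, Pi.add_apply]
  ring

lemma harmOsc_smul {d : ℕ} {f : RSpace d → ℂ} (hf : ContDiff ℝ ∞ f) (a : ℂ) :
    harmOsc (a • f) = a • harmOsc f := by
  funext x
  have h := InnerProductSpace.laplacian_smul (x := x) a
    ((hf.of_le two_le_infty).contDiffAt : ContDiffAt ℝ 2 f x)
  simp only [harmOsc, h, Pi.smul_apply, smul_eq_mul]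
  ring

lemma harmOsc_iterate_add {d : ℕ} {f g : RSpace d → ℂ} (hf : ContDiff ℝ ∞ f)
    (hg : ContDiff ℝ ∞ g) (N : ℕ) :
    harmOsc^[N] (f + g) = harmOsc^[N] f + harmOsc^[N] g := by
  induction N with
  | zero => rfl
  | succ N ih =>
    simp only [Function.iterate_succ_apply', ih]
    exact harmOsc_add (contDiff_harmOsc_iterate hf N) (contDiff_harmOsc_iterate hg N)

lemma harmOsc_iterate_smul {d : ℕ} {f : RSpace d → ℂ} (hf : ContDiff ℝ ∞ f) (a : ℂ) (N : ℕ) :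
    harmOsc^[N] (a • f) = a • harmOsc^[N] f := by
  induction N with
  | zero => rfl
  | succ N ih =>
    simp only [Function.iterate_succ_apply', ih]
    exact harmOsc_smul (contDiff_harmOsc_iterate hf N) a

/-- The quotient `|H^N f(x)| / (h^N (N!)^{2s})`. -/
def pilQuot {d : ℕ} (s h : ℝ) (f : RSpace d → ℂ) (p : ℕ × RSpace d) : ℝ :=
  ‖(harmOsc^[p.1] f) p.2‖ / (h ^ p.1 * (p.1.factorial : ℝ) ^ (2 * s))

lemma pilQuot_nonneg {d : ℕ} (s : ℝ) {h : ℝ} (hh : 0 < h) (f : RSpace d → ℂ)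
    (p : ℕ × RSpace d) : 0 ≤ pilQuot s h f p := by
  unfold pilQuot; positivity

lemma pilQuot_add_le {d : ℕ} (s : ℝ) {h : ℝ} (hh : 0 < h) {f g : RSpace d → ℂ}
    (hf : ContDiff ℝ ∞ f) (hg : ContDiff ℝ ∞ g) (p : ℕ × RSpace d) :
    pilQuot s h (f + g) p ≤ pilQuot s h f p + pilQuot s h g p := by
  unfold pilQuot
  rw [harmOsc_iterate_add hf hg, ← add_div]
  have := norm_add_le ((harmOsc^[p.1] f) p.2) ((harmOsc^[p.1] g) p.2)
  simp only [Pi.add_apply]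
  gcongr

lemma pilQuot_smul {d : ℕ} (s h : ℝ) {f : RSpace d → ℂ} (hf : ContDiff ℝ ∞ f) (a : ℂ)
    (p : ℕ × RSpace d) : pilQuot s h (a • f) p = ‖a‖ * pilQuot s h f p := by
  unfold pilQuot
  rw [harmOsc_iterate_smul hf, Pi.smul_apply, smul_eq_mul, norm_mul, mul_div_assoc]

/-- The Pilipović space `𝚺_s(ℝ^d)` of Beurling type: the smooth `f : ℝ^d → ℂ` such that
`sup_N ‖H^N f‖_{L^∞} / (h^N (N!)^{2s}) < ∞` for every `h > 0`.  As `H^N f` is continuous, its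
`L^∞`-norm is its supremum. -/
def pilipovicSubmodule (d : ℕ) (s : ℝ) : Submodule ℂ (RSpace d → ℂ) where
  carrier := {f | ContDiff ℝ ∞ f ∧ ∀ h : ℝ, 0 < h → BddAbove (Set.range (pilQuot s h f))}
  zero_mem' := by
    refine ⟨contDiff_const, fun h _ => ⟨0, ?_⟩⟩
    rintro _ ⟨p, rfl⟩
    have h0 := pilQuot_smul s h (f := (0 : RSpace d → ℂ)) contDiff_const 0 p
    rw [zero_smul, norm_zero, zero_mul] at h0
    exact h0.le
  add_mem' := by
    rintro f g ⟨hf, hf'⟩ ⟨hg, hg'⟩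
    refine ⟨hf.add hg, fun h hh => ?_⟩
    obtain ⟨A, hA⟩ := hf' h hh
    obtain ⟨B, hB⟩ := hg' h hh
    refine ⟨A + B, ?_⟩
    rintro _ ⟨p, rfl⟩
    exact (pilQuot_add_le s hh hf hg p).trans (add_le_add (hA ⟨p, rfl⟩) (hB ⟨p, rfl⟩))
  smul_mem' := by
    rintro a f ⟨hf, hf'⟩
    refine ⟨hf.const_smul a, fun h hh => ?_⟩
    obtain ⟨A, hA⟩ := hf' h hh
    refine ⟨‖a‖ * A, ?_⟩
    rintro _ ⟨p, rfl⟩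
    rw [pilQuot_smul s h hf]
    exact mul_le_mul_of_nonneg_left (hA ⟨p, rfl⟩) (norm_nonneg a)

/-- `𝚺_s(ℝ^d)` as a type of its own, to carry its own topology. -/
def PilipovicSpace (d : ℕ) (s : ℝ) : Type := pilipovicSubmodule d s

instance (d : ℕ) (s : ℝ) : AddCommGroup (PilipovicSpace d s) :=
  inferInstanceAs (AddCommGroup (pilipovicSubmodule d s))

instance (d : ℕ) (s : ℝ) : Module ℂ (PilipovicSpace d s) :=
  inferInstanceAs (Module ℂ (pilipovicSubmodule d s))

/-- The function `ℝ^d → ℂ` underlying an element of `𝚺_s(ℝ^d)`. -/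
def PilipovicSpace.toFun {d : ℕ} {s : ℝ} (f : PilipovicSpace d s) : RSpace d → ℂ := f.1

/-- The norm `sup_N ‖H^N f‖_{L^∞} / (h^N (N!)^{2s})`. -/
def pilSeminorm (d : ℕ) (s : ℝ) (h : Set.Ioi (0 : ℝ)) : Seminorm ℂ (PilipovicSpace d s) :=
  Seminorm.of (fun f => ⨆ p, pilQuot s h f.toFun p)
    (fun f g => by
      refine ciSup_le fun p => ?_
      exact (pilQuot_add_le s h.2 f.2.1 g.2.1 p).trans
        (add_le_add (le_ciSup (f.2.2 h h.2) p) (le_ciSup (g.2.2 h h.2) p)))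
    (fun a f => by
      rw [Real.mul_iSup_of_nonneg (norm_nonneg a)]
      exact iSup_congr fun p => pilQuot_smul s h f.2.1 a p)

/-- The projective limit topology: the one defined by the norms with `h > 0`. -/
instance (d : ℕ) (s : ℝ) : TopologicalSpace (PilipovicSpace d s) :=
  SeminormFamily.moduleFilterBasis (pilSeminorm d s) |>.topology

lemma withSeminorms_pilipovicSpace (d : ℕ) (s : ℝ) : WithSeminorms (pilSeminorm d s) := ⟨rfl⟩

/-! ### The spaces of entire functions -/

/-- The vector `x ∈ ℝ^d` in `z = x + iξ ∈ ℂ^d`. -/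
def rePart {d : ℕ} (z : CSpace d) : RSpace d := WithLp.toLp 2 fun i => (z i).re

/-- The vector `ξ ∈ ℝ^d` in `z = x + iξ ∈ ℂ^d`. -/
def imPart {d : ℕ} (z : CSpace d) : RSpace d := WithLp.toLp 2 fun i => (z i).im

/-- The weights that define `𝒜_{0,s}(ℂ^d)`, for `r > 0`, with `⟨z⟩ = (1 + |z|²)^{1/2}`:
* `exp (r (log ⟨z⟩)^{1/(1-2s)})` if `s < 1/2`;
* `exp (r |z|²)` if `s = 1/2`;
* `exp (|z|²/2 - r (|x|^{1/s} + |ξ|^{1/s}))`, `z = x + iξ`, if `s > 1/2`. -/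
def entireWeight {d : ℕ} (s r : ℝ) (z : CSpace d) : ℝ :=
  if s < 1 / 2 then
    Real.exp (r * Real.log (Real.sqrt (1 + ‖z‖ ^ 2)) ^ (1 / (1 - 2 * s)))
  else if s = 1 / 2 then
    Real.exp (r * ‖z‖ ^ 2)
  else
    Real.exp (‖z‖ ^ 2 / 2 - r * (‖rePart z‖ ^ (1 / s) + ‖imPart z‖ ^ (1 / s)))

lemma entireWeight_pos {d : ℕ} (s r : ℝ) (z : CSpace d) : 0 < entireWeight s r z := by
  unfold entireWeight
  split_ifs <;> exact Real.exp_pos _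

/-- The quotient of `|F(z)|` by the weight. -/
def entireQuot {d : ℕ} (s r : ℝ) (F : CSpace d → ℂ) (z : CSpace d) : ℝ :=
  ‖F z‖ / entireWeight s r z

lemma entireQuot_add_le {d : ℕ} (s r : ℝ) (F G : CSpace d → ℂ) (z : CSpace d) :
    entireQuot s r (F + G) z ≤ entireQuot s r F z + entireQuot s r G z := by
  unfold entireQuot
  rw [← add_div]
  exact div_le_div_of_nonneg_right (norm_add_le _ _) (entireWeight_pos s r z).le

lemma entireQuot_smul {d : ℕ} (s r : ℝ) (a : ℂ) (F : CSpace d → ℂ) (z : CSpace d) :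
    entireQuot s r (a • F) z = ‖a‖ * entireQuot s r F z := by
  unfold entireQuot
  rw [Pi.smul_apply, smul_eq_mul, norm_mul, mul_div_assoc]

/-- The space `𝒜_{0,s}(ℂ^d)`: the entire functions `F` on `ℂ^d` which, for every `r > 0`, are
bounded by a constant times the weight. -/
def entireSubmodule (d : ℕ) (s : ℝ) : Submodule ℂ (CSpace d → ℂ) where
  carrier := {F | Differentiable ℂ F ∧ ∀ r : ℝ, 0 < r → BddAbove (Set.range (entireQuot s r F))}
  zero_mem' := by
    refine ⟨differentiable_const 0, fun r _ => ⟨0, ?_⟩⟩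
    rintro _ ⟨z, rfl⟩
    simp [entireQuot]
  add_mem' := by
    rintro F G ⟨hF, hF'⟩ ⟨hG, hG'⟩
    refine ⟨hF.add hG, fun r hr => ?_⟩
    obtain ⟨A, hA⟩ := hF' r hr
    obtain ⟨B, hB⟩ := hG' r hr
    refine ⟨A + B, ?_⟩
    rintro _ ⟨z, rfl⟩
    exact (entireQuot_add_le s r F G z).trans (add_le_add (hA ⟨z, rfl⟩) (hB ⟨z, rfl⟩))
  smul_mem' := by
    rintro a F ⟨hF, hF'⟩
    refine ⟨hF.const_smul a, fun r hr => ?_⟩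
    obtain ⟨A, hA⟩ := hF' r hr
    refine ⟨‖a‖ * A, ?_⟩
    rintro _ ⟨z, rfl⟩
    rw [entireQuot_smul]
    exact mul_le_mul_of_nonneg_left (hA ⟨z, rfl⟩) (norm_nonneg a)

/-- `𝒜_{0,s}(ℂ^d)` as a type of its own, to carry its own topology. -/
def EntireSpace (d : ℕ) (s : ℝ) : Type := entireSubmodule d s

instance (d : ℕ) (s : ℝ) : AddCommGroup (EntireSpace d s) :=
  inferInstanceAs (AddCommGroup (entireSubmodule d s))

instance (d : ℕ) (s : ℝ) : Module ℂ (EntireSpace d s) :=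
  inferInstanceAs (Module ℂ (entireSubmodule d s))

/-- The function `ℂ^d → ℂ` underlying an element of `𝒜_{0,s}(ℂ^d)`. -/
def EntireSpace.toFun {d : ℕ} {s : ℝ} (F : EntireSpace d s) : CSpace d → ℂ := F.1

/-- The norm `sup_z |F(z)| / w_r(z)`, where `w_r` is the weight. -/
def entireSeminorm (d : ℕ) (s : ℝ) (r : Set.Ioi (0 : ℝ)) : Seminorm ℂ (EntireSpace d s) :=
  Seminorm.of (fun F => ⨆ z, entireQuot s r F.toFun z)
    (fun F G => by
      refine ciSup_le fun z => ?_
      exact (entireQuot_add_le s r F.toFun G.toFun z).trans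
        (add_le_add (le_ciSup (F.2.2 r r.2) z) (le_ciSup (G.2.2 r r.2) z)))
    (fun a F => by
      rw [Real.mul_iSup_of_nonneg (norm_nonneg a)]
      exact iSup_congr fun z => entireQuot_smul s r a F.toFun z)

/-- The canonical (projective limit) topology: the one defined by the norms with `r > 0`. -/
instance (d : ℕ) (s : ℝ) : TopologicalSpace (EntireSpace d s) :=
  SeminormFamily.moduleFilterBasis (entireSeminorm d s) |>.topology

lemma withSeminorms_entireSpace (d : ℕ) (s : ℝ) : WithSeminorms (entireSeminorm d s) := ⟨rfl⟩

/-! ### Formal Hermite series and the Bargmann transform -/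

/-- A formal Hermite series `∑_α c_α h_α`, given by its coefficients: an element of
`ℋ_0'(ℝ^d)`. -/
abbrev FormalHermiteSeries (d : ℕ) : Type := MultiIndex d → ℂ

/-- The Hermite coefficients `c_α(f) = (f, h_α)_{L²} = ∫ f h_α dx` of a function; the functions
`h_α` are real-valued. -/
def hermiteSeries {d : ℕ} (f : RSpace d → ℂ) : FormalHermiteSeries d :=
  fun α => ∫ x, f x * (hermiteFun α x : ℂ)

/-- The Bargmann transform of a formal Hermite series: `∑_α c_α h_α` goes to the formal power
series `∑_α c_α e_α`, where `e_α(z) = z^α / (α!)^{1/2}`. -/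
def formalBargmann {d : ℕ} (c : FormalHermiteSeries d) : MvPowerSeries (Fin d) ℂ :=
  fun α => c α / (Real.sqrt (MultiIndex.fact α : ℝ) : ℂ)

/-- The formal power series `P` converges (absolutely) on all of `ℂ^d`, with sum `F`. -/
def HasSumOnSpace {d : ℕ} (P : MvPowerSeries (Fin d) ℂ) (F : CSpace d → ℂ) : Prop :=
  ∀ z : CSpace d, HasSum (fun α : MultiIndex d => MvPowerSeries.coeff α P * ∏ i, z i ^ α i) (F z)

/-- The Bargmann transform of a function, as the integral
`π^{-d/4} ∫ exp (-(⟨z,z⟩ + |y|²)/2 + √2 ⟨z,y⟩) f(y) dy`, where `⟨z,w⟩ = ∑ z_j w_j`. -/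
def bargmannIntegral {d : ℕ} (f : RSpace d → ℂ) (z : CSpace d) : ℂ :=
  ((Real.pi ^ (-(d : ℝ) / 4) : ℝ) : ℂ) *
    ∫ y : RSpace d, Complex.exp (-(1 / 2) * ((∑ i, z i * z i) + ((‖y‖ ^ 2 : ℝ) : ℂ)) +
      ((Real.sqrt 2 : ℝ) : ℂ) * ∑ i, z i * (y i : ℂ)) * f y

end Pilipovic

end

noncomputable section

namespace Pilipovic

/-! ### Elementary growth estimates -/

/-! Everything is read off from the coefficients: condition 3 is the hub, and each function space is
compared with it. All the comparisons lose polynomial factors in |α|; these are harmless because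
e^{-ε|α|^{1/(2s)}} absorbs them for every ε > 0.

From Σ_s to decay (`exists_norm_hermiteSeries_le`): h_α is an eigenfunction of H with eigenvalue
2|α|+d and H is symmetric, so c_α(H^N f) = (2|α|+d)^N c_α(f). Since ‖h_α‖_{L¹} grows polynomially,
|c_α| is at most h^N (N!)^{2s} |α|^{-N} up to a polynomial, and N ≈ (r+1)|α|^{1/(2s)} with a
suitable h gives the exponential decay. Conversely (`hermiteSum_mem`), under condition 3 the Hermite
series may be differentiated term by term, and (|α|+1)^N ≤ C h^N (N!)^{2s} e^{r|α|^{1/(2s)}} bounds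
H^N of the sum.

From decay to growth of the transform (`exists_tsum_norm_le`): the numbers |e_α(z)|² sum to
e^{|z|²}. The arithmetic-geometric inequality 2|e_α| ≤ w + |e_α|²/w reduces a bound of Σ|c_α e_α| by
the weight w to one of Σ e^{-r'|α|^{1/(2s)}}|e_α|² by w², which is proved separately for s below, at
and above 1/2. From growth to decay (`exists_coeff_le`): Cauchy's inequalities on tori whose radii
are adapted to α, again in three cases.

The integral formula holds because the Hermite functions are the Taylor coefficients of a translated
Gaussian (`hasSum_kernel1`), and sum and integral may be exchanged for any bounded continuous f. All
parameters depend on d, s and r alone and the bounds are linear in the seminorms, whence continuity.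
Injectivity: at suitable purely imaginary z the Bargmann integral is, up to a factor, the Fourier
transform of e^{-|y|²/2}f, so Fourier inversion applies. Surjectivity: an entire function is the sum
of an everywhere convergent power series, whose coefficients decay and hence come from an element of
Σ_s. -/

lemma exp_one_mul_pow_le (n : ℕ) :
    Real.exp 1 * (n : ℝ) ^ (n + 1) ≤ ((n : ℝ) + 1) ^ (n + 1) := by
  rcases Nat.eq_zero_or_pos n with rfl | hn
  · simp
  · have hn' : (0 : ℝ) < n := by exact_mod_cast hn
    have h1 : 1 / ((n : ℝ) + 1) ≤ Real.log (((n : ℝ) + 1) / n) := by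
      have := Real.one_sub_inv_le_log_of_pos (x := ((n : ℝ) + 1) / n) (by positivity)
      refine le_trans (le_of_eq ?_) this
      field_simp
      ring
    have h2 : Real.exp 1 ≤ (((n : ℝ) + 1) / n) ^ (n + 1) := by
      rw [← Real.exp_log (show (0 : ℝ) < (((n : ℝ) + 1) / n) ^ (n + 1) by positivity),
        Real.log_pow]
      apply Real.exp_le_exp.2
      have h3 : (0 : ℝ) < (n : ℝ) + 1 := by positivity
      have := mul_le_mul_of_nonneg_left h1 h3.le
      rw [mul_one_div_cancel h3.ne'] at this
      push_cast
      exact this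
    rw [div_pow, le_div_iff₀ (by positivity)] at h2
    exact h2

lemma factorial_mul_exp_le_of_pos {n : ℕ} (hn : 1 ≤ n) :
    (n.factorial : ℝ) * Real.exp n ≤ Real.exp 1 * (n : ℝ) ^ (n + 1) := by
  induction n, hn using Nat.le_induction with
  | base => simp
  | succ n hn ih =>
    calc (((n + 1).factorial : ℕ) : ℝ) * Real.exp ((n + 1 : ℕ) : ℝ)
        = ((n : ℝ) + 1) * Real.exp 1 * ((n.factorial : ℝ) * Real.exp n) := by
          rw [Nat.factorial_succ]; push_cast; rw [Real.exp_add]; ring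
      _ ≤ ((n : ℝ) + 1) * Real.exp 1 * (Real.exp 1 * (n : ℝ) ^ (n + 1)) := by gcongr
      _ ≤ ((n : ℝ) + 1) * Real.exp 1 * ((n : ℝ) + 1) ^ (n + 1) := by
          gcongr ?_ * ?_
          exact exp_one_mul_pow_le n
      _ = _ := by push_cast; ring

/-- An upper Stirling bound, with n + 1 in place of n in one factor so that n = 0 is included. The
exact exponential e^n matters in two places: the sup bound of the Hermite functions, and the
coefficient estimate for s > 1/2. -/
lemma factorial_mul_exp_le (n : ℕ) :
    (n.factorial : ℝ) * Real.exp n ≤ Real.exp 1 * (n + 1) * (n : ℝ) ^ n := by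
  rcases Nat.eq_zero_or_pos n with rfl | hn
  · simp
  · refine (factorial_mul_exp_le_of_pos hn).trans ?_
    have : (0 : ℝ) ≤ Real.exp 1 * (n : ℝ) ^ n := by positivity
    rw [pow_succ]
    nlinarith

/-- This is y^N ≤ N! e^y at y = t(n+1)^{1/(2s)}, raised to the power 2s. The free parameter t is
used in two ways below: to produce a prescribed h, or to make the exponential as weak as desired. -/
lemma succ_pow_le {s t : ℝ} (hs : 0 < s) (ht : 0 < t) (N n : ℕ) :
    ((n : ℝ) + 1) ^ N ≤ (t ^ (-(2 * s))) ^ N * (N.factorial : ℝ) ^ (2 * s) *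
      Real.exp (2 * s * (t * ((n : ℝ) + 1) ^ (1 / (2 * s)))) := by
  set y : ℝ := ((n : ℝ) + 1) ^ (1 / (2 * s)) with hy
  have hn : (0 : ℝ) < (n : ℝ) + 1 := by positivity
  have hy0 : 0 < y := Real.rpow_pos_of_pos hn _
  have h1 : (t * y) ^ N ≤ N.factorial * Real.exp (t * y) := by
    have := Real.pow_div_factorial_le_exp (t * y) (by positivity) N
    rwa [div_le_iff₀ (by positivity), mul_comm (Real.exp _)] at this
  have h2 := Real.rpow_le_rpow (by positivity) h1 (show 0 ≤ 2 * s by positivity)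
  rw [Real.mul_rpow (by positivity) (by positivity), ← Real.exp_mul, mul_comm (t * y),
    ← Real.rpow_natCast, ← Real.rpow_mul (by positivity), mul_comm (N : ℝ),
    Real.rpow_mul (by positivity), Real.rpow_natCast, Real.mul_rpow ht.le hy0.le, hy,
    ← Real.rpow_mul hn.le, one_div_mul_cancel (by positivity), Real.rpow_one, mul_pow] at h2
  rw [Real.rpow_neg ht.le, inv_pow, mul_assoc, ← div_eq_inv_mul, le_div_iff₀ (by positivity)]
  linarith

lemma succ_rpow_le {γ : ℝ} (hγ : 0 ≤ γ) (n : ℕ) :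
    ((n : ℝ) + 1) ^ γ ≤ 2 ^ γ * ((n : ℝ) ^ γ + 1) := by
  rcases Nat.eq_zero_or_pos n with rfl | hn
  · have : (1 : ℝ) ≤ 2 ^ γ := Real.one_le_rpow (by norm_num) hγ
    have h0 : (0 : ℝ) ≤ 0 ^ γ := Real.rpow_nonneg le_rfl _
    simp only [Nat.cast_zero, zero_add, Real.one_rpow]
    nlinarith
  · have hn' : (1 : ℝ) ≤ n := by exact_mod_cast hn
    calc ((n : ℝ) + 1) ^ γ ≤ (2 * n) ^ γ := by gcongr; linarith
      _ = 2 ^ γ * (n : ℝ) ^ γ := Real.mul_rpow (by norm_num) (by positivity)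
      _ ≤ _ := by gcongr; linarith

lemma exists_succ_pow_le {s h : ℝ} (hs : 0 < s) (hh : 0 < h) :
    ∃ r : ℝ, 0 < r ∧ ∃ C : ℝ, 0 < C ∧ ∀ N n : ℕ, ((n : ℝ) + 1) ^ N ≤
      C * (h ^ N * (N.factorial : ℝ) ^ (2 * s)) * Real.exp (r * (n : ℝ) ^ (1 / (2 * s))) := by
  -- Chosen so that t^{-2s} = h.
  set t : ℝ := h ^ (-(1 / (2 * s))) with htdef
  have ht : 0 < t := Real.rpow_pos_of_pos hh _
  have hth : t ^ (-(2 * s)) = h := by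
    rw [htdef, ← Real.rpow_mul hh.le]
    have : -(1 / (2 * s)) * -(2 * s) = 1 := by field_simp
    rw [this, Real.rpow_one]
  refine ⟨2 * s * t * 2 ^ (1 / (2 * s)), by positivity, Real.exp (2 * s * t * 2 ^ (1 / (2 * s))),
    Real.exp_pos _, fun N n => ?_⟩
  refine (succ_pow_le hs ht N n).trans ?_
  rw [hth, mul_comm (Real.exp _), mul_assoc (h ^ N * _), ← Real.exp_add]
  gcongr
  have := succ_rpow_le (γ := 1 / (2 * s)) (by positivity) n
  have h2 : 2 * s * (t * ((n : ℝ) + 1) ^ (1 / (2 * s))) ≤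
    2 * s * (t * (2 ^ (1 / (2 * s)) * ((n : ℝ) ^ (1 / (2 * s)) + 1))) := by gcongr
  linarith

lemma exists_succ_pow_le_exp {s ε : ℝ} (hs : 0 < s) (hε : 0 < ε) (k : ℕ) :
    ∃ C : ℝ, 0 < C ∧ ∀ n : ℕ, ((n : ℝ) + 1) ^ k ≤ C * Real.exp (ε * (n : ℝ) ^ (1 / (2 * s))) := by
  set t : ℝ := ε / (2 * s * 2 ^ (1 / (2 * s))) with htdef
  have ht : 0 < t := by positivity
  have hε' : ε = 2 * s * t * 2 ^ (1 / (2 * s)) := by rw [htdef]; field_simp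
  refine ⟨(t ^ (-(2 * s))) ^ k * (k.factorial : ℝ) ^ (2 * s) * Real.exp ε, by positivity,
    fun n => ?_⟩
  refine (succ_pow_le hs ht k n).trans ?_
  rw [mul_assoc _ (Real.exp ε), ← Real.exp_add]
  gcongr
  have := succ_rpow_le (γ := 1 / (2 * s)) (by positivity) n
  have h2 : 2 * s * (t * ((n : ℝ) + 1) ^ (1 / (2 * s))) ≤
    2 * s * (t * (2 ^ (1 / (2 * s)) * ((n : ℝ) ^ (1 / (2 * s)) + 1))) := by gcongr
  refine h2.trans (le_of_eq ?_)
  linear_combination (-(n : ℝ) ^ (1 / (2 * s)) - 1) * hε'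

/-- A sublinear power lies below the identity beyond the crossing point x₀ where K x^γ = x; up to x₀
it is bounded by its value there. -/
lemma exists_mul_rpow_le {γ : ℝ} (h0 : 0 < γ) (h1 : γ < 1) {K : ℝ} (hK : 0 ≤ K) :
    ∃ C : ℝ, ∀ x : ℝ, 0 ≤ x → K * x ^ γ ≤ x + C := by
  set x₀ : ℝ := K ^ (1 / (1 - γ)) with hx₀
  have h1' : 0 < 1 - γ := by linarith
  have hx0 : 0 ≤ x₀ := Real.rpow_nonneg hK _
  refine ⟨K * x₀ ^ γ, fun x hx => ?_⟩
  rcases le_total x x₀ with h | h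
  · have : K * x ^ γ ≤ K * x₀ ^ γ := by gcongr
    linarith
  · rcases hx.eq_or_lt with rfl | hx
    · rw [Real.zero_rpow h0.ne']; have := Real.rpow_nonneg hx0 γ; nlinarith
    · have hK' : K ≤ x ^ (1 - γ) := by
        calc K = x₀ ^ (1 - γ) := by
              rw [hx₀, ← Real.rpow_mul hK, one_div_mul_cancel h1'.ne', Real.rpow_one]
          _ ≤ x ^ (1 - γ) := by gcongr
      have h3 : K * x ^ γ ≤ x := by
        calc K * x ^ γ ≤ x ^ (1 - γ) * x ^ γ := by gcongr
          _ = x := by rw [← Real.rpow_add hx]; simp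
      have : 0 ≤ K * x₀ ^ γ := by positivity
      linarith

/-! ### Sums over multi-indices -/

/-- Induction on d, splitting off the first index. Absolute summability is carried along because it
is what allows two series to be multiplied. -/
lemma hasSum_pi_prod {𝕜 : Type*} [NormedField 𝕜] [CompleteSpace 𝕜] {d : ℕ}
    (f : Fin d → ℕ → 𝕜) (S : Fin d → 𝕜)
    (hf : ∀ i, HasSum (f i) (S i)) (hn : ∀ i, Summable fun n => ‖f i n‖) :
    HasSum (fun a : Fin d → ℕ => ∏ i, f i (a i)) (∏ i, S i) ∧
      Summable (fun a : Fin d → ℕ => ‖∏ i, f i (a i)‖) := by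
  induction d with
  | zero =>
    refine ⟨?_, (hasSum_unique _).summable⟩
    exact hasSum_unique (fun a : Fin 0 → ℕ => ∏ i, f i (a i))
  | succ d ih =>
    obtain ⟨h1, h2⟩ := ih (fun i => f i.succ) (fun i => S i.succ) (fun i => hf i.succ)
      fun i => hn i.succ
    have h0 := hn 0
    have key : ∀ p : ℕ × (Fin d → ℕ), (∏ i, f i (Fin.consEquiv (fun _ => ℕ) p i)) =
        f 0 p.1 * ∏ i, f i.succ (p.2 i) := by
      intro p
      simp [Fin.consEquiv, Fin.prod_univ_succ]
    obtain ⟨g, hg⟩ : ∃ g : (Fin d → ℕ) → 𝕜, g = fun a => ∏ i, f i.succ (a i) := ⟨_, rfl⟩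
    replace key : ∀ p : ℕ × (Fin d → ℕ), (∏ i, f i (Fin.consEquiv (fun _ => ℕ) p i)) =
        f 0 p.1 * g p.2 := fun p => by rw [key, hg]
    rw [← hg] at h1
    replace h2 : Summable fun a => ‖g a‖ := by rw [hg]; exact h2
    have h3 : Summable fun p : ℕ × (Fin d → ℕ) => ‖f 0 p.1 * g p.2‖ := h0.mul_norm h2
    constructor
    · have h4 := HasSum.mul (hf 0) h1 h3.of_norm
      rw [Fin.prod_univ_succ]
      refine (Equiv.hasSum_iff (f := fun a : Fin (d + 1) → ℕ => ∏ i, f i (a i))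
        (Fin.consEquiv (fun _ => ℕ))).1 ?_
      refine h4.congr_fun fun p => ?_
      exact key p
    · refine (Equiv.summable_iff (f := fun a : Fin (d + 1) → ℕ => ‖∏ i, f i (a i)‖)
        (Fin.consEquiv (fun _ => ℕ))).1 ?_
      refine h3.congr fun p => ?_
      exact congrArg norm (key p).symm

lemma hasSum_multiIndex_prod {𝕜 : Type*} [NormedField 𝕜] [CompleteSpace 𝕜] {d : ℕ}
    (f : Fin d → ℕ → 𝕜) (S : Fin d → 𝕜)
    (hf : ∀ i, HasSum (f i) (S i)) (hn : ∀ i, Summable fun n => ‖f i n‖) :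
    HasSum (fun α : MultiIndex d => ∏ i, f i (α i)) (∏ i, S i) :=
  (Equiv.hasSum_iff (f := fun a : Fin d → ℕ => ∏ i, f i (a i))
    (Finsupp.equivFunOnFinite : MultiIndex d ≃ (Fin d → ℕ))).2 (hasSum_pi_prod f S hf hn).1

lemma length_coord_le {d : ℕ} (α : MultiIndex d) (i : Fin d) : α i ≤ α.length :=
  Finset.single_le_sum (f := fun i => α i) (fun _ _ => Nat.zero_le _) (Finset.mem_univ i)

lemma prod_pow_coord {M : Type*} [CommMonoid M] {d : ℕ} (α : MultiIndex d) (x : M) :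
    ∏ i, x ^ α i = x ^ α.length := by
  rw [MultiIndex.length, Finset.prod_pow_eq_pow_sum]

lemma prod_coord_succ_le {d : ℕ} (α : MultiIndex d) :
    ∏ i, ((α i : ℝ) + 1) ≤ ((α.length : ℝ) + 1) ^ d := by
  calc ∏ i, ((α i : ℝ) + 1) ≤ ∏ _i : Fin d, ((α.length : ℝ) + 1) := by
        refine Finset.prod_le_prod (fun i _ => by positivity) fun i _ => ?_
        have : (α i : ℝ) ≤ α.length := by exact_mod_cast length_coord_le α i
        linarith
    _ = _ := by simp

/-- The decay `e^{-r |α|^{1/(2s)}}` of condition (3). -/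
def decay {d : ℕ} (s r : ℝ) (α : MultiIndex d) : ℝ :=
  Real.exp (-r * (α.length : ℝ) ^ (1 / (2 * s)))

lemma decay_pos {d : ℕ} (s r : ℝ) (α : MultiIndex d) : 0 < decay s r α := Real.exp_pos _

lemma decay_add {d : ℕ} (s r t : ℝ) (α : MultiIndex d) :
    decay s (r + t) α = decay s r α * decay s t α := by
  rw [decay, decay, decay, ← Real.exp_add]; ring_nf

lemma exists_pow_mul_decay_le (d : ℕ) {s ε : ℝ} (hs : 0 < s) (hε : 0 < ε) (k : ℕ) :
    ∃ C : ℝ, 0 < C ∧ ∀ α : MultiIndex d, ((α.length : ℝ) + 1) ^ k * decay s ε α ≤ C := by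
  obtain ⟨C, hC, h⟩ := exists_succ_pow_le_exp hs hε k
  refine ⟨C, hC, fun α => ?_⟩
  have := h α.length
  rwa [decay, neg_mul, Real.exp_neg, ← div_eq_mul_inv, div_le_iff₀ (Real.exp_pos _)]

lemma summable_decay (d : ℕ) {s ε : ℝ} (hs : 0 < s) (hε : 0 < ε) :
    Summable fun α : MultiIndex d => decay s ε α := by
  -- The power 2d of |α|+1 dominates ∏ (α_i+1)², whose inverse is a product of convergent series.
  obtain ⟨C, hC, h⟩ := exists_pow_mul_decay_le d hs hε (d * 2)
  have h1 : Summable fun n : ℕ => (((n : ℝ) + 1) ^ 2)⁻¹ := by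
    have := (summable_nat_add_iff 1).2 (Real.summable_nat_pow_inv.2 (show 1 < 2 by norm_num))
    simpa using this
  have h2 : Summable fun α : MultiIndex d => ∏ i, (((α i : ℝ) + 1) ^ 2)⁻¹ :=
    (hasSum_multiIndex_prod (fun _ : Fin d => fun n : ℕ => (((n : ℝ) + 1) ^ 2)⁻¹) _
      (fun _ => h1.hasSum) fun _ => h1.norm).summable
  refine Summable.of_nonneg_of_le (fun α => (decay_pos _ _ _).le) (fun α => ?_) (h2.mul_left C)
  have h3 : ∏ i, ((α i : ℝ) + 1) ^ 2 ≤ ((α.length : ℝ) + 1) ^ (d * 2) := by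
    rw [Finset.prod_pow, pow_mul]
    exact pow_le_pow_left₀ (Finset.prod_nonneg fun i _ => by positivity) (prod_coord_succ_le α) 2
  have h4 : (0 : ℝ) < ∏ i, ((α i : ℝ) + 1) ^ 2 := Finset.prod_pos fun i _ => by positivity
  rw [Finset.prod_inv_distrib, ← div_eq_mul_inv, le_div_iff₀ h4, mul_comm]
  exact (mul_le_mul_of_nonneg_right h3 (decay_pos _ _ _).le).trans (h α)

/-! ### One-dimensional Hermite functions -/

/-- The derivatives of the Gaussian `e^{-t²}`. -/
def gaussDer (n : ℕ) (t : ℝ) : ℝ := iteratedDeriv n (fun u : ℝ => Real.exp (-u ^ 2)) t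

lemma hasDerivAt_gaussDer (n : ℕ) (t : ℝ) : HasDerivAt (gaussDer n) (gaussDer (n + 1) t) t := by
  have h : ContDiff ℝ ∞ (fun u : ℝ => Real.exp (-u ^ 2)) := by fun_prop
  have h1 : Differentiable ℝ (gaussDer n) :=
    h.differentiable_iteratedDeriv n (by exact_mod_cast WithTop.coe_lt_top n)
  have h2 : gaussDer (n + 1) t = deriv (gaussDer n) t := by
    simp only [gaussDer, iteratedDeriv_succ]
    rfl
  rw [h2]
  exact (h1 t).hasDerivAt

lemma gaussDer_zero (t : ℝ) : gaussDer 0 t = Real.exp (-t ^ 2) := by simp [gaussDer]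

lemma gaussDer_one (t : ℝ) : gaussDer 1 t = -2 * t * gaussDer 0 t := by
  have h1 := hasDerivAt_gaussDer 0 t
  have h2 : HasDerivAt (gaussDer 0) (Real.exp (-t ^ 2) * (-(2 * t))) t := by
    have : gaussDer 0 = fun t => Real.exp (-t ^ 2) := funext gaussDer_zero
    rw [this]
    simpa using ((hasDerivAt_pow 2 t).neg).exp
  rw [h1.unique h2, gaussDer_zero]
  ring

/-- The Hermite recursion, obtained by differentiating its previous instance; the start is g' = -2t
g. -/
lemma gaussDer_add_two (n : ℕ) (t : ℝ) :
    gaussDer (n + 2) t = -2 * t * gaussDer (n + 1) t - 2 * (n + 1) * gaussDer n t := by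
  induction n generalizing t with
  | zero =>
    have h1 := hasDerivAt_gaussDer 1 t
    have h2 : HasDerivAt (gaussDer 1) (-2 * gaussDer 0 t + -2 * t * gaussDer 1 t) t := by
      have : gaussDer 1 = fun t => -2 * t * gaussDer 0 t := funext gaussDer_one
      have h3 := ((hasDerivAt_id t).const_mul (-2)).mul (hasDerivAt_gaussDer 0 t)
      rw [mul_one] at h3
      nth_rw 1 [this]
      exact h3
    rw [h1.unique h2]
    push_cast
    ring
  | succ n ih =>
    have h1 := hasDerivAt_gaussDer (n + 2) t
    have h3 := (((hasDerivAt_id t).const_mul (-2)).mul (hasDerivAt_gaussDer (n + 1) t)).sub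
      ((hasDerivAt_gaussDer n t).const_mul (2 * ((n : ℝ) + 1)))
    have h4 : gaussDer (n + 2) = fun t => -2 * t * gaussDer (n + 1) t -
      2 * (n + 1) * gaussDer n t := funext ih
    rw [h4] at h1
    have := h1.unique h3
    rw [this]
    simp only [id]
    push_cast
    ring

/-- The normalizing constants of the Hermite functions. -/
def hermiteNorm (n : ℕ) : ℝ :=
  Real.pi ^ (-(1 / 4) : ℝ) * (-1) ^ n * (Real.sqrt (2 ^ n * n.factorial))⁻¹

lemma hermiteFun1_eq (n : ℕ) (t : ℝ) :
    hermiteFun1 n t = hermiteNorm n * Real.exp (t ^ 2 / 2) * gaussDer n t := rfl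

/-- The coefficient `√(2n)` in the ladder relations. -/
def ladder (n : ℕ) : ℝ := Real.sqrt (2 * n)

lemma ladder_zero : ladder 0 = 0 := by simp [ladder]

lemma ladder_nonneg (n : ℕ) : 0 ≤ ladder n := Real.sqrt_nonneg _

lemma ladder_succ_pos (n : ℕ) : 0 < ladder (n + 1) := by
  unfold ladder; positivity

lemma ladder_mul_self (n : ℕ) : ladder n * ladder n = 2 * n :=
  Real.mul_self_sqrt (by positivity)

lemma ladder_le (n : ℕ) : ladder n ≤ 2 * n := by
  rw [ladder, Real.sqrt_le_left (by positivity)]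
  rcases Nat.eq_zero_or_pos n with rfl | hn
  · simp
  · have : (1 : ℝ) ≤ n := by exact_mod_cast hn
    nlinarith

lemma hermiteNorm_succ (n : ℕ) : ladder (n + 1) * hermiteNorm (n + 1) = -hermiteNorm n := by
  have h1 : Real.sqrt (2 ^ (n + 1) * (n + 1).factorial) =
      ladder (n + 1) * Real.sqrt (2 ^ n * n.factorial) := by
    rw [ladder, ← Real.sqrt_mul (by positivity), Nat.factorial_succ]
    push_cast
    ring_nf
  have h2 := ladder_succ_pos n
  rw [hermiteNorm, hermiteNorm, h1]
  field_simp
  ring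

/-- The recursion of the Gaussian derivatives after normalization. At n = 0 the truncated index n -
1 is harmless, since its coefficient `ladder 0` vanishes; the same holds in the other ladder
formulas. -/
lemma hermiteFun1_rec (n : ℕ) (t : ℝ) :
    ladder (n + 1) * hermiteFun1 (n + 1) t =
      2 * t * hermiteFun1 n t - ladder n * hermiteFun1 (n - 1) t := by
  simp only [hermiteFun1_eq]
  have h1 := hermiteNorm_succ n
  cases n with
  | zero =>
    rw [ladder_zero, gaussDer_one]
    linear_combination (Real.exp (t ^ 2 / 2) * (-2 * t * gaussDer 0 t)) * h1
  | succ n =>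
    have h2 := hermiteNorm_succ n
    have h3 := ladder_mul_self (n + 1)
    rw [Nat.add_sub_cancel, gaussDer_add_two]
    push_cast at h3
    linear_combination (Real.exp (t ^ 2 / 2) *
      (-2 * t * gaussDer (n + 1) t - 2 * (n + 1) * gaussDer n t)) * h1 +
      ladder (n + 1) * Real.exp (t ^ 2 / 2) * gaussDer n t * h2 -
      hermiteNorm (n + 1) * Real.exp (t ^ 2 / 2) * gaussDer n t * h3

lemma hasDerivAt_hermiteFun1 (n : ℕ) (t : ℝ) :
    HasDerivAt (hermiteFun1 n) (t * hermiteFun1 n t - ladder (n + 1) * hermiteFun1 (n + 1) t) t := by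
  have h1 : HasDerivAt (fun t : ℝ => Real.exp (t ^ 2 / 2)) (Real.exp (t ^ 2 / 2) * t) t := by
    have := ((hasDerivAt_pow 2 t).div_const 2).exp
    simpa using this
  have h2 := (h1.const_mul (hermiteNorm n)).mul (hasDerivAt_gaussDer n t)
  refine h2.congr_deriv ?_
  simp only [hermiteFun1_eq]
  linear_combination (Real.exp (t ^ 2 / 2) * gaussDer (n + 1) t) * hermiteNorm_succ n

/-- The lowering form of the derivative; the preceding lemma is the raising form. Applying the
raising form first and then the lowering one gives the eigenvalue 2n+1, and pairing the two gives
orthogonality. -/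
lemma hasDerivAt_hermiteFun1' (n : ℕ) (t : ℝ) :
    HasDerivAt (hermiteFun1 n) (-t * hermiteFun1 n t + ladder n * hermiteFun1 (n - 1) t) t := by
  refine (hasDerivAt_hermiteFun1 n t).congr_deriv ?_
  linear_combination -hermiteFun1_rec n t

lemma deriv_hermiteFun1 (n : ℕ) : deriv (hermiteFun1 n) =
    fun t => 1 / 2 * (ladder n * hermiteFun1 (n - 1) t - ladder (n + 1) * hermiteFun1 (n + 1) t) := by
  funext t
  rw [(hasDerivAt_hermiteFun1 n t).deriv]
  linear_combination 1 / 2 * -hermiteFun1_rec n t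

lemma deriv_deriv_hermiteFun1 (n : ℕ) (t : ℝ) :
    deriv (deriv (hermiteFun1 n)) t = (t ^ 2 - (2 * n + 1)) * hermiteFun1 n t := by
  have h0 : deriv (hermiteFun1 n) = fun t => t * hermiteFun1 n t -
      ladder (n + 1) * hermiteFun1 (n + 1) t := funext fun t => (hasDerivAt_hermiteFun1 n t).deriv
  have h1 := ((hasDerivAt_id t).mul (hasDerivAt_hermiteFun1 n t)).sub
    ((hasDerivAt_hermiteFun1' (n + 1) t).const_mul (ladder (n + 1)))
  rw [h0]
  refine h1.deriv.trans ?_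
  have h3 := ladder_mul_self (n + 1)
  push_cast at h3
  simp only [id, Nat.add_sub_cancel]
  linear_combination -hermiteFun1 n t * h3

lemma contDiff_hermiteFun1 (n : ℕ) : ContDiff ℝ ∞ (hermiteFun1 n) := by
  have h : ContDiff ℝ ∞ (fun u : ℝ => Real.exp (-u ^ 2)) := by fun_prop
  have h1 : ContDiff ℝ ∞ (iteratedDeriv n (fun u : ℝ => Real.exp (-u ^ 2))) := by
    rw [iteratedDeriv_eq_iterate]
    exact ContDiff.iterate_deriv n h
  unfold hermiteFun1
  fun_prop

lemma continuous_hermiteFun1 (n : ℕ) : Continuous (hermiteFun1 n) :=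
  (contDiff_hermiteFun1 n).continuous

/-- The complex Gaussian `e^{-u²}`. -/
def cgauss (u : ℂ) : ℂ := Complex.exp (-u ^ 2)

lemma differentiable_cgauss : Differentiable ℂ cgauss := by unfold cgauss; fun_prop

lemma iteratedDeriv_cgauss_ofReal (n : ℕ) (t : ℝ) :
    iteratedDeriv n cgauss (t : ℂ) = (gaussDer n t : ℂ) := by
  induction n generalizing t with
  | zero => simp [gaussDer, cgauss]
  | succ n ih =>
    have h : ContDiff ℂ ∞ cgauss := differentiable_cgauss.contDiff
    have h1 : HasDerivAt (iteratedDeriv n cgauss) (iteratedDeriv (n + 1) cgauss t) (t : ℂ) := by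
      rw [iteratedDeriv_succ]
      exact ((h.differentiable_iteratedDeriv n (by exact_mod_cast WithTop.coe_lt_top n)) _).hasDerivAt
    have h2 := h1.comp_ofReal
    have h3 := (hasDerivAt_gaussDer n t).ofReal_comp
    have h4 : (fun y : ℝ => iteratedDeriv n cgauss (y : ℂ)) = fun y => (gaussDer n y : ℂ) :=
      funext ih
    rw [h4] at h2
    exact h2.unique h3

/-- With u = a + ib and R² = (a-y)² + b², the difference of the two exponents is (2a-y)²/2 ≥ 0. -/
lemma norm_cgauss_le {y R : ℝ} {u : ℂ} (hu : u ∈ Metric.sphere (y : ℂ) R) :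
    ‖cgauss u‖ ≤ Real.exp (-(y ^ 2 / 2)) * Real.exp (R ^ 2) := by
  rw [cgauss, Complex.norm_exp, ← Real.exp_add, Real.exp_le_exp]
  rw [mem_sphere_iff_norm] at hu
  have h1 : R ^ 2 = (u.re - y) ^ 2 + u.im ^ 2 := by
    rw [← hu, ← Complex.normSq_eq_norm_sq, Complex.normSq_apply]
    simp
    ring
  have h2 : (-u ^ 2).re = -(u.re ^ 2) + u.im ^ 2 := by
    rw [sq, Complex.neg_re, Complex.mul_re]; ring
  rw [h1, h2]
  nlinarith [sq_nonneg (2 * u.re - y)]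

lemma abs_gaussDer_le (n : ℕ) (t : ℝ) {R : ℝ} (hR : 0 < R) :
    |gaussDer n t| ≤ n.factorial * (Real.exp (-(t ^ 2 / 2)) * Real.exp (R ^ 2)) / R ^ n := by
  have := Complex.norm_iteratedDeriv_le_of_forall_mem_sphere_norm_le n hR
    (differentiable_cgauss.diffContOnCl (s := Metric.ball (t : ℂ) R)) fun z hz => norm_cgauss_le hz
  rwa [iteratedDeriv_cgauss_ofReal, Complex.norm_real] at this

lemma pi_rpow_le_one : Real.pi ^ (-(1 / 4) : ℝ) ≤ 1 :=
  Real.rpow_le_one_of_one_le_of_nonpos (by linarith [Real.pi_gt_three]) (by norm_num)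

/-- Cauchy's estimate for the derivatives of the Gaussian, combined with Stirling: the factors
e^{±t²/2} cancel and n! e^n/n^n remains. Linear growth in n is far from sharp but sufficient. -/
lemma abs_hermiteFun1_le (n : ℕ) (t : ℝ) : |hermiteFun1 n t| ≤ 3 * ((n : ℝ) + 1) := by
  have hpi : 0 < Real.pi ^ (-(1 / 4) : ℝ) := Real.rpow_pos_of_pos Real.pi_pos _
  have hexp : Real.exp 1 ≤ 3 := by linarith [Real.exp_one_lt_d9]
  have key : hermiteFun1 n t ^ 2 ≤ Real.exp 1 * (n + 1) := by
    rcases Nat.eq_zero_or_pos n with rfl | hn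
    · have h1 : hermiteFun1 0 t ^ 2 ≤ 1 := by
        have : |hermiteFun1 0 t| ≤ 1 := by
          simp only [hermiteFun1, iteratedDeriv_zero, pow_zero, Nat.factorial_zero, Nat.cast_one,
            mul_one, Real.sqrt_one, inv_one]
          rw [mul_assoc, ← Real.exp_add, abs_of_nonneg (by positivity)]
          have h2 : Real.exp (t ^ 2 / 2 + -t ^ 2) ≤ 1 := by
            rw [Real.exp_le_one_iff]; nlinarith [sq_nonneg t]
          exact mul_le_one₀ pi_rpow_le_one (Real.exp_pos _).le h2
        rw [← sq_abs]
        exact pow_le_one₀ (abs_nonneg _) this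
      have := Real.add_one_le_exp (1 : ℝ)
      norm_num
      linarith
    · have hn' : (0 : ℝ) < n := by exact_mod_cast hn
      -- This radius minimizes e^{R²}/R^n. It vanishes for n = 0, which is why that case is treated
      -- apart.
      set R : ℝ := Real.sqrt (n / 2) with hRdef
      have hR : 0 < R := Real.sqrt_pos.2 (by positivity)
      have hR2 : R ^ 2 = n / 2 := Real.sq_sqrt (by positivity)
      have h1 := abs_gaussDer_le n t hR
      have h2 : gaussDer n t ^ 2 ≤
          (n.factorial * (Real.exp (-(t ^ 2 / 2)) * Real.exp (R ^ 2)) / R ^ n) ^ 2 := by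
        rw [← sq_abs]
        gcongr
      have h3 : hermiteFun1 n t ^ 2 = (Real.pi ^ (-(1 / 4) : ℝ)) ^ 2 * (2 ^ n * (n.factorial : ℝ))⁻¹ *
          Real.exp (t ^ 2 / 2) ^ 2 * gaussDer n t ^ 2 := by
        rw [hermiteFun1_eq, hermiteNorm]
        simp only [mul_pow, inv_pow]
        rw [Real.sq_sqrt (by positivity), ← pow_mul, mul_comm n 2, pow_mul]
        norm_num
      have h5 : (R ^ n) ^ 2 = (n : ℝ) ^ n / 2 ^ n := by
        rw [← pow_mul, mul_comm n 2, pow_mul, hR2, div_pow]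
      have h6 : Real.exp (R ^ 2) ^ 2 = Real.exp n := by
        rw [← Real.exp_nat_mul, hR2]; push_cast; ring_nf
      have h7 : Real.exp (t ^ 2 / 2) * Real.exp (-(t ^ 2 / 2)) = 1 := by
        rw [← Real.exp_add, add_neg_cancel, Real.exp_zero]
      have h8 : (Real.pi ^ (-(1 / 4) : ℝ)) ^ 2 ≤ 1 := pow_le_one₀ hpi.le pi_rpow_le_one
      have h9 := factorial_mul_exp_le n
      rw [h3]
      calc _ ≤ 1 * (2 ^ n * (n.factorial : ℝ))⁻¹ * Real.exp (t ^ 2 / 2) ^ 2 *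
            (n.factorial * (Real.exp (-(t ^ 2 / 2)) * Real.exp (R ^ 2)) / R ^ n) ^ 2 := by gcongr
        _ = (Real.exp (t ^ 2 / 2) * Real.exp (-(t ^ 2 / 2))) ^ 2 * (2 ^ n * (n.factorial : ℝ))⁻¹ *
            n.factorial ^ 2 * Real.exp (R ^ 2) ^ 2 / (R ^ n) ^ 2 := by ring
        _ = n.factorial * Real.exp n / (n : ℝ) ^ n := by
            rw [h7, h6, h5]; field_simp
        _ ≤ _ := by rw [div_le_iff₀ (by positivity)]; exact h9
  have hn0 : (0 : ℝ) ≤ n := by positivity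
  refine abs_le_of_sq_le_sq (key.trans ?_) (by positivity)
  nlinarith

/-- By the recursion, a factor t is traded for the two neighbouring indices with coefficients
O(n+1), so it costs one power of n+1. -/
lemma exists_pow_mul_hermiteFun1_le (k : ℕ) :
    ∃ C : ℝ, 0 < C ∧ ∀ n t, |t| ^ k * |hermiteFun1 n t| ≤ C * ((n : ℝ) + 1) ^ (k + 1) := by
  induction k with
  | zero => exact ⟨3, by norm_num, fun n t => by simpa using abs_hermiteFun1_le n t⟩
  | succ k ih =>
    obtain ⟨C, hC, h⟩ := ih
    refine ⟨C * 2 ^ (k + 1) + C, by positivity, fun n t => ?_⟩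
    have h1 : t * hermiteFun1 n t = (ladder (n + 1) * hermiteFun1 (n + 1) t +
        ladder n * hermiteFun1 (n - 1) t) / 2 := by
      linear_combination -hermiteFun1_rec n t / 2
    have hn0 : (0 : ℝ) ≤ n := by positivity
    have h2 : |t| ^ (k + 1) * |hermiteFun1 n t| ≤ (ladder (n + 1) * (|t| ^ k * |hermiteFun1 (n + 1) t|)
        + ladder n * (|t| ^ k * |hermiteFun1 (n - 1) t|)) / 2 := by
      rw [pow_succ, mul_assoc, ← abs_mul, h1, abs_div, abs_two]
      have := abs_add_le (ladder (n + 1) * hermiteFun1 (n + 1) t) (ladder n * hermiteFun1 (n - 1) t)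
      rw [abs_mul, abs_mul, abs_of_nonneg (ladder_nonneg _), abs_of_nonneg (ladder_nonneg _)] at this
      have h3 := mul_le_mul_of_nonneg_left this (pow_nonneg (abs_nonneg t) k)
      linarith
    have h3 := h (n + 1) t
    have h4 := h (n - 1) t
    have h5 : (((n + 1 : ℕ) : ℝ) + 1) ^ (k + 1) ≤ 2 ^ (k + 1) * ((n : ℝ) + 1) ^ (k + 1) := by
      rw [← mul_pow]
      gcongr
      push_cast
      linarith
    have h6 : (((n - 1 : ℕ) : ℝ) + 1) ^ (k + 1) ≤ ((n : ℝ) + 1) ^ (k + 1) := by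
      gcongr
      exact Nat.sub_le n 1
    have h7 := ladder_le (n + 1)
    push_cast at h7
    have h8 : ladder n ≤ 2 * (n + 1) := (ladder_le n).trans (by linarith)
    calc _ ≤ _ := h2
      _ ≤ (2 * (n + 1) * (C * (2 ^ (k + 1) * ((n : ℝ) + 1) ^ (k + 1))) +
          2 * (n + 1) * (C * ((n : ℝ) + 1) ^ (k + 1))) / 2 := by
          gcongr ?_ / 2
          exact add_le_add
            (mul_le_mul h7 (h3.trans (mul_le_mul_of_nonneg_left h5 hC.le)) (by positivity)
              (by positivity))
            (mul_le_mul h8 (h4.trans (mul_le_mul_of_nonneg_left h6 hC.le)) (by positivity)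
              (by positivity))
      _ = _ := by ring

/-- Adding the bounds for the weights t^k and t^{k+2} produces the integrable factor (1+t²)^{-1}. -/
lemma exists_pow_mul_hermiteFun1_le' (k : ℕ) :
    ∃ C : ℝ, 0 < C ∧ ∀ n t, |t ^ k * hermiteFun1 n t| ≤
      C * ((n : ℝ) + 1) ^ (k + 3) * (1 + t ^ 2)⁻¹ := by
  obtain ⟨C, hC, h⟩ := exists_pow_mul_hermiteFun1_le k
  obtain ⟨D, hD, h'⟩ := exists_pow_mul_hermiteFun1_le (k + 2)
  refine ⟨C + D, by positivity, fun n t => ?_⟩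
  rw [← div_eq_mul_inv, le_div_iff₀ (by positivity), abs_mul, abs_pow]
  have h1 := h n t
  have h2 := h' n t
  have h3 : ((n : ℝ) + 1) ^ (k + 1) ≤ ((n : ℝ) + 1) ^ (k + 3) :=
    pow_le_pow_right₀ (by linarith [n.cast_nonneg (α := ℝ)]) (by omega)
  have h4 : C * ((n : ℝ) + 1) ^ (k + 1) ≤ C * ((n : ℝ) + 1) ^ (k + 3) := by gcongr
  rw [pow_add _ k 2, sq_abs] at h2
  nlinarith

lemma integrable_pow_mul_hermiteFun1 (k n : ℕ) :
    MeasureTheory.Integrable fun t : ℝ => t ^ k * hermiteFun1 n t := by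
  obtain ⟨C, hC, h⟩ := exists_pow_mul_hermiteFun1_le' k
  refine (integrable_inv_one_add_sq.const_mul (C * ((n : ℝ) + 1) ^ (k + 3))).mono'
    ((continuous_pow k).mul (continuous_hermiteFun1 n)).aestronglyMeasurable ?_
  exact .of_forall fun t => h n t

lemma integrable_hermiteFun1 (n : ℕ) : MeasureTheory.Integrable (hermiteFun1 n) := by
  simpa using integrable_pow_mul_hermiteFun1 0 n

lemma exists_integral_abs_hermiteFun1_le :
    ∃ C : ℝ, 0 < C ∧ ∀ n, ∫ t, |hermiteFun1 n t| ≤ C * ((n : ℝ) + 1) ^ 3 := by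
  obtain ⟨C, hC, h⟩ := exists_pow_mul_hermiteFun1_le' 0
  refine ⟨C * Real.pi, by positivity, fun n => ?_⟩
  calc ∫ t, |hermiteFun1 n t| ≤ ∫ t : ℝ, C * ((n : ℝ) + 1) ^ 3 * (1 + t ^ 2)⁻¹ := by
        refine MeasureTheory.integral_mono (integrable_hermiteFun1 n).abs
          (integrable_inv_one_add_sq.const_mul _) fun t => ?_
        simpa using h n t
    _ = _ := by rw [MeasureTheory.integral_const_mul, integral_univ_inv_one_add_sq]; ring

/-! ### Orthonormality of the Hermite functions on the line -/

lemma integrable_hermiteFun1_mul (m n : ℕ) :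
    MeasureTheory.Integrable fun t : ℝ => hermiteFun1 m t * hermiteFun1 n t :=
  (integrable_hermiteFun1 n).bdd_mul (continuous_hermiteFun1 m).aestronglyMeasurable
    (.of_forall fun t => abs_hermiteFun1_le m t)

/-- The derivative of h_m h_n has integral zero; it is expanded by lowering h_m and raising h_n.
This relation shifts both indices by one and yields orthonormality by induction. -/
lemma ladder_integral (m n : ℕ) :
    ladder m * ∫ t, hermiteFun1 (m - 1) t * hermiteFun1 n t =
      ladder (n + 1) * ∫ t, hermiteFun1 m t * hermiteFun1 (n + 1) t := by
  have h1 : ∀ t, HasDerivAt (fun t => hermiteFun1 m t * hermiteFun1 n t)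
      (ladder m * (hermiteFun1 (m - 1) t * hermiteFun1 n t) -
        ladder (n + 1) * (hermiteFun1 m t * hermiteFun1 (n + 1) t)) t := fun t => by
    refine ((hasDerivAt_hermiteFun1' m t).mul (hasDerivAt_hermiteFun1 n t)).congr_deriv ?_
    ring
  have i1 := (integrable_hermiteFun1_mul (m - 1) n).const_mul (ladder m)
  have i2 := (integrable_hermiteFun1_mul m (n + 1)).const_mul (ladder (n + 1))
  have h2 := MeasureTheory.integral_eq_zero_of_hasDerivAt_of_integrable h1 (i1.sub i2)
    (integrable_hermiteFun1_mul m n)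
  rw [MeasureTheory.integral_sub i1 i2, MeasureTheory.integral_const_mul,
    MeasureTheory.integral_const_mul] at h2
  linarith

lemma integral_hermiteFun1_zero : ∫ t, hermiteFun1 0 t * hermiteFun1 0 t = 1 := by
  have h1 : ∀ t, hermiteFun1 0 t * hermiteFun1 0 t =
      Real.pi ^ (-(1 / 2) : ℝ) * Real.exp (-1 * t ^ 2) := fun t => by
    simp only [hermiteFun1, iteratedDeriv_zero, pow_zero, Nat.factorial_zero, Nat.cast_one,
      mul_one, Real.sqrt_one, inv_one]
    have e1 : Real.pi ^ (-(1 / 2) : ℝ) = Real.pi ^ (-(1 / 4) : ℝ) * Real.pi ^ (-(1 / 4) : ℝ) := by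
      rw [← Real.rpow_add Real.pi_pos]; norm_num
    have e2 : Real.exp (-1 * t ^ 2) = (Real.exp (t ^ 2 / 2) * Real.exp (-t ^ 2)) *
        (Real.exp (t ^ 2 / 2) * Real.exp (-t ^ 2)) := by
      simp only [← Real.exp_add]; ring_nf
    rw [e1, e2]
    ring
  simp only [h1]
  rw [MeasureTheory.integral_const_mul, integral_gaussian, div_one, Real.sqrt_eq_rpow,
    ← Real.rpow_add Real.pi_pos]
  norm_num

lemma integral_hermiteFun1_mul (m n : ℕ) :
    ∫ t, hermiteFun1 m t * hermiteFun1 n t = if m = n then 1 else 0 := by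
  have h0 : ∀ n, ∫ t, hermiteFun1 0 t * hermiteFun1 (n + 1) t = 0 := fun n => by
    have := ladder_integral 0 n
    rw [ladder_zero, zero_mul] at this
    exact (mul_eq_zero.1 this.symm).resolve_left (ladder_succ_pos n).ne'
  induction n generalizing m with
  | zero =>
    cases m with
    | zero => simpa using integral_hermiteFun1_zero
    | succ m =>
      rw [if_neg (by omega), ← h0 m]
      simp only [mul_comm]
  | succ n ih =>
    cases m with
    | zero => rw [if_neg (by omega), h0 n]
    | succ m =>
      have h1 := ladder_integral (m + 1) n
      rw [Nat.add_sub_cancel, ih m] at h1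
      by_cases hmn : m = n
      · subst hmn
        rw [if_pos rfl]
        rw [if_pos rfl] at h1
        exact (mul_left_cancel₀ (ladder_succ_pos m).ne' h1).symm
      · rw [if_neg (by omega)]
        rw [if_neg hmn, mul_zero] at h1
        exact (mul_eq_zero.1 h1.symm).resolve_left (ladder_succ_pos n).ne'

/-- The one-dimensional Bargmann kernel. -/
def kernel1 (w : ℂ) (y : ℝ) : ℂ :=
  ((Real.pi ^ (-(1 / 4) : ℝ) : ℝ) : ℂ) *
    Complex.exp (-(1 / 2) * (w * w + (y : ℂ) ^ 2) + ((Real.sqrt 2 : ℝ) : ℂ) * (w * y))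

/-- The generating function of the Hermite functions: the Taylor series of e^{-u²} about y,
evaluated at u = y - w/√2, and multiplied by π^{-1/4}e^{y²/2}. -/
lemma hasSum_kernel1 (w : ℂ) (y : ℝ) :
    HasSum (fun n : ℕ => (hermiteFun1 n y : ℂ) * (w ^ n / (Real.sqrt n.factorial : ℂ)))
      (kernel1 w y) := by
  have h2 : ((Real.sqrt 2 : ℝ) : ℂ) * ((Real.sqrt 2 : ℝ) : ℂ) = 2 := by
    rw [← Complex.ofReal_mul, Real.mul_self_sqrt (by norm_num)]; norm_num
  have h20 : ((Real.sqrt 2 : ℝ) : ℂ) ≠ 0 := by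
    intro h; rw [h] at h2; norm_num at h2
  have h := Complex.hasSum_taylorSeries_of_entire differentiable_cgauss (y : ℂ)
    (y - w / (Real.sqrt 2 : ℝ))
  have h1 := h.mul_left (((Real.pi ^ (-(1 / 4) : ℝ) : ℝ) : ℂ) * Complex.exp ((y : ℂ) ^ 2 / 2))
  have e1 : ((Real.pi ^ (-(1 / 4) : ℝ) : ℝ) : ℂ) * Complex.exp ((y : ℂ) ^ 2 / 2) *
      cgauss (y - w / (Real.sqrt 2 : ℝ)) = kernel1 w y := by
    rw [kernel1, cgauss, mul_assoc, ← Complex.exp_add]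
    congr 2
    field_simp
    rw [show ((Real.sqrt 2 : ℝ) : ℂ) ^ 2 = 2 by rw [sq, h2]]
    linear_combination (-2 * (y : ℂ) ^ 2) * h2
  rw [e1] at h1
  refine h1.congr_fun fun n => ?_
  rw [iteratedDeriv_cgauss_ofReal, hermiteFun1_eq, hermiteNorm]
  have e2 : ((Real.sqrt (2 ^ n * n.factorial) : ℝ) : ℂ) =
      ((Real.sqrt 2 : ℝ) : ℂ) ^ n * (Real.sqrt n.factorial : ℂ) := by
    have : Real.sqrt (2 ^ n) = Real.sqrt 2 ^ n := by
      rw [Real.sqrt_eq_iff_mul_self_eq (by positivity) (by positivity), ← mul_pow,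
        Real.mul_self_sqrt (by norm_num)]
    rw [Real.sqrt_mul (by positivity), this, Complex.ofReal_mul, Complex.ofReal_pow]
  have e3 : (n.factorial : ℂ) = (Real.sqrt n.factorial : ℂ) * (Real.sqrt n.factorial : ℂ) := by
    rw [← Complex.ofReal_mul, Real.mul_self_sqrt (by positivity)]; norm_num
  have e4 : (Real.sqrt n.factorial : ℂ) ≠ 0 := by
    have : Real.sqrt n.factorial ≠ 0 := Real.sqrt_ne_zero'.2 (by positivity)
    exact_mod_cast this
  have e5 : (y : ℂ) - w / ((Real.sqrt 2 : ℝ) : ℂ) - y = -1 * w / ((Real.sqrt 2 : ℝ) : ℂ) := by ring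
  simp only [smul_eq_mul]
  rw [e5, div_pow, mul_pow]
  push_cast
  rw [e2, e3]
  field_simp

/-! ### Functions that are products over the coordinates -/

/-- The product `∏ k_i(x_i)`. -/
def prodFun {d : ℕ} (k : Fin d → ℝ → ℝ) (x : RSpace d) : ℝ := ∏ i, k i (x i)

lemma prodFun_update {d : ℕ} (k : Fin d → ℝ → ℝ) (i : Fin d) (u : ℝ → ℝ) (x : RSpace d) :
    prodFun (Function.update k i u) x = u (x i) * ∏ j ∈ Finset.univ.erase i, k j (x j) := by
  rw [prodFun, ← Finset.mul_prod_erase _ _ (Finset.mem_univ i), Function.update_self]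
  congr 1
  refine Finset.prod_congr rfl fun j hj => ?_
  rw [Function.update_of_ne (Finset.ne_of_mem_erase hj)]

lemma prodFun_eq_mul {d : ℕ} (k : Fin d → ℝ → ℝ) (i : Fin d) (x : RSpace d) :
    prodFun k x = k i (x i) * ∏ j ∈ Finset.univ.erase i, k j (x j) := by
  rw [prodFun, ← Finset.mul_prod_erase _ _ (Finset.mem_univ i)]

lemma hasFDerivAt_prodFun {d : ℕ} {k : Fin d → ℝ → ℝ} (hk : ∀ i, Differentiable ℝ (k i))
    (x : RSpace d) :
    HasFDerivAt (prodFun k) (∑ i, prodFun (Function.update k i (deriv (k i))) x •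
      (EuclideanSpace.proj i : RSpace d →L[ℝ] ℝ)) x := by
  have h1 : ∀ i ∈ Finset.univ, HasFDerivAt (fun x : RSpace d => k i (x i))
      (deriv (k i) (x i) • (EuclideanSpace.proj i : RSpace d →L[ℝ] ℝ)) x := fun i _ =>
    HasDerivAt.comp_hasFDerivAt (f := fun x : RSpace d => x i) x (hk i (x i)).hasDerivAt
      (EuclideanSpace.proj i : RSpace d →L[ℝ] ℝ).hasFDerivAt
  refine (HasFDerivAt.finsetProd h1).congr_fderiv ?_
  refine Finset.sum_congr rfl fun i _ => ?_
  rw [prodFun_update, smul_smul, mul_comm]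

lemma contDiff_prodFun {d : ℕ} {n : ℕ∞} {k : Fin d → ℝ → ℝ} (hk : ∀ i, ContDiff ℝ n (k i)) :
    ContDiff ℝ n (prodFun k) := by
  refine contDiff_prod fun i _ => ?_
  exact (hk i).comp (EuclideanSpace.proj i : RSpace d →L[ℝ] ℝ).contDiff

/-- The directional derivative along the `i`-th coordinate. -/
def partialDeriv {d : ℕ} (i : Fin d) (f : RSpace d → ℂ) (x : RSpace d) : ℂ :=
  fderiv ℝ f x (EuclideanSpace.single i 1)

lemma contDiff_partialDeriv {d : ℕ} (i : Fin d) {f : RSpace d → ℂ} (hf : ContDiff ℝ ∞ f) :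
    ContDiff ℝ ∞ (partialDeriv i f) :=
  (hf.fderiv_right (m := ∞) (by norm_cast)).clm_apply contDiff_const

lemma laplacian_eq_sum_partialDeriv {d : ℕ} {f : RSpace d → ℂ} (hf : ContDiff ℝ ∞ f)
    (x : RSpace d) : (Δ f) x = ∑ i, partialDeriv i (partialDeriv i f) x := by
  rw [InnerProductSpace.laplacian_eq_iteratedFDeriv_orthonormalBasis f
      (EuclideanSpace.basisFun (Fin d) ℝ)]
  refine Finset.sum_congr rfl fun i _ => ?_
  have h1 : DifferentiableAt ℝ (fderiv ℝ f) x :=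
    ((hf.fderiv_right (m := ∞) (by norm_cast)).differentiable (by norm_num)) x
  rw [iteratedFDeriv_two_apply]
  simp only [partialDeriv, EuclideanSpace.basisFun_apply, Matrix.cons_val_zero,
    Matrix.cons_val_one]
  change _ = fderiv ℝ (fun y => fderiv ℝ f y (EuclideanSpace.single i 1)) x _
  rw [fderiv_clm_apply h1 (differentiableAt_const _)]
  simp

/-- A product function with values in `ℂ`. -/
def cprodFun {d : ℕ} (k : Fin d → ℝ → ℝ) (x : RSpace d) : ℂ := (prodFun k x : ℂ)

lemma contDiff_cprodFun {d : ℕ} {n : ℕ∞} {k : Fin d → ℝ → ℝ} (hk : ∀ i, ContDiff ℝ n (k i)) :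
    ContDiff ℝ n (cprodFun k) := Complex.ofRealCLM.contDiff.comp (contDiff_prodFun hk)

lemma fderiv_cprodFun {d : ℕ} {k : Fin d → ℝ → ℝ} (hk : ∀ i, Differentiable ℝ (k i))
    (x : RSpace d) :
    HasFDerivAt (cprodFun k) (∑ i, (cprodFun (Function.update k i (deriv (k i))) x) •
      (Complex.ofRealCLM ∘L (EuclideanSpace.proj i : RSpace d →L[ℝ] ℝ))) x := by
  refine (Complex.ofRealCLM.hasFDerivAt.comp x (hasFDerivAt_prodFun hk x)).congr_fderiv ?_
  ext v
  simp [cprodFun]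

lemma partialDeriv_cprodFun {d : ℕ} {k : Fin d → ℝ → ℝ} (hk : ∀ i, Differentiable ℝ (k i))
    (i : Fin d) : partialDeriv i (cprodFun k) = cprodFun (Function.update k i (deriv (k i))) := by
  funext x
  rw [partialDeriv, (fderiv_cprodFun hk x).fderiv, sum_apply,
    Finset.sum_eq_single i]
  · simp
  · intro j _ hj
    simp [hj]
  · simp

lemma partialDeriv_partialDeriv_cprodFun {d : ℕ} {k : Fin d → ℝ → ℝ}
    (hk : ∀ i, ContDiff ℝ ∞ (k i)) (i : Fin d) :
    partialDeriv i (partialDeriv i (cprodFun k)) =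
      cprodFun (Function.update k i (deriv (deriv (k i)))) := by
  have h1 : ∀ i, Differentiable ℝ (k i) := fun i => (hk i).differentiable (by norm_num)
  have h2 : Differentiable ℝ (deriv (k i)) := by
    have := (hk i).iterate_deriv 1
    exact this.differentiable (by norm_num)
  rw [partialDeriv_cprodFun h1, partialDeriv_cprodFun, Function.update_self,
    Function.update_idem]
  intro j
  by_cases hj : j = i
  · subst hj; rwa [Function.update_self]
  · rw [Function.update_of_ne hj]; exact h1 j

lemma laplacian_cprodFun {d : ℕ} {k : Fin d → ℝ → ℝ} (hk : ∀ i, ContDiff ℝ ∞ (k i))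
    (x : RSpace d) :
    (Δ (cprodFun k)) x = ∑ i, cprodFun (Function.update k i (deriv (deriv (k i)))) x := by
  rw [laplacian_eq_sum_partialDeriv (contDiff_cprodFun hk)]
  exact Finset.sum_congr rfl fun i _ => by rw [partialDeriv_partialDeriv_cprodFun hk]

lemma integrable_prodFun {d : ℕ} {k : Fin d → ℝ → ℝ}
    (hk : ∀ i, MeasureTheory.Integrable (k i)) : MeasureTheory.Integrable (prodFun k) := by
  have h := MeasureTheory.Integrable.fintype_prod (f := k) hk
  exact ((PiLp.volume_preserving_ofLp (Fin d)).integrable_comp_emb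
    (MeasurableEquiv.toLp 2 (Fin d → ℝ)).symm.measurableEmbedding).2 h

lemma integral_prodFun {d : ℕ} (k : Fin d → ℝ → ℝ) :
    ∫ x, prodFun k x = ∏ i, ∫ t, k i t := by
  rw [← MeasureTheory.integral_fintype_prod_volume_eq_prod (f := k)]
  exact (PiLp.volume_preserving_ofLp (Fin d)).integral_comp
    (MeasurableEquiv.toLp 2 (Fin d → ℝ)).symm.measurableEmbedding (fun a => ∏ i, k i (a i))

/-! ### Hermite functions in several variables -/

/-- The Hermite function with values in `ℂ`. -/
def chermite {d : ℕ} (α : MultiIndex d) : RSpace d → ℂ := cprodFun fun i => hermiteFun1 (α i)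

lemma chermite_apply {d : ℕ} (α : MultiIndex d) (x : RSpace d) :
    chermite α x = (hermiteFun α x : ℂ) := rfl

lemma contDiff_chermite {d : ℕ} (α : MultiIndex d) : ContDiff ℝ ∞ (chermite α) :=
  contDiff_cprodFun fun i => contDiff_hermiteFun1 (α i)

lemma harmOsc_chermite {d : ℕ} (α : MultiIndex d) :
    harmOsc (chermite α) = ((2 * α.length + d : ℕ) : ℂ) • chermite α := by
  funext x
  have h1 : ∀ i, cprodFun (Function.update (fun i => hermiteFun1 (α i)) i
      (deriv (deriv (hermiteFun1 (α i))))) x = (((x i) ^ 2 - (2 * α i + 1) : ℝ) : ℂ) *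
        chermite α x := fun i => by
    rw [chermite, cprodFun, cprodFun, ← Complex.ofReal_mul, prodFun_update,
      deriv_deriv_hermiteFun1, prodFun_eq_mul _ i]
    ring_nf
  rw [harmOsc, chermite, laplacian_cprodFun fun i => contDiff_hermiteFun1 (α i)]
  rw [Finset.sum_congr rfl fun i _ => h1 i, ← Finset.sum_mul, ← Complex.ofReal_sum,
    Finset.sum_sub_distrib, ← EuclideanSpace.real_norm_sq_eq, Finset.sum_add_distrib,
    ← Finset.mul_sum]
  simp only [Pi.smul_apply, smul_eq_mul, MultiIndex.length, chermite]
  push_cast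
  simp
  ring

lemma abs_hermiteFun_le {d : ℕ} (α : MultiIndex d) (x : RSpace d) :
    |hermiteFun α x| ≤ 3 ^ d * ((α.length : ℝ) + 1) ^ d := by
  rw [hermiteFun, Finset.abs_prod]
  calc _ ≤ ∏ i, (3 * ((α i : ℝ) + 1)) :=
        Finset.prod_le_prod (fun i _ => abs_nonneg _) fun i _ => abs_hermiteFun1_le _ _
    _ = 3 ^ d * ∏ i, ((α i : ℝ) + 1) := by simp [Finset.prod_mul_distrib]
    _ ≤ _ := by gcongr; exact prod_coord_succ_le α

lemma norm_chermite_le {d : ℕ} (α : MultiIndex d) (x : RSpace d) :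
    ‖chermite α x‖ ≤ 3 ^ d * ((α.length : ℝ) + 1) ^ d := by
  rw [chermite_apply, Complex.norm_real]
  exact abs_hermiteFun_le α x

lemma integrable_hermiteFun {d : ℕ} (α : MultiIndex d) :
    MeasureTheory.Integrable (hermiteFun α) :=
  integrable_prodFun fun i => integrable_hermiteFun1 (α i)

lemma exists_integral_abs_hermiteFun_le (d : ℕ) :
    ∃ C : ℝ, 0 < C ∧ ∀ α : MultiIndex d,
      ∫ x, |hermiteFun α x| ≤ C * ((α.length : ℝ) + 1) ^ (d * 3) := by
  obtain ⟨C, hC, h⟩ := exists_integral_abs_hermiteFun1_le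
  refine ⟨C ^ d, by positivity, fun α => ?_⟩
  have h1 : (fun x => |hermiteFun α x|) = prodFun fun i t => |hermiteFun1 (α i) t| := by
    funext x; rw [hermiteFun, Finset.abs_prod]; rfl
  rw [h1, integral_prodFun]
  calc _ ≤ ∏ i, (C * ((α i : ℝ) + 1) ^ 3) :=
        Finset.prod_le_prod (fun i _ => MeasureTheory.integral_nonneg fun t => abs_nonneg _)
          fun i _ => h _
    _ = C ^ d * (∏ i, ((α i : ℝ) + 1)) ^ 3 := by
        simp [Finset.prod_mul_distrib, Finset.prod_pow]
    _ ≤ _ := by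
        rw [pow_mul]
        gcongr
        exact prod_coord_succ_le α

lemma integral_hermiteFun_mul {d : ℕ} (α β : MultiIndex d) :
    ∫ x, hermiteFun α x * hermiteFun β x = if α = β then 1 else 0 := by
  have h1 : (fun x => hermiteFun α x * hermiteFun β x) =
      prodFun fun i t => hermiteFun1 (α i) t * hermiteFun1 (β i) t := by
    funext x; simp [hermiteFun, prodFun, Finset.prod_mul_distrib]
  rw [h1, integral_prodFun]
  simp only [integral_hermiteFun1_mul]
  split_ifs with h
  · subst h; simp
  · obtain ⟨i, hi⟩ : ∃ i, α i ≠ β i := by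
      by_contra! hc
      exact h (Finsupp.ext hc)
    exact Finset.prod_eq_zero (Finset.mem_univ i) (if_neg hi)

/-- The multi-index with `i`-th entry replaced by `m`. -/
def setCoord {d : ℕ} (α : MultiIndex d) (i : Fin d) (m : ℕ) : MultiIndex d := Finsupp.update α i m

lemma length_setCoord_le {d : ℕ} (α : MultiIndex d) (i : Fin d) {m : ℕ} (hm : m ≤ α i + 1) :
    (setCoord α i m).length ≤ α.length + 1 := by
  rw [MultiIndex.length, MultiIndex.length, ← Finset.add_sum_erase _ _ (Finset.mem_univ i),
    ← Finset.add_sum_erase (a := i) _ (fun i => α i) (Finset.mem_univ i)]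
  have h1 : ∑ j ∈ Finset.univ.erase i, (setCoord α i m) j = ∑ j ∈ Finset.univ.erase i, α j := by
    refine Finset.sum_congr rfl fun j hj => ?_
    simp [setCoord, Finset.ne_of_mem_erase hj]
  have h2 : setCoord α i m i = m := by simp [setCoord]
  rw [h1, h2]
  omega

/-- Expressing the derivative by neighbouring Hermite functions lets bounds for derivatives of every
order be proved by induction. -/
lemma hasFDerivAt_chermite {d : ℕ} (α : MultiIndex d) (x : RSpace d) :
    HasFDerivAt (chermite α) (∑ i, ((((1 / 2 * ladder (α i) : ℝ) : ℂ) •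
      chermite (setCoord α i (α i - 1)) x - ((1 / 2 * ladder (α i + 1) : ℝ) : ℂ) •
      chermite (setCoord α i (α i + 1)) x) •
      (Complex.ofRealCLM ∘L (EuclideanSpace.proj i : RSpace d →L[ℝ] ℝ)))) x := by
  refine (fderiv_cprodFun (fun i => (contDiff_hermiteFun1 (α i)).differentiable (by norm_num))
    x).congr_fderiv (Finset.sum_congr rfl fun i _ => ?_)
  have h1 : ∀ m, chermite (setCoord α i m) x =
      cprodFun (Function.update (fun i => hermiteFun1 (α i)) i (hermiteFun1 m)) x := fun m => by
    rw [chermite]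
    congr 1
    funext j
    by_cases hj : j = i
    · subst hj; simp [setCoord]
    · simp [setCoord, hj]
  rw [h1, h1]
  congr 1
  simp only [cprodFun, prodFun_update, deriv_hermiteFun1, smul_eq_mul]
  push_cast
  ring

lemma hasSum_chermite_kernel {d : ℕ} (z : CSpace d) (y : RSpace d) :
    HasSum (fun α : MultiIndex d => chermite α y * ((∏ i, z i ^ α i) / (Real.sqrt α.fact : ℂ)))
      (((Real.pi ^ (-(d : ℝ) / 4) : ℝ) : ℂ) *
        Complex.exp (-(1 / 2) * ((∑ i, z i * z i) + ((‖y‖ ^ 2 : ℝ) : ℂ)) +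
      ((Real.sqrt 2 : ℝ) : ℂ) * ∑ i, z i * (y i : ℂ))) := by
  have h := hasSum_multiIndex_prod _ _ (fun i => hasSum_kernel1 (z i) (y i))
    fun i => (hasSum_kernel1 (z i) (y i)).summable.norm
  have e1 : ∏ i, kernel1 (z i) (y i) = ((Real.pi ^ (-(d : ℝ) / 4) : ℝ) : ℂ) *
        Complex.exp (-(1 / 2) * ((∑ i, z i * z i) + ((‖y‖ ^ 2 : ℝ) : ℂ)) +
      ((Real.sqrt 2 : ℝ) : ℂ) * ∑ i, z i * (y i : ℂ)) := by
    simp only [kernel1, Finset.prod_mul_distrib, ← Complex.exp_sum]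
    congr 1
    · rw [Finset.prod_const, Finset.card_univ, Fintype.card_fin, ← Complex.ofReal_pow,
        ← Real.rpow_natCast, ← Real.rpow_mul Real.pi_pos.le]
      congr 2
      ring
    · rw [EuclideanSpace.real_norm_sq_eq, Finset.sum_add_distrib, ← Finset.mul_sum,
        ← Finset.mul_sum, Finset.sum_add_distrib]
      push_cast
      rfl
  rw [e1] at h
  refine h.congr_fun fun α => ?_
  have e2 : (Real.sqrt α.fact : ℂ) = ∏ i, (Real.sqrt (α i).factorial : ℂ) := by
    rw [← Complex.ofReal_prod, ← Real.sqrt_prod _ fun i _ => by positivity, MultiIndex.fact]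
    push_cast
    rfl
  rw [e2, chermite_apply, hermiteFun, Complex.ofReal_prod, Finset.prod_mul_distrib,
    Finset.prod_div_distrib]

/-! ### The harmonic oscillator and Hermite coefficients -/

/-- Dilates b(t/(n+1)) of one bump function: each derivative brings a factor 1/(n+1) ≤ 1, so the
bounds are uniform in n. They serve to integrate by parts against functions that are only known to
be bounded. -/
lemma exists_cutoff : ∃ (χ : ℕ → ℝ → ℝ) (B : ℝ), 0 ≤ B ∧ (∀ n, ContDiff ℝ ∞ (χ n)) ∧
    (∀ n, HasCompactSupport (χ n)) ∧ (∀ n t, |χ n t| ≤ 1) ∧ (∀ n t, |deriv (χ n) t| ≤ B) ∧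
    (∀ n t, |deriv (deriv (χ n)) t| ≤ B) ∧
    ∀ t, ∀ᶠ n in Filter.atTop, χ n =ᶠ[nhds t] fun _ => 1 := by
  let b : ContDiffBump (0 : ℝ) := ⟨1, 2, by norm_num, by norm_num⟩
  have hb : ContDiff ℝ ∞ (b : ℝ → ℝ) := b.contDiff
  have hb1 : ContDiff ℝ ∞ (deriv b) := hb.iterate_deriv 1
  have hb2 : ContDiff ℝ ∞ (deriv (deriv b)) := hb.iterate_deriv 2
  have hc : HasCompactSupport (b : ℝ → ℝ) := b.hasCompactSupport
  obtain ⟨B1, hB1⟩ := hc.deriv.exists_bound_of_continuous hb1.continuous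
  obtain ⟨B2, hB2⟩ := hc.deriv.deriv.exists_bound_of_continuous hb2.continuous
  have hd : ∀ (u : ℝ → ℝ) (c t : ℝ), deriv (fun t => u (c * t)) t = c * deriv u (c * t) :=
    fun u c t => by rw [deriv_comp_mul_left, smul_eq_mul]
  have hc0 : ∀ n : ℕ, (0 : ℝ) < ((n : ℝ) + 1)⁻¹ := fun n => by positivity
  have hc1 : ∀ n : ℕ, ((n : ℝ) + 1)⁻¹ ≤ 1 := fun n => by
    apply inv_le_one_of_one_le₀; linarith [n.cast_nonneg (α := ℝ)]
  have hd1 : ∀ n : ℕ, deriv (fun t => b (((n : ℝ) + 1)⁻¹ * t)) =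
      fun t => ((n : ℝ) + 1)⁻¹ * deriv b (((n : ℝ) + 1)⁻¹ * t) := fun n => funext fun t => hd _ _ _
  refine ⟨fun n t => b (((n : ℝ) + 1)⁻¹ * t), max B1 B2, ?_, ?_, ?_, ?_, ?_, ?_, ?_⟩
  · exact le_max_of_le_left ((norm_nonneg _).trans (hB1 0))
  · intro n
    exact hb.comp (contDiff_const.mul contDiff_id)
  · intro n
    exact hc.comp_homeomorph (Homeomorph.mulLeft₀ (((n : ℝ) + 1)⁻¹) (hc0 n).ne')
  · intro n t
    rw [abs_of_nonneg b.nonneg]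
    exact b.le_one
  · intro n t
    rw [hd1, abs_mul, abs_of_pos (hc0 n)]
    exact (mul_le_of_le_one_left (abs_nonneg _) (hc1 n)).trans ((hB1 _).trans (le_max_left _ _))
  · intro n t
    rw [hd1, deriv_const_mul_field, hd, ← mul_assoc, abs_mul, abs_of_pos (mul_pos (hc0 n) (hc0 n))]
    exact (mul_le_of_le_one_left (abs_nonneg _)
      (mul_le_one₀ (hc1 n) (hc0 n).le (hc1 n))).trans ((hB2 _).trans (le_max_right _ _))
  · intro t
    obtain ⟨m, hm⟩ := exists_nat_gt |t|
    filter_upwards [Filter.eventually_ge_atTop m] with n hn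
    have hlt : |t| < (n : ℝ) + 1 := by
      have : (m : ℝ) ≤ n := by exact_mod_cast hn
      linarith
    have hev : ∀ᶠ u in nhds t, |u| < (n : ℝ) + 1 :=
      (continuous_abs.tendsto t).eventually (gt_mem_nhds hlt)
    filter_upwards [hev] with u hu
    apply b.one_of_mem_closedBall
    rw [mem_closedBall_zero_iff, Real.norm_eq_abs, abs_mul, abs_of_pos (hc0 n),
      inv_mul_le_iff₀ (by positivity)]
    simpa [b] using hu.le

lemma integral_mul_partialDeriv {d : ℕ} (i : Fin d) {f φ : RSpace d → ℂ} (hf : ContDiff ℝ ∞ f)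
    (hφ : ContDiff ℝ ∞ φ) (hc : HasCompactSupport φ) :
    ∫ x, f x * partialDeriv i φ x = -∫ x, partialDeriv i f x * φ x := by
  have hφ' : HasCompactSupport (partialDeriv i φ) := hc.fderiv_apply ℝ _
  have c1 := (contDiff_partialDeriv i hf).continuous
  have c2 := (contDiff_partialDeriv i hφ).continuous
  refine integral_mul_fderiv_eq_neg_fderiv_mul_of_integrable ?_ ?_ ?_
    (fun x _ => hf.differentiable (by norm_num) x) (fun x _ => hφ.differentiable (by norm_num) x)
  · exact (c1.mul hφ.continuous).integrable_of_hasCompactSupport hc.mul_left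
  · exact (hf.continuous.mul c2).integrable_of_hasCompactSupport hφ'.mul_left
  · exact (hf.continuous.mul hφ.continuous).integrable_of_hasCompactSupport hc.mul_left

lemma integral_harmOsc_mul {d : ℕ} {f φ : RSpace d → ℂ} (hf : ContDiff ℝ ∞ f)
    (hφ : ContDiff ℝ ∞ φ) (hc : HasCompactSupport φ) :
    ∫ x, harmOsc f x * φ x = ∫ x, f x * harmOsc φ x := by
  have hφ1 : ∀ i, HasCompactSupport (partialDeriv i φ) := fun i => hc.fderiv_apply ℝ _
  have hφ2 : ∀ i, HasCompactSupport (partialDeriv i (partialDeriv i φ)) :=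
    fun i => (hφ1 i).fderiv_apply ℝ _
  have cf2 := fun i => (contDiff_partialDeriv i (contDiff_partialDeriv i hf)).continuous
  have cφ2 := fun i => (contDiff_partialDeriv i (contDiff_partialDeriv i hφ)).continuous
  have hn : Continuous fun x : RSpace d => ((‖x‖ ^ 2 : ℝ) : ℂ) := by fun_prop
  have i1 : MeasureTheory.Integrable fun x => ((‖x‖ ^ 2 : ℝ) : ℂ) * f x * φ x :=
    ((hn.mul hf.continuous).mul hφ.continuous).integrable_of_hasCompactSupport hc.mul_left
  have i2 : ∀ i, MeasureTheory.Integrable fun x => partialDeriv i (partialDeriv i f) x * φ x :=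
    fun i => ((cf2 i).mul hφ.continuous).integrable_of_hasCompactSupport hc.mul_left
  have i3 : ∀ i, MeasureTheory.Integrable fun x => f x * partialDeriv i (partialDeriv i φ) x :=
    fun i => (hf.continuous.mul (cφ2 i)).integrable_of_hasCompactSupport (hφ2 i).mul_left
  have e1 : ∀ x, harmOsc f x * φ x = ((‖x‖ ^ 2 : ℝ) : ℂ) * f x * φ x -
      ∑ i, partialDeriv i (partialDeriv i f) x * φ x := fun x => by
    rw [harmOsc, laplacian_eq_sum_partialDeriv hf, ← Finset.sum_mul, sub_mul]
  have e2 : ∀ x, f x * harmOsc φ x = ((‖x‖ ^ 2 : ℝ) : ℂ) * f x * φ x -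
      ∑ i, f x * partialDeriv i (partialDeriv i φ) x := fun x => by
    rw [harmOsc, laplacian_eq_sum_partialDeriv hφ, ← Finset.mul_sum]; ring
  simp only [e1, e2]
  rw [MeasureTheory.integral_sub i1 (MeasureTheory.integrable_finsetSum _ fun i _ => i2 i),
    MeasureTheory.integral_sub i1 (MeasureTheory.integrable_finsetSum _ fun i _ => i3 i),
    MeasureTheory.integral_finsetSum _ fun i _ => i2 i,
    MeasureTheory.integral_finsetSum _ fun i _ => i3 i]
  congr 1
  refine Finset.sum_congr rfl fun i _ => ?_
  rw [integral_mul_partialDeriv i hf (contDiff_partialDeriv i hφ) (hφ1 i)]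
  rw [integral_mul_partialDeriv i (contDiff_partialDeriv i hf) hφ hc, neg_neg]

lemma hasCompactSupport_cprodFun {d : ℕ} {k : Fin d → ℝ → ℝ}
    (hk : ∀ i, HasCompactSupport (k i)) : HasCompactSupport (cprodFun k) := by
  have h1 : IsCompact (Set.pi Set.univ fun i => tsupport (k i)) := isCompact_univ_pi hk
  refine HasCompactSupport.of_support_subset_isCompact
    (h1.image (EuclideanSpace.equiv (Fin d) ℝ).symm.continuous) fun x hx => ?_
  refine ⟨EuclideanSpace.equiv (Fin d) ℝ x, fun i _ => subset_tsupport _ ?_, by simp⟩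
  intro h0
  apply hx
  rw [cprodFun, prodFun, Finset.prod_eq_zero (Finset.mem_univ i), Complex.ofReal_zero]
  exact h0

lemma norm_cprodFun_le {d : ℕ} {k l : Fin d → ℝ → ℝ} (h : ∀ i t, |k i t| ≤ l i t) (x : RSpace d) :
    ‖cprodFun k x‖ ≤ prodFun l x := by
  rw [cprodFun, Complex.norm_real, Real.norm_eq_abs, prodFun, Finset.abs_prod]
  exact Finset.prod_le_prod (fun i _ => abs_nonneg _) fun i _ => h i _

lemma harmOsc_cprodFun {d : ℕ} {k : Fin d → ℝ → ℝ} (hk : ∀ i, ContDiff ℝ ∞ (k i))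
    (x : RSpace d) :
    harmOsc (cprodFun k) x = ∑ i, cprodFun (Function.update k i
      fun t => t ^ 2 * k i t - deriv (deriv (k i)) t) x := by
  have h1 : ((‖x‖ ^ 2 : ℝ) : ℂ) * cprodFun k x =
      ∑ i, cprodFun (Function.update k i fun t => t ^ 2 * k i t) x := by
    rw [EuclideanSpace.real_norm_sq_eq, Complex.ofReal_sum, Finset.sum_mul]
    refine Finset.sum_congr rfl fun i _ => ?_
    rw [cprodFun, cprodFun, prodFun_update, prodFun_eq_mul k i]
    push_cast
    ring
  rw [harmOsc, laplacian_cprodFun hk, h1, ← Finset.sum_sub_distrib]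
  refine Finset.sum_congr rfl fun i _ => ?_
  simp only [cprodFun, prodFun_update]
  push_cast
  ring

/-- The product rule bounds the truncated expression by h_n, its first two derivatives and t² h_n,
all integrable. The dominating function depends on the cutoff only through B, as dominated
convergence requires. -/
lemma exists_hermite_dominating (n : ℕ) (B : ℝ) : ∃ G : ℝ → ℝ, MeasureTheory.Integrable G ∧
    ∀ χ : ℝ → ℝ, ContDiff ℝ ∞ χ → (∀ t, |χ t| ≤ 1) → (∀ t, |deriv χ t| ≤ B) →
      (∀ t, |deriv (deriv χ) t| ≤ B) → ∀ t,
        |t ^ 2 * (χ t * hermiteFun1 n t) - deriv (deriv fun t => χ t * hermiteFun1 n t) t| ≤ G t := by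
  have hB : 0 ≤ |B| := abs_nonneg B
  refine ⟨fun t => |t ^ 2 * hermiteFun1 n t| + (|B| * |hermiteFun1 n t| +
    2 * (|B| * |deriv (hermiteFun1 n) t|) + |deriv (deriv (hermiteFun1 n)) t|), ?_, ?_⟩
  · have j1 := integrable_hermiteFun1 n
    have j2 : MeasureTheory.Integrable (deriv (hermiteFun1 n)) := by
      rw [deriv_hermiteFun1]
      exact (((integrable_hermiteFun1 _).const_mul _).sub
        ((integrable_hermiteFun1 _).const_mul _)).const_mul _
    have j3 : MeasureTheory.Integrable (deriv (deriv (hermiteFun1 n))) := by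
      have : deriv (deriv (hermiteFun1 n)) = fun t => t ^ 2 * hermiteFun1 n t -
          (2 * n + 1) * hermiteFun1 n t := by
        funext t; rw [deriv_deriv_hermiteFun1]; ring
      rw [this]
      exact (integrable_pow_mul_hermiteFun1 2 n).sub (j1.const_mul _)
    exact (integrable_pow_mul_hermiteFun1 2 n).abs.add (((j1.abs.const_mul _).add
      ((j2.abs.const_mul _).const_mul _)).add j3.abs)
  · intro χ hχ h0 h1 h2 t
    have dχ : Differentiable ℝ χ := hχ.differentiable (by norm_num)
    have dχ' : Differentiable ℝ (deriv χ) := (hχ.iterate_deriv 1).differentiable (by norm_num)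
    have hh := contDiff_hermiteFun1 n
    have dh : Differentiable ℝ (hermiteFun1 n) := hh.differentiable (by norm_num)
    have dh' : Differentiable ℝ (deriv (hermiteFun1 n)) :=
      (hh.iterate_deriv 1).differentiable (by norm_num)
    have e1 : deriv (fun t => χ t * hermiteFun1 n t) =
        fun t => deriv χ t * hermiteFun1 n t + χ t * deriv (hermiteFun1 n) t :=
      funext fun t => deriv_fun_mul (dχ t) (dh t)
    have e2 : deriv (deriv fun t => χ t * hermiteFun1 n t) t =
        deriv (deriv χ) t * hermiteFun1 n t + 2 * (deriv χ t * deriv (hermiteFun1 n) t) +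
          χ t * deriv (deriv (hermiteFun1 n)) t := by
      rw [e1]
      refine (((dχ' t).hasDerivAt.mul (dh t).hasDerivAt).add
        ((dχ t).hasDerivAt.mul (dh' t).hasDerivAt)).deriv.trans ?_
      ring
    rw [e2]
    refine (abs_sub _ _).trans (add_le_add ?_ ((abs_add_three _ _ _).trans
      (add_le_add (add_le_add ?_ ?_) ?_)))
    · rw [show t ^ 2 * (χ t * hermiteFun1 n t) = χ t * (t ^ 2 * hermiteFun1 n t) by ring, abs_mul]
      exact mul_le_of_le_one_left (abs_nonneg _) (h0 t)
    · rw [abs_mul]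
      exact mul_le_mul_of_nonneg_right ((h2 t).trans (le_abs_self B)) (abs_nonneg _)
    · rw [abs_mul, abs_mul, abs_two]
      exact mul_le_mul_of_nonneg_left (mul_le_mul_of_nonneg_right
        ((h1 t).trans (le_abs_self B)) (abs_nonneg _)) (by norm_num)
    · rw [abs_mul]
      exact mul_le_of_le_one_left (abs_nonneg _) (h0 t)

/-- Symmetry of H without any decay of f: H is moved onto χ_n h_α, which has compact support, and n
tends to infinity by dominated convergence on both sides. The eigenvalue equation for h_α finishes.
-/
lemma hermiteSeries_harmOsc {d : ℕ} {f : RSpace d → ℂ} (hf : ContDiff ℝ ∞ f) {M M' : ℝ}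
    (hM : ∀ x, ‖f x‖ ≤ M) (hM' : ∀ x, ‖harmOsc f x‖ ≤ M') (α : MultiIndex d) :
    hermiteSeries (harmOsc f) α = ((2 * α.length + d : ℕ) : ℂ) * hermiteSeries f α := by
  obtain ⟨χ, B, hB, h1, h2, h3, h4, h5, h6⟩ := exists_cutoff
  choose G hG hG' using fun i => exists_hermite_dominating (α i) B
  set k : ℕ → Fin d → ℝ → ℝ := fun n i t => χ n t * hermiteFun1 (α i) t with hk
  have hk1 : ∀ n i, ContDiff ℝ ∞ (k n i) := fun n i => (h1 n).mul (contDiff_hermiteFun1 _)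
  have hk2 : ∀ n i, HasCompactSupport (k n i) := fun n i => (h2 n).mul_right
  have hk3 : ∀ n i t, |k n i t| ≤ |hermiteFun1 (α i) t| := fun n i t => by
    rw [hk, abs_mul]
    exact mul_le_of_le_one_left (abs_nonneg _) (h3 n t)
  have key : ∀ n, ∫ x, harmOsc f x * cprodFun (k n) x = ∫ x, f x * harmOsc (cprodFun (k n)) x :=
    fun n => integral_harmOsc_mul hf (contDiff_cprodFun (hk1 n))
      (hasCompactSupport_cprodFun (hk2 n))
  have hev : ∀ x : RSpace d, ∀ᶠ n in Filter.atTop,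
      ∀ i, k n i =ᶠ[nhds (x i)] hermiteFun1 (α i) := fun x => by
    rw [Filter.eventually_all]
    intro i
    filter_upwards [h6 (x i)] with n hn
    filter_upwards [hn] with t ht
    simp [hk, ht]
  have iA : MeasureTheory.Integrable (prodFun fun i t => |hermiteFun1 (α i) t|) :=
    integrable_prodFun fun i => (integrable_hermiteFun1 _).abs
  -- H applied to a product is a sum over i in which only the i-th factor changes; these products
  -- dominate the summands.
  have iB : ∀ i, MeasureTheory.Integrable
      (prodFun (Function.update (fun i t => |hermiteFun1 (α i) t|) i (G i))) := fun i =>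
    integrable_prodFun fun j => by
      by_cases hj : j = i
      · subst hj; rw [Function.update_self]; exact hG j
      · rw [Function.update_of_ne hj]; exact (integrable_hermiteFun1 _).abs
  have t1 : Filter.Tendsto (fun n => ∫ x, harmOsc f x * cprodFun (k n) x) Filter.atTop
      (nhds (∫ x, harmOsc f x * chermite α x)) := by
    refine MeasureTheory.tendsto_integral_of_dominated_convergence
      (fun x => M' * prodFun (fun i t => |hermiteFun1 (α i) t|) x) (fun n => ?_)
      (iA.const_mul M') (fun n => .of_forall fun x => ?_) (.of_forall fun x => ?_)
    · exact ((contDiff_harmOsc hf).continuous.mul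
        (contDiff_cprodFun (hk1 n)).continuous).aestronglyMeasurable
    · rw [norm_mul]
      exact mul_le_mul (hM' x) (norm_cprodFun_le (hk3 n) x) (norm_nonneg _)
        ((norm_nonneg _).trans (hM' x))
    · refine tendsto_const_nhds.congr' ?_
      filter_upwards [hev x] with n hn
      rw [chermite, cprodFun, cprodFun, prodFun, prodFun,
        Finset.prod_congr rfl fun i _ => (hn i).eq_of_nhds]
  have t2 : Filter.Tendsto (fun n => ∫ x, f x * harmOsc (cprodFun (k n)) x) Filter.atTop
      (nhds (∫ x, f x * harmOsc (chermite α) x)) := by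
    refine MeasureTheory.tendsto_integral_of_dominated_convergence
      (fun x => M * ∑ i, prodFun (Function.update (fun i t => |hermiteFun1 (α i) t|) i (G i)) x)
      (fun n => ?_) ((MeasureTheory.integrable_finsetSum _ fun i _ => iB i).const_mul M)
      (fun n => .of_forall fun x => ?_) (.of_forall fun x => ?_)
    · exact (hf.continuous.mul
        (contDiff_harmOsc (contDiff_cprodFun (hk1 n))).continuous).aestronglyMeasurable
    · rw [norm_mul, harmOsc_cprodFun (hk1 n)]
      refine mul_le_mul (hM x) ((norm_sum_le _ _).trans (Finset.sum_le_sum fun i _ =>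
        norm_cprodFun_le (fun j t => ?_) x)) (norm_nonneg _) ((norm_nonneg _).trans (hM x))
      by_cases hj : j = i
      · subst hj
        rw [Function.update_self, Function.update_self]
        exact hG' j (χ n) (h1 n) (h3 n) (h4 n) (h5 n) t
      · rw [Function.update_of_ne hj, Function.update_of_ne hj]
        exact hk3 n j t
    · refine tendsto_const_nhds.congr' ?_
      filter_upwards [hev x] with n hn
      rw [chermite, harmOsc_cprodFun (hk1 n),
        harmOsc_cprodFun fun i => contDiff_hermiteFun1 (α i)]
      congr 1
      refine Finset.sum_congr rfl fun i _ => ?_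
      simp only [cprodFun, prodFun_update]
      rw [Finset.prod_congr rfl fun j _ => (hn j).eq_of_nhds, (hn i).eq_of_nhds,
        ((hn i).deriv.deriv).eq_of_nhds]
  have hlim := tendsto_nhds_unique (t1.congr key) t2
  change ∫ x, harmOsc f x * chermite α x = _
  rw [hlim, harmOsc_chermite, hermiteSeries, ← MeasureTheory.integral_const_mul]
  refine MeasureTheory.integral_congr_ae (.of_forall fun x => ?_)
  simp only [Pi.smul_apply, smul_eq_mul, chermite_apply]
  ring

lemma norm_harmOsc_iterate_le {d : ℕ} {s : ℝ} (g : PilipovicSpace d s) (h : Set.Ioi (0 : ℝ))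
    (N : ℕ) (x : RSpace d) : ‖(harmOsc^[N] g.toFun) x‖ ≤
      pilSeminorm d s h g * ((h : ℝ) ^ N * (N.factorial : ℝ) ^ (2 * s)) := by
  have hh : (0 : ℝ) < h := h.2
  have := le_ciSup (g.2.2 h h.2) (N, x)
  change pilQuot s h g.toFun (N, x) ≤ pilSeminorm d s h g at this
  rwa [pilQuot, div_le_iff₀ (by positivity)] at this

lemma hermiteSeries_harmOsc_iterate {d : ℕ} {s : ℝ} (g : PilipovicSpace d s) (α : MultiIndex d)
    (N : ℕ) : hermiteSeries (harmOsc^[N] g.toFun) α =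
      ((2 * α.length + d : ℕ) : ℂ) ^ N * hermiteSeries g.toFun α := by
  induction N with
  | zero => simp
  | succ N ih =>
    have h1 := norm_harmOsc_iterate_le g ⟨1, Set.mem_Ioi.2 one_pos⟩
    have h2 := h1 (N + 1)
    simp only [Function.iterate_succ_apply'] at h2 ⊢
    have h0 : ContDiff ℝ ∞ g.toFun := g.2.1
    rw [hermiteSeries_harmOsc (contDiff_harmOsc_iterate h0 N) (h1 N) h2, ih, pow_succ]
    ring

lemma norm_hermiteSeries_le {d : ℕ} {f : RSpace d → ℂ} {M : ℝ} (hM : ∀ x, ‖f x‖ ≤ M)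
    (α : MultiIndex d) : ‖hermiteSeries f α‖ ≤ M * ∫ x, |hermiteFun α x| := by
  rw [hermiteSeries, ← MeasureTheory.integral_const_mul]
  refine MeasureTheory.norm_integral_le_of_norm_le ((integrable_hermiteFun α).abs.const_mul M)
    (.of_forall fun x => ?_)
  rw [norm_mul, Complex.norm_real, Real.norm_eq_abs]
  exact mul_le_mul_of_nonneg_right (hM x) (abs_nonneg _)

lemma factorial_rpow_le {s ρ x : ℝ} (hs : 0 < s) (hρ : 0 < ρ) (hx : 0 ≤ x) {N : ℕ}
    (hN : (N : ℝ) ≤ ρ * x ^ (1 / (2 * s))) :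
    (N.factorial : ℝ) ^ (2 * s) ≤ (ρ ^ (2 * s) * x) ^ N := by
  have h1 : (N.factorial : ℝ) ≤ (ρ * x ^ (1 / (2 * s))) ^ N := by
    have : (N.factorial : ℝ) ≤ (N : ℝ) ^ N := by exact_mod_cast Nat.factorial_le_pow N
    exact this.trans (by gcongr)
  have hy : 0 ≤ ρ * x ^ (1 / (2 * s)) := by positivity
  refine (Real.rpow_le_rpow (by positivity) h1 (by positivity)).trans (le_of_eq ?_)
  rw [← Real.rpow_natCast, ← Real.rpow_mul hy, mul_comm (N : ℝ), Real.rpow_mul hy,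
    Real.rpow_natCast, Real.mul_rpow hρ.le (by positivity), ← Real.rpow_mul hx,
    one_div_mul_cancel (by positivity), Real.rpow_one]

/-- The coefficient bound from H^N holds for every N, and N is optimized depending on α. Both h and
C are independent of g, so the estimate also serves for continuity. -/
lemma exists_norm_hermiteSeries_le (d : ℕ) {s r : ℝ} (hs : 0 < s) (hr : 0 < r) :
    ∃ (h : Set.Ioi (0 : ℝ)) (C : ℝ), 0 ≤ C ∧ ∀ (g : PilipovicSpace d s) (α : MultiIndex d),
      ‖hermiteSeries g.toFun α‖ ≤ C * pilSeminorm d s h g * decay s r α := by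
  obtain ⟨C, hC, hL1⟩ := exists_integral_abs_hermiteFun_le d
  obtain ⟨D, hD, hpoly⟩ := exists_pow_mul_decay_le d hs one_pos (d * 3)
  -- The surplus 1 over r pays for the polynomial growth of the L¹ norms.
  set ρ : ℝ := r + 1 with hρdef
  have hρ : 0 < ρ := by positivity
  have hρs : 0 < ρ ^ (2 * s) := Real.rpow_pos_of_pos hρ _
  -- Since (N!)^{2s} ≤ (ρ^{2s} n)^N for the N below, this choice leaves exactly e^{-N} after
  -- division by n^N.
  set h : ℝ := Real.exp (-1) / ρ ^ (2 * s) with hhdef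
  have hh : 0 < h := by positivity
  refine ⟨⟨h, hh⟩, C * D * Real.exp 1, by positivity, fun g α => ?_⟩
  set P := pilSeminorm d s ⟨h, hh⟩ g with hP
  have hP0 : 0 ≤ P := apply_nonneg _ _
  set n : ℝ := (α.length : ℝ) with hn
  have hn0 : 0 ≤ n := by positivity
  set γ := 1 / (2 * s) with hγ
  have hγ0 : γ ≠ 0 := by positivity
  set N : ℕ := ⌊ρ * n ^ γ⌋₊ with hNdef
  have hN1 : (N : ℝ) ≤ ρ * n ^ γ := Nat.floor_le (by positivity)
  have hN2 : ρ * n ^ γ ≤ N + 1 := (Nat.lt_floor_add_one _).le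
  -- For α = 0 also N = 0, and the power is 0^0 = 1.
  have hnN : 0 < n ^ N := by
    rcases hn0.eq_or_lt with h0 | h0
    · have : N = 0 := by rw [hNdef, ← h0, Real.zero_rpow hγ0, mul_zero, Nat.floor_zero]
      rw [this]; simp
    · positivity
  have e1 := norm_hermiteSeries_le (norm_harmOsc_iterate_le g ⟨h, hh⟩ N) α
  rw [hermiteSeries_harmOsc_iterate, norm_mul, norm_pow, Complex.norm_natCast] at e1
  have e2 : n ^ N * ‖hermiteSeries g.toFun α‖ ≤
      n ^ N * (Real.exp (-N) * (P * (C * (n + 1) ^ (d * 3)))) := by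
    calc _ ≤ ((2 * α.length + d : ℕ) : ℝ) ^ N * ‖hermiteSeries g.toFun α‖ := by
          gcongr
          rw [hn]
          push_cast
          have : (0 : ℝ) ≤ d := by positivity
          linarith
      _ ≤ P * (h ^ N * (N.factorial : ℝ) ^ (2 * s)) * ∫ x, |hermiteFun α x| := e1
      _ ≤ P * (h ^ N * (ρ ^ (2 * s) * n) ^ N) * (C * (n + 1) ^ (d * 3)) := by
          gcongr
          · exact factorial_rpow_le hs hρ hn0 hN1
          · exact hL1 α
      _ = n ^ N * ((h * ρ ^ (2 * s)) ^ N * (P * (C * (n + 1) ^ (d * 3)))) := by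
          rw [mul_pow, mul_pow]; ring
      _ = _ := by
          rw [hhdef, div_mul_cancel₀ _ hρs.ne', ← Real.exp_nat_mul, mul_neg_one]
  have e3 := le_of_mul_le_mul_left e2 hnN
  -- Rounding N down loses less than 1 in the exponent, hence the factor e.
  have e4 : Real.exp (-(N : ℝ)) ≤ Real.exp 1 * (decay s r α * decay s 1 α) := by
    rw [← decay_add, decay, ← Real.exp_add, Real.exp_le_exp]
    linarith
  have e5 := hpoly α
  calc _ ≤ _ := e3
    _ ≤ Real.exp 1 * (decay s r α * decay s 1 α) * (P * (C * (n + 1) ^ (d * 3))) := by gcongr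
    _ = Real.exp 1 * decay s r α * P * C * ((n + 1) ^ (d * 3) * decay s 1 α) := by ring
    _ ≤ Real.exp 1 * decay s r α * P * C * D := by
        have := decay_pos s r α
        gcongr
    _ = _ := by ring

/-! ### Sums of Hermite series -/

/-- Each derivative replaces h_α by neighbours with coefficients at most |α|+1, so the degree rises
by one. A neighbour has length at most |α|+1, which accounts for the factor 2^m. -/
lemma exists_norm_iteratedFDeriv_chermite_le (d k : ℕ) :
    ∃ (C : ℝ) (m : ℕ), 0 ≤ C ∧ ∀ (α : MultiIndex d) (x : RSpace d),
      ‖iteratedFDeriv ℝ k (chermite α) x‖ ≤ C * ((α.length : ℝ) + 1) ^ m := by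
  induction k with
  | zero =>
    exact ⟨3 ^ d, d, by positivity, fun α x => by
      rw [norm_iteratedFDeriv_zero]; exact norm_chermite_le α x⟩
  | succ k ih =>
    obtain ⟨C, m, hC, h⟩ := ih
    set L : Fin d → RSpace d →L[ℝ] ℂ :=
      fun i => Complex.ofRealCLM ∘L (EuclideanSpace.proj i : RSpace d →L[ℝ] ℝ) with hL
    set S : Fin d → ℂ →L[ℝ] (RSpace d →L[ℝ] ℂ) :=
      fun i => (((ContinuousLinearMap.id ℂ ℂ).smulRight (L i)).restrictScalars ℝ) with hS
    refine ⟨∑ i, ‖S i‖ * (2 * C * 2 ^ m), m + 1,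
      Finset.sum_nonneg fun i _ => by positivity, fun α x => ?_⟩
    rw [← norm_iteratedFDeriv_fderiv]
    set u : Fin d → RSpace d → ℂ := fun i x => (1 / 2 * ladder (α i)) •
      chermite (setCoord α i (α i - 1)) x - (1 / 2 * ladder (α i + 1)) •
      chermite (setCoord α i (α i + 1)) x with hu
    have hc : ∀ β : MultiIndex d, ContDiff ℝ k (chermite β) := fun β =>
      (contDiff_chermite β).of_le (by exact_mod_cast le_top)
    have hcu : ∀ i, ContDiff ℝ k (u i) := fun i =>
      ((hc _).const_smul _).sub ((hc _).const_smul _)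
    have e1 : fderiv ℝ (chermite α) = ∑ i, (S i ∘ u i) := by
      funext x
      rw [(hasFDerivAt_chermite α x).fderiv, Finset.sum_apply]
      refine Finset.sum_congr rfl fun i _ => ?_
      simp [hS, hu, hL]
    rw [e1, iteratedFDeriv_sum_apply fun i _ =>
      ((S i).contDiff.comp (hcu i)).contDiffAt, Finset.sum_mul]
    refine (norm_sum_le _ _).trans (Finset.sum_le_sum fun i _ => ?_)
    refine ((S i).norm_iteratedFDeriv_comp_left (hcu i).contDiffAt le_rfl).trans ?_
    rw [mul_assoc]
    refine mul_le_mul_of_nonneg_left ?_ (norm_nonneg _)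
    have hb : ∀ (a : ℝ) (n : ℕ), 0 ≤ a → a ≤ (α.length : ℝ) + 1 → n ≤ α i + 1 →
        ‖iteratedFDeriv ℝ k (fun x => a • chermite (setCoord α i n) x) x‖ ≤
          C * 2 ^ m * ((α.length : ℝ) + 1) ^ (m + 1) := fun a n ha0 ha hn => by
      have e2 : (fun x => a • chermite (setCoord α i n) x) = a • chermite (setCoord α i n) := rfl
      rw [e2, iteratedFDeriv_const_smul_apply (hc _).contDiffAt, norm_smul, Real.norm_eq_abs,
        abs_of_nonneg ha0]
      have h1 := h (setCoord α i n) x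
      have h2 : ((setCoord α i n).length : ℝ) ≤ α.length + 1 := by
        exact_mod_cast length_setCoord_le α i hn
      calc a * _ ≤ ((α.length : ℝ) + 1) * (C * (2 * ((α.length : ℝ) + 1)) ^ m) := by
            refine mul_le_mul ha (h1.trans ?_) (norm_nonneg _) (by positivity)
            gcongr
            linarith [(α.length : ℕ).cast_nonneg (α := ℝ)]
        _ = _ := by rw [mul_pow, pow_succ]; ring
    have hαi : (α i : ℝ) ≤ α.length := by exact_mod_cast length_coord_le α i
    have hl1 : 1 / 2 * ladder (α i) ≤ (α.length : ℝ) + 1 := by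
      linarith [ladder_le (α i)]
    have hl2 : 1 / 2 * ladder (α i + 1) ≤ (α.length : ℝ) + 1 := by
      have := ladder_le (α i + 1)
      push_cast at this
      linarith
    have b1 := hb _ (α i - 1) (mul_nonneg (by norm_num) (ladder_nonneg (α i))) hl1 (by omega)
    have b2 := hb _ (α i + 1) (mul_nonneg (by norm_num) (ladder_nonneg (α i + 1))) hl2 le_rfl
    have e3 := iteratedFDeriv_sub_apply (𝕜 := ℝ) (i := k) (x := x)
      ((hc (setCoord α i (α i - 1))).const_smul (1 / 2 * ladder (α i))).contDiffAt
      ((hc (setCoord α i (α i + 1))).const_smul (1 / 2 * ladder (α i + 1))).contDiffAt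
    change iteratedFDeriv ℝ k (u i) x = _ at e3
    rw [e3]
    refine (norm_sub_le _ _).trans ?_
    refine (add_le_add b1 b2).trans (le_of_eq ?_)
    ring

/-- The coefficients are summable against every power of `|α| + 1`. -/
def PolySummable {d : ℕ} (c : FormalHermiteSeries d) : Prop :=
  ∀ k : ℕ, Summable fun α => ‖c α‖ * ((α.length : ℝ) + 1) ^ k

/-- The function `∑_α c_α h_α`. -/
def hermiteSum {d : ℕ} (c : FormalHermiteSeries d) (x : RSpace d) : ℂ := ∑' α, (c α • chermite α) x

lemma PolySummable.bounds {d : ℕ} {c : FormalHermiteSeries d} (hc : PolySummable c) :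
    ∃ v : ℕ → MultiIndex d → ℝ, (∀ k, Summable (v k)) ∧
      ∀ k α x, ‖iteratedFDeriv ℝ k (c α • chermite α) x‖ ≤ v k α := by
  choose C m hC h using exists_norm_iteratedFDeriv_chermite_le d
  refine ⟨fun k α => C k * (‖c α‖ * ((α.length : ℝ) + 1) ^ m k),
    fun k => (hc (m k)).mul_left _, fun k α x => ?_⟩
  rw [iteratedFDeriv_const_smul_apply (((contDiff_chermite α).of_le
    (by exact_mod_cast le_top)).contDiffAt), norm_smul]
  calc _ ≤ ‖c α‖ * (C k * ((α.length : ℝ) + 1) ^ m k) :=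
        mul_le_mul_of_nonneg_left (h k α x) (norm_nonneg _)
    _ = _ := by ring

lemma contDiff_smul_chermite {d : ℕ} (c : ℂ) (α : MultiIndex d) :
    ContDiff ℝ ∞ (c • chermite α) := (contDiff_chermite α).const_smul c

lemma contDiff_hermiteSum {d : ℕ} {c : FormalHermiteSeries d} (hc : PolySummable c) :
    ContDiff ℝ ∞ (hermiteSum c) := by
  obtain ⟨v, hv, h⟩ := hc.bounds
  exact contDiff_tsum (fun α => contDiff_smul_chermite (c α) α) (fun k _ => hv k)
    fun k α x _ => h k α x

lemma PolySummable.norm_le {d : ℕ} {c : FormalHermiteSeries d} (α : MultiIndex d) (x : RSpace d) :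
    ‖(c α • chermite α) x‖ ≤ 3 ^ d * (‖c α‖ * ((α.length : ℝ) + 1) ^ d) := by
  rw [Pi.smul_apply, norm_smul]
  calc _ ≤ ‖c α‖ * (3 ^ d * ((α.length : ℝ) + 1) ^ d) :=
        mul_le_mul_of_nonneg_left (norm_chermite_le α x) (norm_nonneg _)
    _ = _ := by ring

lemma PolySummable.summable {d : ℕ} {c : FormalHermiteSeries d} (hc : PolySummable c)
    (x : RSpace d) : Summable fun α => (c α • chermite α) x :=
  Summable.of_norm_bounded ((hc d).mul_left (3 ^ d)) fun α => PolySummable.norm_le α x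

lemma norm_hermiteSum_le {d : ℕ} {c : FormalHermiteSeries d} (hc : PolySummable c)
    (x : RSpace d) :
    ‖hermiteSum c x‖ ≤ 3 ^ d * ∑' α, ‖c α‖ * ((α.length : ℝ) + 1) ^ d := by
  rw [← tsum_mul_left]
  exact tsum_of_norm_bounded ((hc d).mul_left (3 ^ d)).hasSum fun α => PolySummable.norm_le α x

lemma PolySummable.mul {d : ℕ} {c : FormalHermiteSeries d} (hc : PolySummable c) :
    PolySummable fun α => ((2 * α.length + d : ℕ) : ℂ) * c α := by
  intro k
  refine Summable.of_nonneg_of_le (fun α => by positivity) (fun α => ?_)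
    ((hc (k + 1)).mul_left ((2 : ℝ) + d))
  have h1 : (((2 * α.length + d : ℕ) : ℕ) : ℝ) ≤ (2 + d) * ((α.length : ℝ) + 1) := by
    push_cast
    have : (0 : ℝ) ≤ (d : ℝ) * α.length := by positivity
    linarith
  rw [norm_mul, Complex.norm_natCast, pow_succ]
  calc _ ≤ ((2 + d) * ((α.length : ℝ) + 1)) * ‖c α‖ * ((α.length : ℝ) + 1) ^ k := by gcongr
    _ = _ := by ring

/-- The second derivatives may be summed term by term thanks to the uniform summable bounds, and
each term is an eigenfunction. -/
lemma harmOsc_hermiteSum {d : ℕ} {c : FormalHermiteSeries d} (hc : PolySummable c) :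
    harmOsc (hermiteSum c) = hermiteSum fun α => ((2 * α.length + d : ℕ) : ℂ) * c α := by
  obtain ⟨v, hv, h⟩ := hc.bounds
  funext x
  set e := EuclideanSpace.basisFun (Fin d) ℝ with he
  have hs2 : Summable fun α => iteratedFDeriv ℝ 2 (c α • chermite α) x :=
    Summable.of_norm_bounded (hv 2) fun α => h 2 α x
  have h1 : iteratedFDeriv ℝ 2 (hermiteSum c) x =
      ∑' α, iteratedFDeriv ℝ 2 (c α • chermite α) x :=
    iteratedFDeriv_tsum_apply (N := ⊤) (fun α => contDiff_smul_chermite (c α) α) (fun k _ => hv k)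
      (fun k α x _ => h k α x) le_top x
  have h2 : ∀ m : Fin 2 → RSpace d, HasSum (fun α => iteratedFDeriv ℝ 2 (c α • chermite α) x m)
      (iteratedFDeriv ℝ 2 (hermiteSum c) x m) := fun m => by
    rw [h1]
    exact hs2.hasSum.mapL (ContinuousMultilinearMap.apply ℝ (fun _ : Fin 2 => RSpace d) ℂ m)
  have h3 : HasSum (fun α => (Δ (c α • chermite α)) x) ((Δ (hermiteSum c)) x) := by
    simp only [InnerProductSpace.laplacian_eq_iteratedFDeriv_orthonormalBasis _ e]
    exact hasSum_sum fun i _ => h2 _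
  have h4 : HasSum (fun α => harmOsc (c α • chermite α) x) (harmOsc (hermiteSum c) x) :=
    ((hc.summable x).hasSum.mul_left _).sub h3
  rw [← h4.tsum_eq, hermiteSum]
  refine tsum_congr fun α => ?_
  rw [harmOsc_smul (contDiff_chermite α), harmOsc_chermite, smul_smul, mul_comm]

lemma harmOsc_iterate_hermiteSum {d : ℕ} {c : FormalHermiteSeries d} (hc : PolySummable c)
    (N : ℕ) : (PolySummable fun α => ((2 * α.length + d : ℕ) : ℂ) ^ N * c α) ∧
      harmOsc^[N] (hermiteSum c) =
        hermiteSum fun α => ((2 * α.length + d : ℕ) : ℂ) ^ N * c α := by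
  induction N with
  | zero => simpa using hc
  | succ N ih =>
    have h1 : (fun α : MultiIndex d => ((2 * α.length + d : ℕ) : ℂ) ^ (N + 1) * c α) =
        fun α => ((2 * α.length + d : ℕ) : ℂ) * (((2 * α.length + d : ℕ) : ℂ) ^ N * c α) := by
      funext α; ring
    rw [h1]
    refine ⟨ih.1.mul, ?_⟩
    rw [Function.iterate_succ_apply', ih.2, harmOsc_hermiteSum ih.1]

lemma hermiteSeries_hermiteSum {d : ℕ} {c : FormalHermiteSeries d} (hc : PolySummable c) :
    hermiteSeries (hermiteSum c) = c := by
  funext α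
  have hint : ∀ β : MultiIndex d, MeasureTheory.Integrable fun x =>
      (c β • chermite β) x * (hermiteFun α x : ℂ) := fun β =>
    (integrable_hermiteFun α).ofReal.bdd_mul
      (contDiff_smul_chermite (c β) β).continuous.aestronglyMeasurable
      (.of_forall fun x => PolySummable.norm_le β x)
  have hsum : Summable fun β : MultiIndex d =>
      ∫ x, ‖(c β • chermite β) x * (hermiteFun α x : ℂ)‖ := by
    refine Summable.of_nonneg_of_le
      (fun β => MeasureTheory.integral_nonneg fun x => norm_nonneg _) (fun β => ?_)
      (((hc d).mul_left (3 ^ d)).mul_right (∫ x, |hermiteFun α x|))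
    rw [← MeasureTheory.integral_const_mul]
    refine MeasureTheory.integral_mono (hint β).norm
      ((integrable_hermiteFun α).abs.const_mul _) fun x => ?_
    rw [norm_mul, Complex.norm_real, Real.norm_eq_abs]
    exact mul_le_mul_of_nonneg_right (PolySummable.norm_le β x) (abs_nonneg _)
  have h1 := MeasureTheory.hasSum_integral_of_summable_integral_norm hint hsum
  have h2 : ∀ β, ∫ x, (c β • chermite β) x * (hermiteFun α x : ℂ) = if β = α then c α else 0 := by
    intro β
    have : ∀ x, (c β • chermite β) x * (hermiteFun α x : ℂ) =
        c β * ((hermiteFun β x * hermiteFun α x : ℝ) : ℂ) := fun x => by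
      rw [Pi.smul_apply, smul_eq_mul, chermite_apply]; push_cast; ring
    simp only [this]
    rw [MeasureTheory.integral_const_mul, integral_complex_ofReal, integral_hermiteFun_mul]
    split_ifs with h
    · rw [h]; simp
    · simp
  simp only [h2] at h1
  have h3 := h1.unique (hasSum_ite_eq α (c α))
  rw [hermiteSeries, ← h3]
  refine MeasureTheory.integral_congr_ae (.of_forall fun x => ?_)
  exact tsum_mul_right.symm

lemma polySummable_of_decay {d : ℕ} {s : ℝ} (hs : 0 < s) {c : FormalHermiteSeries d}
    (hc : ∃ C : ℝ, ∀ α, ‖c α‖ ≤ C * decay s 2 α) : PolySummable c := by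
  obtain ⟨C, hC⟩ := hc
  intro k
  obtain ⟨D, hD, h⟩ := exists_pow_mul_decay_le d hs one_pos k
  refine Summable.of_nonneg_of_le (fun α => by positivity) (fun α => ?_)
    ((summable_decay d hs one_pos).mul_left (|C| * D))
  have h1 := (hC α).trans (mul_le_mul_of_nonneg_right (le_abs_self C) (decay_pos s 2 α).le)
  -- One half of the decay absorbs the polynomial, the other is summable.
  rw [show (2 : ℝ) = 1 + 1 by norm_num, decay_add] at h1
  have hp := decay_pos s 1 α
  calc _ ≤ |C| * (decay s 1 α * decay s 1 α) * ((α.length : ℝ) + 1) ^ k := by gcongr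
    _ = |C| * decay s 1 α * (((α.length : ℝ) + 1) ^ k * decay s 1 α) := by ring
    _ ≤ |C| * decay s 1 α * D := by gcongr; exact h α
    _ = _ := by ring

/-- H^N multiplies c_α by (2|α|+d)^N. The growth estimate for (|α|+1)^N separates the N-dependence
h^N (N!)^{2s} from a factor e^{r|α|^{1/(2s)}} that the decay of c_α swallows. -/
lemma hermiteSum_mem {d : ℕ} {s : ℝ} (hs : 0 < s) {c : FormalHermiteSeries d}
    (hc : ∀ r : ℝ, 0 < r → ∃ C : ℝ, ∀ α, ‖c α‖ ≤ C * decay s r α) :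
    hermiteSum c ∈ pilipovicSubmodule d s := by
  have hps : PolySummable c := polySummable_of_decay hs (hc 2 (by norm_num))
  refine ⟨contDiff_hermiteSum hps, fun h hh => ?_⟩
  -- Dividing h by 2+d compensates 2|α|+d ≤ (2+d)(|α|+1).
  obtain ⟨r, hr, C, hC, hN⟩ := exists_succ_pow_le hs (show 0 < h / (2 + d) by positivity)
  -- The part r cancels the exponential factor; the part 2 is what polynomial summability asks for.
  obtain ⟨D, hD⟩ := hc (r + 2) (by linarith)
  have hps' : PolySummable fun α => (Real.exp (r * (α.length : ℝ) ^ (1 / (2 * s))) : ℂ) * c α := by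
    refine polySummable_of_decay hs ⟨D, fun α => ?_⟩
    rw [norm_mul, Complex.norm_real, Real.norm_eq_abs, abs_of_pos (Real.exp_pos _)]
    have e1 : Real.exp (r * (α.length : ℝ) ^ (1 / (2 * s))) * decay s r α = 1 := by
      rw [decay, ← Real.exp_add]; simp
    calc _ ≤ Real.exp (r * (α.length : ℝ) ^ (1 / (2 * s))) * (D * decay s (r + 2) α) :=
          mul_le_mul_of_nonneg_left (hD α) (Real.exp_pos _).le
      _ = D * decay s 2 α * (Real.exp (r * (α.length : ℝ) ^ (1 / (2 * s))) * decay s r α) := by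
          rw [decay_add]; ring
      _ = _ := by rw [e1, mul_one]
  set T := ∑' α : MultiIndex d, ‖(Real.exp (r * (α.length : ℝ) ^ (1 / (2 * s))) : ℂ) * c α‖ *
    ((α.length : ℝ) + 1) ^ d with hT
  refine ⟨3 ^ d * (C * T), ?_⟩
  rintro _ ⟨⟨N, x⟩, rfl⟩
  rw [pilQuot, div_le_iff₀ (by positivity)]
  obtain ⟨hpN, eN⟩ := harmOsc_iterate_hermiteSum hps N
  rw [eN]
  refine (norm_hermiteSum_le hpN x).trans ?_
  rw [mul_assoc]
  refine mul_le_mul_of_nonneg_left ?_ (by positivity)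
  have e2 : C * T * (h ^ N * (N.factorial : ℝ) ^ (2 * s)) = ∑' α : MultiIndex d,
      C * (h ^ N * (N.factorial : ℝ) ^ (2 * s)) *
      (‖(Real.exp (r * (α.length : ℝ) ^ (1 / (2 * s))) : ℂ) * c α‖ *
        ((α.length : ℝ) + 1) ^ d) := by
    rw [tsum_mul_left, hT]; ring
  rw [e2]
  refine Summable.tsum_le_tsum (fun α => ?_) (hpN d) ((hps' d).mul_left _)
  rw [norm_mul, norm_mul, Complex.norm_real, Real.norm_eq_abs,
    abs_of_pos (Real.exp_pos _), norm_pow, Complex.norm_natCast]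
  have e3 : (((2 * α.length + d : ℕ) : ℕ) : ℝ) ≤ (2 + d) * ((α.length : ℝ) + 1) := by
    push_cast
    have : (0 : ℝ) ≤ (d : ℝ) * α.length := by positivity
    linarith
  have e4 := hN N α.length
  have e5 : (((2 * α.length + d : ℕ) : ℕ) : ℝ) ^ N ≤ C * (h ^ N * (N.factorial : ℝ) ^ (2 * s)) *
      Real.exp (r * (α.length : ℝ) ^ (1 / (2 * s))) := by
    calc _ ≤ ((2 + d) * ((α.length : ℝ) + 1)) ^ N := by gcongr
      _ = (2 + d : ℝ) ^ N * ((α.length : ℝ) + 1) ^ N := mul_pow _ _ _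
      _ ≤ (2 + d : ℝ) ^ N * (C * ((h / (2 + d)) ^ N * (N.factorial : ℝ) ^ (2 * s)) *
          Real.exp (r * (α.length : ℝ) ^ (1 / (2 * s)))) := by gcongr
      _ = _ := by
          rw [div_pow]
          field_simp
  calc _ ≤ (C * (h ^ N * (N.factorial : ℝ) ^ (2 * s)) *
      Real.exp (r * (α.length : ℝ) ^ (1 / (2 * s)))) * ‖c α‖ * ((α.length : ℝ) + 1) ^ d := by gcongr
    _ = _ := by ring

/-! ### Entire functions of several variables -/

/-- The cube `[0, 2π]^d` of angles. -/
def angleCube (d : ℕ) : Set (Fin d → ℝ) := Set.Icc 0 fun _ => 2 * Real.pi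

lemma isCompact_angleCube (d : ℕ) : IsCompact (angleCube d) := isCompact_Icc

lemma volume_angleCube (d : ℕ) :
    MeasureTheory.volume.real (angleCube d) = (2 * Real.pi) ^ d := by
  rw [MeasureTheory.measureReal_def, angleCube, Pi.zero_def,
    Real.volume_Icc_pi_toReal fun _ => Real.two_pi_pos.le]
  simp

lemma restrict_angleCube (d : ℕ) :
    (MeasureTheory.volume : MeasureTheory.Measure (Fin d → ℝ)).restrict (angleCube d) =
      MeasureTheory.Measure.pi fun _ =>
        (MeasureTheory.volume : MeasureTheory.Measure ℝ).restrict (Set.Icc 0 (2 * Real.pi)) := by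
  rw [← MeasureTheory.Measure.restrict_pi_pi, angleCube, ← Set.pi_univ_Icc]
  rfl

/-- The character `e^{-i ⟨α, θ⟩}`. -/
def angleChar {d : ℕ} (α : MultiIndex d) (θ : Fin d → ℝ) : ℂ :=
  ∏ j, Complex.exp (-((α j : ℂ) * (θ j * Complex.I)))

lemma continuous_angleChar {d : ℕ} (α : MultiIndex d) : Continuous (angleChar α) := by
  unfold angleChar; fun_prop

lemma norm_angleChar {d : ℕ} (α : MultiIndex d) (θ : Fin d → ℝ) : ‖angleChar α θ‖ = 1 := by
  rw [angleChar, norm_prod]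
  refine Finset.prod_eq_one fun j _ => ?_
  rw [Complex.norm_exp]
  simp

lemma continuous_torusMap {d : ℕ} (c : Fin d → ℂ) (R : Fin d → ℝ) : Continuous (torusMap c R) := by
  unfold torusMap; fun_prop

lemma norm_torusMap_zero {d : ℕ} (R : Fin d → ℝ) (θ : Fin d → ℝ) (i : Fin d) :
    ‖torusMap 0 R θ i‖ = |R i| := by
  simp [torusMap, Complex.norm_exp]

/-- The average `(2π)^{-d} ∫ F(R e^{iθ}) e^{-i⟨α,θ⟩} dθ`. -/
def torusAverage {d : ℕ} (F : (Fin d → ℂ) → ℂ) (R : Fin d → ℝ) (α : MultiIndex d) : ℂ :=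
  ((2 * Real.pi : ℂ) ^ d)⁻¹ * ∫ θ in angleCube d, F (torusMap 0 R θ) * angleChar α θ

lemma norm_torusAverage_le {d : ℕ} {F : (Fin d → ℂ) → ℂ} {R : Fin d → ℝ} {M : ℝ}
    (hF : ∀ θ, ‖F (torusMap 0 R θ)‖ ≤ M) (α : MultiIndex d) : ‖torusAverage F R α‖ ≤ M := by
  have h1 : ‖∫ θ in angleCube d, F (torusMap 0 R θ) * angleChar α θ‖ ≤
      M * MeasureTheory.volume.real (angleCube d) :=
    MeasureTheory.norm_setIntegral_le_of_norm_le_const (isCompact_angleCube d).measure_lt_top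
      fun θ _ => by rw [norm_mul, norm_angleChar, mul_one]; exact hF θ
  rw [volume_angleCube] at h1
  have h2 : (0 : ℝ) < (2 * Real.pi) ^ d := by positivity
  have h3 : ‖((2 * Real.pi : ℂ) ^ d)⁻¹‖ = ((2 * Real.pi) ^ d)⁻¹ := by
    rw [norm_inv, norm_pow, norm_mul, Complex.norm_real, Real.norm_eq_abs,
      abs_of_pos Real.pi_pos]
    simp
  rw [torusAverage, norm_mul, h3, inv_mul_le_iff₀ h2]
  linarith

lemma integral_Icc_exp (m n : ℕ) :
    ∫ t in Set.Icc (0 : ℝ) (2 * Real.pi),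
      Complex.exp (t * Complex.I) ^ m * Complex.exp (-((n : ℂ) * (t * Complex.I))) =
        if m = n then (2 * Real.pi : ℂ) else 0 := by
  rw [MeasureTheory.integral_Icc_eq_integral_Ioc,
    ← intervalIntegral.integral_of_le Real.two_pi_pos.le]
  have e1 : ∀ t : ℝ, Complex.exp (t * Complex.I) ^ m * Complex.exp (-((n : ℂ) * (t * Complex.I))) =
      Complex.exp ((((m : ℂ) - n) * Complex.I) * t) := fun t => by
    rw [← Complex.exp_nat_mul, ← Complex.exp_add]; ring_nf
  simp only [e1]
  split_ifs with h
  · subst h; simp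
  · have h0 : ((m : ℂ) - n) * Complex.I ≠ 0 :=
      mul_ne_zero (sub_ne_zero.2 (by exact_mod_cast h)) Complex.I_ne_zero
    rw [integral_exp_mul_complex h0]
    have e2 : ((m : ℂ) - n) * Complex.I * ((2 * Real.pi : ℝ) : ℂ) =
        ((m : ℤ) - (n : ℤ) : ℤ) * (2 * Real.pi * Complex.I) := by push_cast; ring
    rw [e2, Complex.exp_int_mul_two_pi_mul_I]
    simp

lemma integral_angleCube_char {d : ℕ} (α β : MultiIndex d) :
    ∫ θ in angleCube d, (∏ j, Complex.exp (θ j * Complex.I) ^ β j) * angleChar α θ =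
      if β = α then (2 * Real.pi : ℂ) ^ d else 0 := by
  have e1 : ∀ θ : Fin d → ℝ, (∏ j, Complex.exp (θ j * Complex.I) ^ β j) * angleChar α θ =
      ∏ j, (fun t : ℝ => Complex.exp (t * Complex.I) ^ β j *
        Complex.exp (-((α j : ℂ) * (t * Complex.I)))) (θ j) := fun θ => by
    rw [angleChar, ← Finset.prod_mul_distrib]
  simp only [e1]
  rw [restrict_angleCube, MeasureTheory.integral_fintype_prod_eq_prod (𝕜 := ℂ)
    (fun j (t : ℝ) => Complex.exp (t * Complex.I) ^ β j *
        Complex.exp (-((α j : ℂ) * (t * Complex.I))))]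
  simp only [integral_Icc_exp]
  split_ifs with h
  · subst h; simp
  · obtain ⟨i, hi⟩ : ∃ i, β i ≠ α i := by
      by_contra! hc
      exact h (Finsupp.ext hc)
    exact Finset.prod_eq_zero (Finset.mem_univ i) (if_neg hi)

/-- Orthogonality of the characters, applied term by term. The moduli of the terms do not depend on
θ, so absolute convergence at θ = 0 already justifies the exchange with the integral. -/
lemma torusAverage_eq {d : ℕ} {F : (Fin d → ℂ) → ℂ} {R : Fin d → ℝ} {a : MultiIndex d → ℂ}
    (h : ∀ θ, HasSum (fun β : MultiIndex d => a β * ∏ i, torusMap 0 R θ i ^ β i)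
      (F (torusMap 0 R θ))) (α : MultiIndex d) :
    torusAverage F R α = a α * ∏ i, (R i : ℂ) ^ α i := by
  have e1 : ∀ θ β, a β * ∏ i, torusMap 0 R θ i ^ β i =
      (a β * ∏ i, (R i : ℂ) ^ β i) * ∏ j, Complex.exp (θ j * Complex.I) ^ β j := fun θ β => by
    rw [mul_assoc, ← Finset.prod_mul_distrib]
    simp [torusMap, mul_pow]
  have hsum : Summable fun β : MultiIndex d => ‖a β * ∏ i, (R i : ℂ) ^ β i‖ := by
    have := (h 0).summable.norm
    refine this.congr fun β => ?_
    rw [e1]; simp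
  have hcont : ∀ β : MultiIndex d, Continuous fun θ : Fin d → ℝ => (a β * ∏ i, (R i : ℂ) ^ β i) *
      ((∏ j, Complex.exp (θ j * Complex.I) ^ β j) * angleChar α θ) := fun β => by
    have := continuous_angleChar α
    fun_prop
  have hnorm : ∀ (β : MultiIndex d) (θ : Fin d → ℝ), ‖(a β * ∏ i, (R i : ℂ) ^ β i) *
      ((∏ j, Complex.exp (θ j * Complex.I) ^ β j) * angleChar α θ)‖ =
        ‖a β * ∏ i, (R i : ℂ) ^ β i‖ := fun β θ => by
    have : ‖∏ j, Complex.exp (θ j * Complex.I) ^ β j‖ = 1 := by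
      rw [norm_prod]
      refine Finset.prod_eq_one fun j _ => ?_
      rw [norm_pow, Complex.norm_exp]
      simp
    rw [norm_mul, norm_mul (∏ j, Complex.exp (θ j * Complex.I) ^ β j), norm_angleChar, this,
      mul_one, mul_one]
  have h1 := MeasureTheory.hasSum_integral_of_summable_integral_norm
    (μ := MeasureTheory.volume.restrict (angleCube d))
    (F := fun (β : MultiIndex d) (θ : Fin d → ℝ) => (a β * ∏ i, (R i : ℂ) ^ β i) *
      ((∏ j, Complex.exp (θ j * Complex.I) ^ β j) * angleChar α θ))
    (fun β => (hcont β).continuousOn.integrableOn_compact (isCompact_angleCube d)) (by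
      simp only [hnorm]
      simp only [MeasureTheory.integral_const, smul_eq_mul]
      exact hsum.mul_left _)
  have h2 : ∀ β : MultiIndex d, ∫ θ in angleCube d, (a β * ∏ i, (R i : ℂ) ^ β i) *
      ((∏ j, Complex.exp (θ j * Complex.I) ^ β j) * angleChar α θ) =
        if β = α then (a α * ∏ i, (R i : ℂ) ^ α i) * (2 * Real.pi : ℂ) ^ d else 0 := fun β => by
    rw [MeasureTheory.integral_const_mul, integral_angleCube_char]
    split_ifs with hβ
    · rw [hβ]
    · simp
  simp only [h2] at h1
  have h3 := h1.unique (hasSum_ite_eq α _)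
  have h4 : ∫ θ in angleCube d, F (torusMap 0 R θ) * angleChar α θ =
      (a α * ∏ i, (R i : ℂ) ^ α i) * (2 * Real.pi : ℂ) ^ d := by
    rw [← h3]
    refine MeasureTheory.integral_congr_ae (.of_forall fun θ => ?_)
    have h5 := (h θ).mul_right (angleChar α θ)
    refine h5.tsum_eq.symm.trans (tsum_congr fun β => ?_)
    rw [e1]; ring
  have hpi : (2 * Real.pi : ℂ) ^ d ≠ 0 :=
    pow_ne_zero _ (mul_ne_zero two_ne_zero (by exact_mod_cast Real.pi_ne_zero))
  rw [torusAverage, h4]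
  field_simp

/-! ### Cauchy's formula on polydiscs and global power series -/

lemma continuous_cauchyKernel {d : ℕ} {R : ℝ} {z : Fin d → ℂ} (hz : ∀ i, ‖z i‖ < R) :
    Continuous fun θ : Fin d → ℝ => ∏ i, (torusMap 0 (fun _ => R) θ i - z i)⁻¹ := by
  refine continuous_finsetProd _ fun i _ => ?_
  have hc : Continuous fun θ => torusMap 0 (fun _ => R) θ i - z i :=
    ((continuous_apply i).comp (continuous_torusMap 0 fun _ => R)).sub continuous_const
  refine hc.inv₀ fun θ h0 => ?_
  have h1 := norm_torusMap_zero (fun _ => R) θ i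
  rw [sub_eq_zero.1 h0] at h1
  have h2 := hz i
  rw [h1] at h2
  exact (le_abs_self R).not_gt h2

/-- Induction on d: the inner integral over the last d variables is Cauchy's formula by hypothesis,
the outer one is the formula in one variable. -/
lemma torusIntegral_cauchy {d : ℕ} {R : ℝ} {F : (Fin d → ℂ) → ℂ} (hF : Differentiable ℂ F)
    {z : Fin d → ℂ} (hz : ∀ i, ‖z i‖ < R) :
    torusIntegral (fun w => (∏ i, (w i - z i)⁻¹) * F w) 0 (fun _ => R) =
      (2 * Real.pi * Complex.I) ^ d * F z := by
  induction d with
  | zero =>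
    rw [torusIntegral_dim0]
    simp only [Finset.univ_eq_empty, Finset.prod_empty, pow_zero]
    rw [Subsingleton.elim (0 : Fin 0 → ℂ) z]
  | succ d ih =>
    have hint : TorusIntegrable (fun w : Fin (d + 1) → ℂ => (∏ i, (w i - z i)⁻¹) * F w) 0
        (fun _ => R) :=
      ((continuous_cauchyKernel hz).mul
        (hF.continuous.comp (continuous_torusMap _ _))).continuousOn.integrableOn_compact
          isCompact_Icc
    rw [torusIntegral_succ hint]
    have e1 : ∀ x : ℂ, torusIntegral (fun y : Fin d → ℂ =>
        (∏ i, ((Fin.cons x y : Fin (d + 1) → ℂ) i - z i)⁻¹) * F (Fin.cons x y))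
          ((0 : Fin (d + 1) → ℂ) ∘ Fin.succ) ((fun _ => R) ∘ Fin.succ) =
        (x - z 0)⁻¹ • ((2 * Real.pi * Complex.I) ^ d * F (Fin.cons x fun i => z i.succ)) := fun x => by
      have hG : Differentiable ℂ fun y : Fin d → ℂ => F (Fin.cons x y) := by
        refine hF.comp ?_
        rw [differentiable_pi]
        intro i
        refine Fin.cases ?_ (fun j => ?_) i
        · simp
        · simpa using differentiable_apply j
      have h1 := ih hG (z := fun i => z i.succ) fun i => hz i.succ
      rw [← h1, smul_eq_mul, ← torusIntegral_const_mul]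
      simp only [Fin.prod_univ_succ, Fin.cons_zero, Fin.cons_succ, mul_assoc]
      rfl
    simp only [e1]
    have hG : Differentiable ℂ fun x : ℂ =>
        (2 * Real.pi * Complex.I) ^ d * F (Fin.cons x fun i => z i.succ) := by
      refine (hF.comp ?_).const_mul _
      rw [differentiable_pi]
      intro i
      refine Fin.cases ?_ (fun j => ?_) i
      · simp
      · simp
    have h2 := hG.diffContOnCl (s := Metric.ball 0 R) |>.circleIntegral_sub_inv_smul
      (w := z 0) (by simpa using hz 0)
    simp only [Pi.zero_apply]
    rw [h2, smul_eq_mul, pow_succ]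
    have e2 : (Fin.cons (z 0) fun i => z i.succ : Fin (d + 1) → ℂ) = z := Fin.cons_self_tail z
    rw [e2]
    ring

/-- The Cauchy kernel is expanded into geometric series in z_i/w_i and integrated term by term over
the torus. -/
lemma hasSum_torusAverage {d : ℕ} {R : ℝ} (hR : 0 < R) {F : (Fin d → ℂ) → ℂ}
    (hF : Differentiable ℂ F) {z : Fin d → ℂ} (hz : ∀ i, ‖z i‖ < R) :
    HasSum (fun α : MultiIndex d => torusAverage F (fun _ => R) α * ∏ i, (z i / R) ^ α i)
      (F z) := by
  have hRC : (R : ℂ) ≠ 0 := by exact_mod_cast hR.ne'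
  set w : (Fin d → ℝ) → Fin d → ℂ := torusMap 0 fun _ => R with hw
  have hwi : ∀ θ i, w θ i = R * Complex.exp (θ i * Complex.I) := fun θ i => by
    simp [hw, torusMap]
  have hw0 : ∀ θ i, w θ i ≠ 0 := fun θ i => by
    rw [hwi]; exact mul_ne_zero hRC (Complex.exp_ne_zero _)
  have hwn : ∀ θ i, ‖w θ i‖ = R := fun θ i => by
    rw [hw, norm_torusMap_zero, abs_of_pos hR]
  have hFw : Continuous fun θ => F (w θ) := hF.continuous.comp (continuous_torusMap _ _)
  obtain ⟨M, hM⟩ := (isCompact_angleCube d).exists_bound_of_continuousOn hFw.continuousOn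
  have hchar : ∀ (α : MultiIndex d) θ, angleChar α θ * ∏ i, (z i / R) ^ α i =
      ∏ i, (z i / w θ i) ^ α i := fun α θ => by
    rw [angleChar, ← Finset.prod_mul_distrib]
    refine Finset.prod_congr rfl fun i _ => ?_
    rw [hwi, ← mul_neg, Complex.exp_nat_mul, ← mul_pow, Complex.exp_neg]
    congr 1
    field_simp
  have hq : ∀ i, ‖z i‖ / R < 1 := fun i => (div_lt_one hR).2 (hz i)
  have hsumR : Summable fun α : MultiIndex d => ∏ i, (‖z i‖ / R) ^ α i :=
    (hasSum_multiIndex_prod (fun i (n : ℕ) => (‖z i‖ / R) ^ n) _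
      (fun i => hasSum_geometric_of_lt_one (by positivity) (hq i)) fun i =>
        (hasSum_geometric_of_lt_one (by positivity) (hq i)).summable.norm).summable
  have hgeo : ∀ θ, HasSum (fun α : MultiIndex d => ∏ i, (z i / w θ i) ^ α i)
      (∏ i, (1 - z i / w θ i)⁻¹) := fun θ => by
    have hlt : ∀ i, ‖z i / w θ i‖ < 1 := fun i => by rw [norm_div, hwn]; exact hq i
    exact hasSum_multiIndex_prod (fun i (n : ℕ) => (z i / w θ i) ^ n) _
      (fun i => hasSum_geometric_of_norm_lt_one (hlt i)) fun i => by
        simpa only [norm_pow] using summable_geometric_of_lt_one (norm_nonneg _) (hlt i)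
  have hcont : ∀ α : MultiIndex d, Continuous fun θ =>
      F (w θ) * angleChar α θ * ∏ i, (z i / R) ^ α i := fun α =>
    (hFw.mul (continuous_angleChar α)).mul continuous_const
  have hint : ∀ α : MultiIndex d, MeasureTheory.IntegrableOn (fun θ =>
      F (w θ) * angleChar α θ * ∏ i, (z i / R) ^ α i) (angleCube d) := fun α =>
    (hcont α).continuousOn.integrableOn_compact (isCompact_angleCube d)
  have hsum : Summable fun α : MultiIndex d => ∫ θ in angleCube d,
      ‖F (w θ) * angleChar α θ * ∏ i, (z i / R) ^ α i‖ := by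
    refine Summable.of_nonneg_of_le
      (fun α => MeasureTheory.integral_nonneg fun θ => norm_nonneg _) (fun α => ?_)
      (hsumR.mul_left (M * (2 * Real.pi) ^ d))
    have h1 := MeasureTheory.norm_setIntegral_le_of_norm_le_const (μ := MeasureTheory.volume)
      (f := fun θ => ‖F (w θ) * angleChar α θ * ∏ i, (z i / R) ^ α i‖)
      (C := M * ∏ i, (‖z i‖ / R) ^ α i) (isCompact_angleCube d).measure_lt_top fun θ hθ => by
        rw [norm_norm, norm_mul, norm_mul, norm_angleChar, mul_one, norm_prod]
        have : ∀ i, ‖(z i / R) ^ α i‖ = (‖z i‖ / R) ^ α i := fun i => by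
          rw [norm_pow, norm_div, Complex.norm_real, Real.norm_eq_abs, abs_of_pos hR]
        simp only [this]
        exact mul_le_mul_of_nonneg_right (hM θ hθ) (Finset.prod_nonneg fun i _ => by positivity)
    rw [volume_angleCube] at h1
    refine (Real.le_norm_self _).trans (h1.trans (le_of_eq ?_))
    ring
  have h1 := MeasureTheory.hasSum_integral_of_summable_integral_norm hint hsum
  have h2 := h1.mul_left ((2 * Real.pi : ℂ) ^ d)⁻¹
  have hpi : (2 * Real.pi : ℂ) ≠ 0 := mul_ne_zero two_ne_zero (by exact_mod_cast Real.pi_ne_zero)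
  have e1 : ((2 * Real.pi : ℂ) ^ d)⁻¹ * ∫ θ in angleCube d, ∑' α : MultiIndex d,
      F (w θ) * angleChar α θ * ∏ i, (z i / R) ^ α i = F z := by
    have h3 := torusIntegral_cauchy hF hz
    -- The parametrization of the torus contributes i^d ∏ w_i; the factors w_i turn (w_i - z_i)^{-1}
    -- into (1 - z_i/w_i)^{-1}.
    have e2 : (Complex.I ^ d) * ∫ θ in angleCube d, ∑' α : MultiIndex d,
        F (w θ) * angleChar α θ * ∏ i, (z i / R) ^ α i = (2 * Real.pi * Complex.I) ^ d * F z := by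
      rw [← h3, torusIntegral, ← MeasureTheory.integral_const_mul]
      refine MeasureTheory.integral_congr_ae (.of_forall fun θ => ?_)
      have e3 : ∑' α : MultiIndex d, F (w θ) * angleChar α θ * ∏ i, (z i / R) ^ α i =
          F (w θ) * ∏ i, (1 - z i / w θ i)⁻¹ := by
        rw [← ((hgeo θ).mul_left _).tsum_eq]
        refine tsum_congr fun α => ?_
        rw [mul_assoc, hchar]
      have e4 : ∀ i, (1 - z i / w θ i)⁻¹ = w θ i * (w θ i - z i)⁻¹ := fun i => by
        have hne : w θ i - z i ≠ 0 := fun h0 => by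
          have h4 := hwn θ i
          rw [sub_eq_zero.1 h0] at h4
          exact (hz i).ne h4
        have := hw0 θ i
        rw [one_sub_div this, inv_div]
        field_simp
      simp only [e3, e4, Finset.prod_mul_distrib, smul_eq_mul, ← hwi]
      rw [Finset.prod_const, Finset.card_univ, Fintype.card_fin]
      ring
    rw [mul_pow, mul_comm (_ ^ d) (Complex.I ^ d), mul_assoc] at e2
    rw [mul_left_cancel₀ (pow_ne_zero d Complex.I_ne_zero) e2]
    field_simp
  rw [e1] at h2
  refine h2.congr_fun fun α => ?_
  rw [torusAverage, mul_assoc, ← MeasureTheory.integral_mul_const]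

/-- The averages over the unit torus serve as coefficients for every z: the expansion in a polydisc
of radius R > 1 contains the unit torus, and averaging it there shows that its coefficients are the
same. -/
lemma exists_hasSum_of_differentiable {d : ℕ} {F : (Fin d → ℂ) → ℂ} (hF : Differentiable ℂ F) :
    ∃ a : MultiIndex d → ℂ, ∀ z : Fin d → ℂ,
      HasSum (fun α : MultiIndex d => a α * ∏ i, z i ^ α i) (F z) := by
  refine ⟨torusAverage F fun _ => 1, fun z => ?_⟩
  set R : ℝ := 2 + ‖z‖ with hR
  have hR1 : 1 < R := by linarith [norm_nonneg z]
  have hR0 : 0 < R := by linarith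
  have key : ∀ v : Fin d → ℂ, (∀ i, ‖v i‖ < R) → HasSum (fun α : MultiIndex d =>
      (torusAverage F (fun _ => R) α / ∏ i, (R : ℂ) ^ α i) * ∏ i, v i ^ α i) (F v) := fun v hv => by
    refine (hasSum_torusAverage hR0 hF hv).congr_fun fun α => ?_
    simp only [div_pow, Finset.prod_div_distrib]
    ring
  have h1 : ∀ α, torusAverage F (fun _ => 1) α =
      torusAverage F (fun _ => R) α / ∏ i, (R : ℂ) ^ α i := fun α => by
    rw [torusAverage_eq (R := fun _ => 1) (F := F) fun θ => key _ fun i => by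
      rw [norm_torusMap_zero]; simpa using hR1]
    simp
  simp only [h1]
  exact key z fun i => (norm_le_pi_norm z i).trans_lt (by linarith)

/-- Cauchy's inequality, with a separate radius for each variable. Zero radii are allowed, because
the radii √α_i used later may vanish. -/
lemma norm_coeff_mul_le {d : ℕ} {P : MvPowerSeries (Fin d) ℂ} {F : CSpace d → ℂ}
    (h : HasSumOnSpace P F) {R : Fin d → ℝ} (hR : ∀ i, 0 ≤ R i) {M : ℝ}
    (hM : ∀ z : CSpace d, (∀ i, ‖z i‖ = R i) → ‖F z‖ ≤ M) (α : MultiIndex d) :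
    ‖MvPowerSeries.coeff α P‖ * ∏ i, R i ^ α i ≤ M := by
  have h1 := torusAverage_eq (F := fun v => F (WithLp.toLp 2 v)) (R := R)
    (a := fun α => MvPowerSeries.coeff α P) (fun θ => h (WithLp.toLp 2 (torusMap 0 R θ))) α
  have h2 : ‖torusAverage (fun v => F (WithLp.toLp 2 v)) R α‖ ≤ M :=
    norm_torusAverage_le (fun θ => hM _ fun i => by
      change ‖torusMap 0 R θ i‖ = R i
      rw [norm_torusMap_zero, abs_of_nonneg (hR i)]) α
  rw [h1, norm_mul, norm_prod] at h2
  convert h2 using 3 with i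
  rw [norm_pow, Complex.norm_real, Real.norm_eq_abs, abs_of_nonneg (hR i)]

lemma exists_hasSumOnSpace {d : ℕ} {F : CSpace d → ℂ} (hF : Differentiable ℂ F) :
    ∃ P : MvPowerSeries (Fin d) ℂ, HasSumOnSpace P F := by
  have h1 : Differentiable ℂ fun v : Fin d → ℂ => F (WithLp.toLp 2 v) :=
    hF.comp (EuclideanSpace.equiv (Fin d) ℂ).symm.differentiable
  obtain ⟨a, ha⟩ := exists_hasSum_of_differentiable h1
  exact ⟨a, fun z => ha (WithLp.ofLp z)⟩

/-! ### Sums of everywhere convergent power series are entire -/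

lemma hasFDerivAt_monomial {d : ℕ} (α : MultiIndex d) (z : CSpace d) :
    HasFDerivAt (fun z : CSpace d => ∏ i, z i ^ α i)
      (∑ i, ((∏ j ∈ Finset.univ.erase i, z j ^ α j) * (α i * z i ^ (α i - 1))) •
        (EuclideanSpace.proj i : CSpace d →L[ℂ] ℂ)) z := by
  have h1 : ∀ i ∈ Finset.univ, HasFDerivAt (fun z : CSpace d => z i ^ α i)
      ((α i * z i ^ (α i - 1)) • (EuclideanSpace.proj i : CSpace d →L[ℂ] ℂ)) z := fun i _ => by
    exact HasDerivAt.comp_hasFDerivAt (f := fun z : CSpace d => z i) z (hasDerivAt_pow (α i) (z i))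
      (EuclideanSpace.proj i : CSpace d →L[ℂ] ℂ).hasFDerivAt
  refine (HasFDerivAt.finsetProd h1).congr_fderiv ?_
  refine Finset.sum_congr rfl fun i _ => ?_
  rw [smul_smul]

lemma norm_fderiv_monomial_le {d : ℕ} (α : MultiIndex d) {z : CSpace d} {ρ : ℝ} (hρ : 1 ≤ ρ)
    (hz : ‖z‖ ≤ ρ) :
    ‖∑ i, ((∏ j ∈ Finset.univ.erase i, z j ^ α j) * (α i * z i ^ (α i - 1))) •
        (EuclideanSpace.proj i : CSpace d →L[ℂ] ℂ)‖ ≤ (2 * ρ) ^ α.length := by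
  have hzi : ∀ i, ‖z i‖ ≤ ρ := fun i => (PiLp.norm_apply_le z i).trans hz
  have hρ0 : 0 ≤ ρ := by linarith
  have hproj : ∀ i, ‖(EuclideanSpace.proj i : CSpace d →L[ℂ] ℂ)‖ ≤ 1 := fun i =>
    ContinuousLinearMap.opNorm_le_bound _ zero_le_one fun v => by
      rw [one_mul]; exact PiLp.norm_apply_le v i
  have h1 : ∀ i, ‖((∏ j ∈ Finset.univ.erase i, z j ^ α j) * (α i * z i ^ (α i - 1))) •
        (EuclideanSpace.proj i : CSpace d →L[ℂ] ℂ)‖ ≤ α i * ρ ^ α.length := fun i => by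
    rw [norm_smul, norm_mul, norm_mul, norm_prod, Complex.norm_natCast, norm_pow]
    calc _ ≤ (∏ j ∈ Finset.univ.erase i, ρ ^ α j) * (α i * ρ ^ α i) * 1 := by
          refine mul_le_mul (mul_le_mul ?_ ?_ (by positivity)
            (Finset.prod_nonneg fun j _ => by positivity)) (hproj i) (norm_nonneg _)
            (mul_nonneg (Finset.prod_nonneg fun j _ => by positivity) (by positivity))
          · refine Finset.prod_le_prod (fun j _ => norm_nonneg _) fun j _ => ?_
            rw [norm_pow]
            exact pow_le_pow_left₀ (norm_nonneg _) (hzi j) _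
          · refine mul_le_mul_of_nonneg_left ?_ (by positivity)
            exact (pow_le_pow_left₀ (norm_nonneg _) (hzi i) _).trans
              (pow_le_pow_right₀ hρ (Nat.sub_le _ _))
      _ = α i * (ρ ^ α i * ∏ j ∈ Finset.univ.erase i, ρ ^ α j) := by ring
      _ = _ := by rw [Finset.mul_prod_erase _ (fun i => ρ ^ α i) (Finset.mem_univ i), prod_pow_coord]
  refine (norm_sum_le _ _).trans ((Finset.sum_le_sum fun i _ => h1 i).trans ?_)
  rw [← Finset.sum_mul, mul_pow]
  refine mul_le_mul_of_nonneg_right ?_ (by positivity)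
  have h2 : α.length ≤ 2 ^ α.length := Nat.lt_two_pow_self.le
  have h3 : ∑ i, (α i : ℝ) = α.length := by rw [MultiIndex.length]; push_cast; rfl
  rw [h3]
  exact_mod_cast h2

lemma differentiable_of_hasSumOnSpace {d : ℕ} {P : MvPowerSeries (Fin d) ℂ} {F : CSpace d → ℂ}
    (h : HasSumOnSpace P F) : Differentiable ℂ F := by
  intro z
  set ρ : ℝ := ‖z‖ + 1 with hρ
  have hρ1 : 1 ≤ ρ := by linarith [norm_nonneg z]
  -- Absolute convergence at the point (2ρ, ..., 2ρ) dominates the derivatives of all terms on the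
  -- ball of radius ρ; the 2 absorbs the factor |α| ≤ 2^{|α|} from differentiation.
  have hu : Summable fun α : MultiIndex d =>
      ‖MvPowerSeries.coeff α P‖ * (2 * ρ) ^ α.length := by
    have := (h (WithLp.toLp 2 fun _ => ((2 * ρ : ℝ) : ℂ))).summable.norm
    refine this.congr fun α => ?_
    rw [norm_mul, prod_pow_coord, norm_pow, Complex.norm_real, Real.norm_eq_abs,
      abs_of_nonneg (by positivity)]
  have hz : z ∈ Metric.ball (0 : CSpace d) ρ := by rw [mem_ball_zero_iff]; linarith
  set p : MultiIndex d → CSpace d → ℂ :=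
    fun α z => MvPowerSeries.coeff α P * ∏ i, z i ^ α i with hp
  set p' : MultiIndex d → CSpace d → CSpace d →L[ℂ] ℂ := fun α z => MvPowerSeries.coeff α P •
      ∑ i, ((∏ j ∈ Finset.univ.erase i, z j ^ α j) * ((α i : ℂ) * z i ^ (α i - 1))) •
        (EuclideanSpace.proj i : CSpace d →L[ℂ] ℂ) with hp'
  have d1 : ∀ α x, x ∈ Metric.ball (0 : CSpace d) ρ → HasFDerivAt (p α) (p' α x) x :=
    fun α x _ => (hasFDerivAt_monomial α x).const_mul _
  have d2 : ∀ α x, x ∈ Metric.ball (0 : CSpace d) ρ → ‖p' α x‖ ≤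
      ‖MvPowerSeries.coeff α P‖ * (2 * ρ) ^ α.length := fun α x hx => by
    simp only [hp']
    rw [norm_smul]
    exact mul_le_mul_of_nonneg_left (norm_fderiv_monomial_le α hρ1
        (mem_ball_zero_iff.1 hx).le) (norm_nonneg _)
  have h1 := hasFDerivAt_tsum_of_isPreconnected hu Metric.isOpen_ball
    (convex_ball (0 : CSpace d) ρ).isPreconnected d1 d2 hz (h z).summable hz
  have h2 : F = fun z => ∑' α : MultiIndex d, MvPowerSeries.coeff α P * ∏ i, z i ^ α i :=
    funext fun z => (h z).tsum_eq.symm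
  rw [h2]
  exact h1.differentiableAt

/-! ### Weights and coefficient decay -/

lemma hasSum_exp_multiIndex {d : ℕ} (x : Fin d → ℝ) :
    HasSum (fun α : MultiIndex d => ∏ i, (x i ^ α i / (α i).factorial)) (Real.exp (∑ i, x i)) := by
  have h : ∀ t : ℝ, HasSum (fun n : ℕ => t ^ n / n.factorial) (Real.exp t) := fun t => by
    rw [Real.exp_eq_exp_ℝ]; exact NormedSpace.expSeries_div_hasSum_exp t
  rw [Real.exp_sum]
  exact hasSum_multiIndex_prod (fun i (n : ℕ) => x i ^ n / n.factorial) _ (fun i => h (x i))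
    fun i => (h (x i)).summable.norm

/-- The terms `|z^α|² / α!`. -/
def expTerm {d : ℕ} (z : CSpace d) (α : MultiIndex d) : ℝ :=
  ∏ i, ((‖z i‖ ^ 2) ^ α i / (α i).factorial)

lemma expTerm_nonneg {d : ℕ} (z : CSpace d) (α : MultiIndex d) : 0 ≤ expTerm z α :=
  Finset.prod_nonneg fun i _ => by positivity

lemma hasSum_expTerm {d : ℕ} (z : CSpace d) : HasSum (expTerm z) (Real.exp (‖z‖ ^ 2)) := by
  rw [EuclideanSpace.norm_sq_eq]
  exact hasSum_exp_multiIndex fun i => ‖z i‖ ^ 2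

lemma hasSum_pow_mul_expTerm {d : ℕ} (z : CSpace d) (q : ℝ) :
    HasSum (fun α => q ^ α.length * expTerm z α) (Real.exp (q * ‖z‖ ^ 2)) := by
  rw [EuclideanSpace.norm_sq_eq, Finset.mul_sum]
  refine (hasSum_exp_multiIndex fun i => q * ‖z i‖ ^ 2).congr_fun fun α => ?_
  rw [expTerm, ← prod_pow_coord, ← Finset.prod_mul_distrib]
  refine Finset.prod_congr rfl fun i _ => ?_
  rw [mul_pow]; ring

lemma decay_le_one {d : ℕ} {s r : ℝ} (hr : 0 ≤ r) (α : MultiIndex d) : decay s r α ≤ 1 := by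
  rw [decay, Real.exp_le_one_iff]
  have : 0 ≤ (α.length : ℝ) ^ (1 / (2 * s)) := by positivity
  nlinarith

lemma summable_decay_mul_expTerm {d : ℕ} {s r : ℝ} (hr : 0 ≤ r) (z : CSpace d) :
    Summable fun α => decay s r α * expTerm z α :=
  Summable.of_nonneg_of_le (fun α => mul_nonneg (decay_pos _ _ _).le (expTerm_nonneg z α))
    (fun α => mul_le_of_le_one_left (expTerm_nonneg z α) (decay_le_one hr α))
    (hasSum_expTerm z).summable

lemma sq_exp (x : ℝ) : Real.exp x ^ 2 = Real.exp (2 * x) := by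
  rw [← Real.exp_nat_mul]; norm_num

lemma rpow_inv_eq_sq_rpow {s x : ℝ} (hx : 0 ≤ x) : x ^ (1 / s) = (x ^ 2) ^ (1 / (2 * s)) := by
  rw [← Real.rpow_natCast x 2, ← Real.rpow_mul hx]
  congr 1
  push_cast
  rw [one_div, one_div, mul_inv]
  ring

lemma norm_sq_eq_rePart_add_imPart {d : ℕ} (z : CSpace d) :
    ‖z‖ ^ 2 = ‖rePart z‖ ^ 2 + ‖imPart z‖ ^ 2 := by
  rw [EuclideanSpace.norm_sq_eq, EuclideanSpace.real_norm_sq_eq, EuclideanSpace.real_norm_sq_eq,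
    ← Finset.sum_add_distrib]
  refine Finset.sum_congr rfl fun i _ => ?_
  rw [← Complex.normSq_eq_norm_sq, Complex.normSq_apply, rePart, imPart]
  ring

/-- With X = |z|², the sum is split at |α| = X/4. Above, the decay is at most e^{-4rX^γ}, and w² ≥
e^{X-4rX^γ}. Below, 1 ≤ e^{X/4}e^{-|α|} gives at most e^{X/4+X/e} ≤ e^{3X/4}, which is smaller
because X^γ is sublinear. -/
lemma exists_tsum_le_of_half_lt {d : ℕ} {s r : ℝ} (hs : 1 / 2 < s) (hr : 0 < r) :
    ∃ r' C : ℝ, 0 < r' ∧ 0 ≤ C ∧ ∀ z : CSpace d,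
      ∑' α, decay s r' α * expTerm z α ≤ C * entireWeight s r z ^ 2 := by
  have hs0 : 0 < s := by linarith
  set γ := 1 / (2 * s) with hγ
  have hγ0 : 0 < γ := by positivity
  have hγ1 : γ < 1 := by rw [hγ, div_lt_one (by positivity)]; linarith
  obtain ⟨D, hD⟩ := exists_mul_rpow_le hγ0 hγ1 (show 0 ≤ 4 * (4 * r) by positivity)
  -- The factor 4^γ undoes the division in (X/4)^γ.
  refine ⟨4 * r * 4 ^ γ, 1 + Real.exp (D / 4), by positivity, by positivity, fun z => ?_⟩
  set X := ‖z‖ ^ 2 with hX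
  have hX0 : 0 ≤ X := by positivity
  have hw : Real.exp (X - 4 * r * X ^ γ) ≤ entireWeight s r z ^ 2 := by
    rw [entireWeight, if_neg (by linarith), if_neg (by linarith), sq_exp, Real.exp_le_exp]
    have e := norm_sq_eq_rePart_add_imPart z
    have h1 : ‖rePart z‖ ^ (1 / s) ≤ X ^ γ := by
      rw [rpow_inv_eq_sq_rpow (norm_nonneg _)]
      exact Real.rpow_le_rpow (by positivity) (by rw [hX, e]; linarith [sq_nonneg ‖imPart z‖]) hγ0.le
    have h2 : ‖imPart z‖ ^ (1 / s) ≤ X ^ γ := by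
      rw [rpow_inv_eq_sq_rpow (norm_nonneg _)]
      exact Real.rpow_le_rpow (by positivity) (by rw [hX, e]; linarith [sq_nonneg ‖rePart z‖]) hγ0.le
    nlinarith
  have hterm : ∀ α : MultiIndex d, decay s (4 * r * 4 ^ γ) α * expTerm z α ≤
      Real.exp (-(4 * r * X ^ γ)) * expTerm z α +
        Real.exp (X / 4) * (Real.exp (-1) ^ α.length * expTerm z α) := fun α => by
    rw [← mul_assoc, ← add_mul]
    refine mul_le_mul_of_nonneg_right ?_ (expTerm_nonneg z α)
    rcases le_total (X / 4) α.length with h | h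
    · refine le_add_of_le_of_nonneg ?_ (by positivity)
      rw [decay, Real.exp_le_exp]
      have h1 : (X / 4) ^ γ ≤ (α.length : ℝ) ^ γ := by gcongr
      rw [Real.div_rpow hX0 (by norm_num), div_le_iff₀ (by positivity)] at h1
      have h2 := mul_le_mul_of_nonneg_left h1 (show 0 ≤ 4 * r by positivity)
      rw [← hγ]
      linarith
    · refine le_add_of_nonneg_of_le (Real.exp_pos _).le ?_
      refine (decay_le_one (by positivity) α).trans ?_
      rw [← Real.exp_nat_mul, ← Real.exp_add]
      exact Real.one_le_exp (by linarith)
  have hsum := ((hasSum_expTerm z).mul_left (Real.exp (-(4 * r * X ^ γ)))).add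
    ((hasSum_pow_mul_expTerm z (Real.exp (-1))).mul_left (Real.exp (X / 4)))
  refine ((summable_decay_mul_expTerm (by positivity) z).tsum_le_tsum hterm hsum.summable).trans ?_
  rw [hsum.tsum_eq, ← Real.exp_add, ← Real.exp_add, ← hX]
  have he : Real.exp (-1) ≤ 1 / 2 := by
    rw [Real.exp_neg, one_div]
    exact inv_anti₀ (by norm_num) (by linarith [Real.add_one_le_exp (1 : ℝ)])
  have h1 : Real.exp (X / 4 + Real.exp (-1) * X) ≤
      Real.exp (D / 4) * Real.exp (X - 4 * r * X ^ γ) := by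
    rw [← Real.exp_add, Real.exp_le_exp]
    have := hD X hX0
    have h2 : Real.exp (-1) * X ≤ 1 / 2 * X := by gcongr
    linarith
  have h3 : Real.exp (-(4 * r * X ^ γ) + X) = Real.exp (X - 4 * r * X ^ γ) := by ring_nf
  rw [h3]
  calc _ ≤ (1 + Real.exp (D / 4)) * Real.exp (X - 4 * r * X ^ γ) := by linarith
    _ ≤ _ := by gcongr

lemma exists_tsum_le_of_eq_half {d : ℕ} {s r : ℝ} (hs : s = 1 / 2) (hr : 0 < r) :
    ∃ r' C : ℝ, 0 < r' ∧ 0 ≤ C ∧ ∀ z : CSpace d,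
      ∑' α, decay s r' α * expTerm z α ≤ C * entireWeight s r z ^ 2 := by
  -- The sum is exp(e^{-r'}|z|²), and w² = e^{2r|z|²}, so e^{-r'} ≤ 2r is needed; the maximum keeps
  -- r' positive.
  set r' := max 1 (-Real.log (2 * r)) with hr'
  refine ⟨r', 1, by positivity, by norm_num, fun z => ?_⟩
  have h1 : ∀ α : MultiIndex d, decay s r' α = Real.exp (-r') ^ α.length := fun α => by
    rw [decay, ← Real.exp_nat_mul, hs]
    norm_num
    ring
  simp only [h1]
  rw [(hasSum_pow_mul_expTerm z _).tsum_eq, entireWeight, if_neg (by linarith), if_pos hs, one_mul,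
    sq_exp, Real.exp_le_exp, ← mul_assoc]
  refine mul_le_mul_of_nonneg_right ?_ (by positivity)
  rw [← Real.le_log_iff_exp_le (by positivity)]
  linarith [le_max_right 1 (-Real.log (2 * r))]

/-- A Young inequality. Either the left side is not positive, or x < (L/r)^{2s/(1-2s)}, and then xL
alone is below the right side. -/
lemma mul_sub_rpow_le {s r L x : ℝ} (hs0 : 0 < s) (hs : s < 1 / 2) (hr : 0 < r) (hL : 0 ≤ L)
    (hx : 0 ≤ x) : x * L - r * x ^ (1 / (2 * s)) ≤
      r ^ (-(2 * s / (1 - 2 * s))) * L ^ (1 / (1 - 2 * s)) := by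
  have h2s : 0 < 1 - 2 * s := by linarith
  have hq : 0 < 2 * s / (1 - 2 * s) := by positivity
  have hRHS : 0 ≤ r ^ (-(2 * s / (1 - 2 * s))) * L ^ (1 / (1 - 2 * s)) := by positivity
  rcases le_or_gt (x * L) (r * x ^ (1 / (2 * s))) with h | h
  · linarith
  · have hx0 : 0 < x := by
      rcases hx.eq_or_lt with h0 | h0
      · rw [← h0, Real.zero_rpow (by positivity)] at h; simp at h
      · exact h0
    have e1 : x ^ (1 / (2 * s)) = x ^ ((1 - 2 * s) / (2 * s)) * x := by
      rw [← Real.rpow_add_one hx0.ne']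
      congr 1
      field_simp
      ring
    rw [e1, ← mul_assoc, mul_comm x L] at h
    have h1 : r * x ^ ((1 - 2 * s) / (2 * s)) < L := lt_of_mul_lt_mul_right h hx
    have hL0 : 0 < L := lt_of_le_of_lt (by positivity) h1
    have h2 : x ≤ (L / r) ^ (2 * s / (1 - 2 * s)) := by
      calc x = (x ^ ((1 - 2 * s) / (2 * s))) ^ (2 * s / (1 - 2 * s)) := by
            rw [← Real.rpow_mul hx, div_mul_div_comm, mul_comm (1 - 2 * s), div_self (by positivity),
              Real.rpow_one]
        _ ≤ _ := by
            refine Real.rpow_le_rpow (by positivity) ?_ hq.le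
            rw [le_div_iff₀ hr]; linarith
    have e2 : L ^ (1 / (1 - 2 * s)) = L ^ (2 * s / (1 - 2 * s)) * L := by
      rw [← Real.rpow_add_one hL0.ne']
      congr 1
      field_simp
      ring
    have e3 : (L / r) ^ (2 * s / (1 - 2 * s)) =
        r ^ (-(2 * s / (1 - 2 * s))) * L ^ (2 * s / (1 - 2 * s)) := by
      rw [Real.div_rpow hL hr.le, Real.rpow_neg hr.le]; ring
    rw [e2, ← mul_assoc, ← e3]
    have h3 : 0 ≤ r * x ^ (1 / (2 * s)) := by positivity
    nlinarith

lemma exists_tsum_le_of_lt_half {d : ℕ} {s r : ℝ} (hs0 : 0 < s) (hs : s < 1 / 2) (hr : 0 < r) :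
    ∃ r' C : ℝ, 0 < r' ∧ 0 ≤ C ∧ ∀ z : CSpace d,
      ∑' α, decay s r' α * expTerm z α ≤ C * entireWeight s r z ^ 2 := by
  have h2s : 0 < 1 - 2 * s := by linarith
  set p := 1 / (1 - 2 * s) with hp
  set q := 2 * s / (1 - 2 * s) with hq
  have hq0 : 0 < q := by positivity
  set B := 2 * r / 2 ^ p with hB
  have hB0 : 0 < B := by positivity
  refine ⟨B ^ (-(1 / q)), Real.exp (∑ _i : Fin d, 1), by positivity, by positivity, fun z => ?_⟩
  have hr' : (B ^ (-(1 / q))) ^ (-q) = B := by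
    rw [← Real.rpow_mul hB0.le]
    have : -(1 / q) * -q = 1 := by field_simp
    rw [this, Real.rpow_one]
  set L := Real.log (1 + ‖z‖ ^ 2) with hL
  have hL0 : 0 ≤ L := Real.log_nonneg (by linarith [sq_nonneg ‖z‖])
  have hw : entireWeight s r z ^ 2 = Real.exp (B * L ^ p) := by
    rw [entireWeight, if_pos hs, sq_exp, Real.log_sqrt (by positivity), ← hL, ← hp,
      Real.div_rpow hL0 (by norm_num), hB]
    congr 1
    ring
  have hterm : ∀ α : MultiIndex d, decay s (B ^ (-(1 / q))) α * expTerm z α ≤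
      Real.exp (B * L ^ p) * ∏ i, ((1 : ℝ) ^ α i / (α i).factorial) := fun α => by
    have h1 : expTerm z α ≤ (1 + ‖z‖ ^ 2) ^ α.length * ∏ i, ((1 : ℝ) ^ α i / (α i).factorial) := by
      rw [expTerm, ← prod_pow_coord, ← Finset.prod_mul_distrib]
      refine Finset.prod_le_prod (fun i _ => by positivity) fun i _ => ?_
      rw [one_pow, mul_one_div]
      have : ‖z i‖ ≤ ‖z‖ := PiLp.norm_apply_le z i
      gcongr
      nlinarith [norm_nonneg (z i)]
    have h2 : decay s (B ^ (-(1 / q))) α * (1 + ‖z‖ ^ 2) ^ α.length ≤ Real.exp (B * L ^ p) := by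
      rw [← Real.exp_log (show (0 : ℝ) < 1 + ‖z‖ ^ 2 by positivity), ← hL, ← Real.exp_nat_mul, decay,
        ← Real.exp_add, Real.exp_le_exp]
      have := mul_sub_rpow_le hs0 hs (show 0 < B ^ (-(1 / q)) by positivity) hL0
        (show (0 : ℝ) ≤ α.length by positivity)
      rw [← hq, hr', ← hp] at this
      linarith
    calc _ ≤ decay s (B ^ (-(1 / q))) α *
          ((1 + ‖z‖ ^ 2) ^ α.length * ∏ i, ((1 : ℝ) ^ α i / (α i).factorial)) :=
          mul_le_mul_of_nonneg_left h1 (decay_pos _ _ _).le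
      _ ≤ _ := by
          rw [← mul_assoc]
          exact mul_le_mul_of_nonneg_right h2 (Finset.prod_nonneg fun i _ => by positivity)
  have hsum := (hasSum_exp_multiIndex fun _ : Fin d => (1 : ℝ)).mul_left (Real.exp (B * L ^ p))
  refine ((summable_decay_mul_expTerm (by positivity) z).tsum_le_tsum hterm hsum.summable).trans ?_
  rw [hsum.tsum_eq, hw, mul_comm]

lemma exists_tsum_le (d : ℕ) {s r : ℝ} (hs : 0 < s) (hr : 0 < r) :
    ∃ r' C : ℝ, 0 < r' ∧ 0 ≤ C ∧ ∀ z : CSpace d,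
      ∑' α, decay s r' α * expTerm z α ≤ C * entireWeight s r z ^ 2 := by
  rcases lt_trichotomy s (1 / 2) with h | h | h
  · exact exists_tsum_le_of_lt_half hs h hr
  · exact exists_tsum_le_of_eq_half h hr
  · exact exists_tsum_le_of_half_lt h hr

/-- The modulus of `e_α(z) = z^α / √α!`. -/
def monoNorm {d : ℕ} (z : CSpace d) (α : MultiIndex d) : ℝ :=
  (∏ i, ‖z i‖ ^ α i) / Real.sqrt α.fact

lemma fact_pos {d : ℕ} (α : MultiIndex d) : (0 : ℝ) < α.fact := by
  have : 0 < α.fact := Finset.prod_pos fun i _ => Nat.factorial_pos _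
  exact_mod_cast this

lemma monoNorm_nonneg {d : ℕ} (z : CSpace d) (α : MultiIndex d) : 0 ≤ monoNorm z α :=
  div_nonneg (Finset.prod_nonneg fun i _ => by positivity) (Real.sqrt_nonneg _)

lemma monoNorm_sq {d : ℕ} (z : CSpace d) (α : MultiIndex d) : monoNorm z α ^ 2 = expTerm z α := by
  rw [monoNorm, div_pow, Real.sq_sqrt (fact_pos α).le, expTerm, Finset.prod_div_distrib,
    MultiIndex.fact, ← Finset.prod_pow]
  push_cast
  congr 1
  exact Finset.prod_congr rfl fun i _ => by rw [← pow_mul, ← pow_mul, mul_comm]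

lemma exists_tsum_norm_le (d : ℕ) {s r : ℝ} (hs : 0 < s) (hr : 0 < r) :
    ∃ r' C : ℝ, 0 < r' ∧ 0 ≤ C ∧ ∀ (c : MultiIndex d → ℂ) (M : ℝ), 0 ≤ M →
      (∀ α, ‖c α‖ ≤ M * decay s r' α) → ∀ z : CSpace d,
        Summable (fun α => ‖c α‖ * monoNorm z α) ∧
        ∑' α, ‖c α‖ * monoNorm z α ≤ C * M * entireWeight s r z := by
  obtain ⟨r', C, hr', hC, h⟩ := exists_tsum_le d hs hr
  have hS := summable_decay d hs hr'
  set S := ∑' α : MultiIndex d, decay s r' α with hSdef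
  have hS0 : 0 ≤ S := tsum_nonneg fun α => (decay_pos _ _ _).le
  refine ⟨r', (S + C) / 2, hr', by positivity, fun c M hM hc z => ?_⟩
  set w := entireWeight s r z with hw
  have hw0 : 0 < w := entireWeight_pos s r z
  have hterm : ∀ α, ‖c α‖ * monoNorm z α ≤
      M / 2 * (w * decay s r' α + w⁻¹ * (decay s r' α * expTerm z α)) := fun α => by
    have h1 : 2 * monoNorm z α ≤ w + w⁻¹ * expTerm z α := by
      rw [← monoNorm_sq]
      have h2 : 0 ≤ w⁻¹ * (w - monoNorm z α) ^ 2 := by positivity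
      have h3 : w⁻¹ * (w - monoNorm z α) ^ 2 =
          w - 2 * monoNorm z α + w⁻¹ * monoNorm z α ^ 2 := by field_simp; ring
      linarith
    have hd := decay_pos s r' α
    calc _ ≤ M * decay s r' α * monoNorm z α :=
          mul_le_mul_of_nonneg_right (hc α) (monoNorm_nonneg z α)
      _ = M / 2 * decay s r' α * (2 * monoNorm z α) := by ring
      _ ≤ M / 2 * decay s r' α * (w + w⁻¹ * expTerm z α) := by gcongr
      _ = _ := by ring
  have hsum : Summable fun α =>
      M / 2 * (w * decay s r' α + w⁻¹ * (decay s r' α * expTerm z α)) :=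
    ((hS.mul_left w).add ((summable_decay_mul_expTerm hr'.le z).mul_left w⁻¹)).mul_left _
  have hsum0 : Summable fun α => ‖c α‖ * monoNorm z α :=
    Summable.of_nonneg_of_le (fun α => mul_nonneg (norm_nonneg _) (monoNorm_nonneg z α)) hterm hsum
  refine ⟨hsum0, (hsum0.tsum_le_tsum hterm hsum).trans ?_⟩
  rw [tsum_mul_left, (hS.mul_left w).tsum_add ((summable_decay_mul_expTerm hr'.le z).mul_left w⁻¹),
    tsum_mul_left, tsum_mul_left, ← hSdef]
  have h4 := h z
  calc _ ≤ M / 2 * (w * S + w⁻¹ * (C * w ^ 2)) := by gcongr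
    _ = _ := by field_simp

/-! ### Coefficient decay from growth -/

lemma norm_coeff_mul_le_sqrt_fact {d : ℕ} {c : FormalHermiteSeries d} {F : CSpace d → ℂ}
    (h : HasSumOnSpace (formalBargmann c) F) {R : Fin d → ℝ} (hR : ∀ i, 0 ≤ R i) {M : ℝ}
    (hM : ∀ z : CSpace d, (∀ i, ‖z i‖ = R i) → ‖F z‖ ≤ M) (α : MultiIndex d) :
    ‖c α‖ * ∏ i, R i ^ α i ≤ Real.sqrt α.fact * M := by
  have h1 := norm_coeff_mul_le h hR hM α
  have h2 : MvPowerSeries.coeff α (formalBargmann c) = c α / (Real.sqrt α.fact : ℂ) := rfl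
  have h3 : 0 < Real.sqrt α.fact := Real.sqrt_pos.2 (fact_pos α)
  rw [h2, norm_div, Complex.norm_real, Real.norm_eq_abs, abs_of_pos h3, div_mul_eq_mul_div,
    div_le_iff₀ h3] at h1
  linarith

lemma sqrt_fact_le {d : ℕ} (α : MultiIndex d) :
    Real.sqrt α.fact ≤ ∏ i, Real.sqrt (α i) ^ α i := by
  rw [Real.sqrt_le_left (Finset.prod_nonneg fun i _ => by positivity), ← Finset.prod_pow,
    MultiIndex.fact]
  push_cast
  refine Finset.prod_le_prod (fun i _ => by positivity) fun i _ => ?_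
  rw [← pow_mul, mul_comm, pow_mul, Real.sq_sqrt (by positivity)]
  exact_mod_cast Nat.factorial_le_pow (α i)

lemma sqrt_fact_mul_exp_le {d : ℕ} (α : MultiIndex d) :
    Real.sqrt α.fact * Real.exp (α.length / 2) ≤
      Real.exp 1 ^ d * ((α.length : ℝ) + 1) ^ d * ∏ i, Real.sqrt (α i) ^ α i := by
  have hQ : 0 ≤ ∏ i, Real.sqrt (α i) ^ α i := Finset.prod_nonneg fun i _ => by positivity
  have hP1 : 1 ≤ Real.exp 1 ^ d * ((α.length : ℝ) + 1) ^ d := by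
    have h1 : (1 : ℝ) ≤ Real.exp 1 := Real.one_le_exp (by norm_num)
    have h2 : (1 : ℝ) ≤ (α.length : ℝ) + 1 := by linarith [(α.length).cast_nonneg (α := ℝ)]
    exact one_le_mul_of_one_le_of_one_le (one_le_pow₀ h1) (one_le_pow₀ h2)
  refine le_of_sq_le_sq ?_ (by positivity)
  rw [mul_pow, mul_pow, Real.sq_sqrt (fact_pos α).le, sq_exp, ← Finset.prod_pow]
  have e1 : ∀ i, (Real.sqrt (α i) ^ α i) ^ 2 = (α i : ℝ) ^ α i := fun i => by
    rw [← pow_mul, mul_comm, pow_mul, Real.sq_sqrt (by positivity)]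
  simp only [e1]
  have e2 : (α.fact : ℝ) * Real.exp (2 * (α.length / 2)) =
      ∏ i, ((α i).factorial * Real.exp (α i) : ℝ) := by
    rw [Finset.prod_mul_distrib, ← Real.exp_sum, MultiIndex.fact, MultiIndex.length]
    push_cast
    congr 2
    ring
  rw [e2]
  calc _ ≤ ∏ i, (Real.exp 1 * (α i + 1) * (α i : ℝ) ^ α i) :=
        Finset.prod_le_prod (fun i _ => by positivity) fun i _ => factorial_mul_exp_le (α i)
    _ = Real.exp 1 ^ d * (∏ i, ((α i : ℝ) + 1)) * ∏ i, (α i : ℝ) ^ α i := by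
        simp [Finset.prod_mul_distrib]
    _ ≤ Real.exp 1 ^ d * ((α.length : ℝ) + 1) ^ d * ∏ i, (α i : ℝ) ^ α i := by
        have h0 : 0 ≤ ∏ i, (α i : ℝ) ^ α i := Finset.prod_nonneg fun i _ => by positivity
        gcongr
        exact prod_coord_succ_le α
    _ ≤ _ := by
        refine mul_le_mul_of_nonneg_right ?_ (Finset.prod_nonneg fun i _ => by positivity)
        nlinarith

lemma prod_sqrt_pow_pos {d : ℕ} (α : MultiIndex d) : 0 < ∏ i, Real.sqrt (α i) ^ α i :=
  (Real.sqrt_pos.2 (fact_pos α)).trans_le (sqrt_fact_le α)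

lemma norm_sq_of_torus {d : ℕ} (α : MultiIndex d) {l : ℝ} {z : CSpace d}
    (hz : ∀ i, ‖z i‖ = l * Real.sqrt (α i)) : ‖z‖ ^ 2 = l ^ 2 * α.length := by
  rw [EuclideanSpace.norm_sq_eq, MultiIndex.length, Nat.cast_sum, Finset.mul_sum]
  refine Finset.sum_congr rfl fun i _ => ?_
  rw [hz, mul_pow, Real.sq_sqrt (by positivity)]

lemma exists_coeff_le_of_half_lt {d : ℕ} {s r : ℝ} (hs : 1 / 2 < s) (hr : 0 < r) :
    ∃ r' C : ℝ, 0 < r' ∧ ∀ (c : FormalHermiteSeries d) (F : CSpace d → ℂ) (M : ℝ),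
      HasSumOnSpace (formalBargmann c) F → 0 ≤ M → (∀ z, ‖F z‖ ≤ M * entireWeight s r' z) →
        ∀ α, ‖c α‖ ≤ C * M * decay s r α := by
  have hs0 : 0 < s := by linarith
  set γ := 1 / (2 * s) with hγ
  have hγ0 : 0 < γ := by positivity
  obtain ⟨D, hD, hpoly⟩ := exists_pow_mul_decay_le d hs0 one_pos d
  refine ⟨2 ^ γ * (r + 1), Real.exp 1 ^ d * D, by positivity, fun c F M hF hM hFM α => ?_⟩
  set n : ℝ := (α.length : ℝ) with hn
  have hn0 : 0 ≤ n := by positivity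
  have hW : ∀ z : CSpace d, (∀ i, ‖z i‖ = Real.sqrt (α i)) →
      ‖F z‖ ≤ M * (Real.exp (n / 2) * decay s (r + 1) α) := fun z hz => by
    refine (hFM z).trans (mul_le_mul_of_nonneg_left ?_ hM)
    have hz2 : ‖z‖ ^ 2 = n := by
      rw [norm_sq_of_torus α (l := 1) (by simpa using hz), one_pow, one_mul]
    rw [entireWeight, if_neg (by linarith), if_neg (by linarith), decay, ← Real.exp_add,
      Real.exp_le_exp, hz2, ← hn, ← hγ]
    have e := norm_sq_eq_rePart_add_imPart z
    rw [hz2] at e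
    have h1 : (n / 2) ^ γ ≤ ‖rePart z‖ ^ (1 / s) + ‖imPart z‖ ^ (1 / s) := by
      rw [rpow_inv_eq_sq_rpow (norm_nonneg _), rpow_inv_eq_sq_rpow (norm_nonneg _), ← hγ]
      rcases le_total (‖rePart z‖ ^ 2) (‖imPart z‖ ^ 2) with h | h
      · refine le_add_of_nonneg_of_le (by positivity) ?_
        exact Real.rpow_le_rpow (by positivity) (by linarith) hγ0.le
      · refine le_add_of_le_of_nonneg ?_ (by positivity)
        exact Real.rpow_le_rpow (by positivity) (by linarith) hγ0.le
    rw [Real.div_rpow hn0 (by norm_num), div_le_iff₀ (by positivity)] at h1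
    have h2 := mul_le_mul_of_nonneg_left h1 (show 0 ≤ r + 1 by linarith)
    nlinarith
  have h1 := norm_coeff_mul_le_sqrt_fact hF (fun i => Real.sqrt_nonneg _) hW α
  have h2 := sqrt_fact_mul_exp_le α
  have hQ := prod_sqrt_pow_pos α
  have hd1 := decay_pos s (r + 1) α
  have h3 : ‖c α‖ * ∏ i, Real.sqrt (α i) ^ α i ≤
      (Real.exp 1 ^ d * (n + 1) ^ d * M * decay s (r + 1) α) * ∏ i, Real.sqrt (α i) ^ α i := by
    calc _ ≤ _ := h1
      _ = (Real.sqrt α.fact * Real.exp (n / 2)) * (M * decay s (r + 1) α) := by ring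
      _ ≤ (Real.exp 1 ^ d * (n + 1) ^ d * ∏ i, Real.sqrt (α i) ^ α i) *
          (M * decay s (r + 1) α) := by gcongr
      _ = _ := by ring
  refine (le_of_mul_le_mul_right h3 hQ).trans ?_
  have h4 := hpoly α
  have hd := decay_pos s r α
  rw [decay_add]
  calc _ = Real.exp 1 ^ d * M * decay s r α * ((n + 1) ^ d * decay s 1 α) := by ring
    _ ≤ Real.exp 1 ^ d * M * decay s r α * D := by gcongr
    _ = _ := by ring

lemma exists_coeff_le_of_eq_half {d : ℕ} {s r : ℝ} (hs : s = 1 / 2) :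
    ∃ r' C : ℝ, 0 < r' ∧ ∀ (c : FormalHermiteSeries d) (F : CSpace d → ℂ) (M : ℝ),
      HasSumOnSpace (formalBargmann c) F → 0 ≤ M → (∀ z, ‖F z‖ ≤ M * entireWeight s r' z) →
        ∀ α, ‖c α‖ ≤ C * M * decay s r α := by
  set l := Real.exp (r + 1) with hl
  have hl0 : 0 < l := Real.exp_pos _
  refine ⟨(l ^ 2)⁻¹, 1, by positivity, fun c F M hF hM hFM α => ?_⟩
  set n : ℝ := (α.length : ℝ) with hn
  have hW : ∀ z : CSpace d, (∀ i, ‖z i‖ = l * Real.sqrt (α i)) → ‖F z‖ ≤ M * Real.exp n :=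
    fun z hz => by
      refine (hFM z).trans (le_of_eq ?_)
      rw [entireWeight, if_neg (by linarith), if_pos hs, norm_sq_of_torus α hz, ← mul_assoc,
        inv_mul_cancel₀ (by positivity), one_mul]
  have h1 := norm_coeff_mul_le_sqrt_fact hF (fun i => by positivity) hW α
  have hQ := prod_sqrt_pow_pos α
  have e1 : ∏ i, (l * Real.sqrt (α i)) ^ α i =
      Real.exp ((r + 1) * n) * ∏ i, Real.sqrt (α i) ^ α i := by
    simp only [mul_pow, Finset.prod_mul_distrib, prod_pow_coord]
    rw [hl, ← Real.exp_nat_mul, mul_comm n]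
  have e2 : decay s r α = Real.exp (-r * n) := by
    rw [decay, hs]; norm_num [hn]
  rw [e1] at h1
  have h2 : (‖c α‖ * Real.exp ((r + 1) * n)) * ∏ i, Real.sqrt (α i) ^ α i ≤
      (M * Real.exp n) * ∏ i, Real.sqrt (α i) ^ α i := by
    calc _ ≤ Real.sqrt α.fact * (M * Real.exp n) := by linarith
      _ ≤ (∏ i, Real.sqrt (α i) ^ α i) * (M * Real.exp n) := by
          gcongr; exact sqrt_fact_le α
      _ = _ := by ring
  have h3 := le_of_mul_le_mul_right h2 hQ
  rw [← le_div_iff₀ (Real.exp_pos _), mul_div_assoc, ← Real.exp_sub] at h3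
  rw [e2, one_mul]
  refine h3.trans (le_of_eq ?_)
  congr 2
  ring

lemma exists_coeff_le_of_lt_half {d : ℕ} {s r : ℝ} (hs0 : 0 < s) (hs : s < 1 / 2) (hr : 0 < r) :
    ∃ r' C : ℝ, 0 < r' ∧ ∀ (c : FormalHermiteSeries d) (F : CSpace d → ℂ) (M : ℝ),
      HasSumOnSpace (formalBargmann c) F → 0 ≤ M → (∀ z, ‖F z‖ ≤ M * entireWeight s r' z) →
        ∀ α, ‖c α‖ ≤ C * M * decay s r α := by
  have h2s : 0 < 1 - 2 * s := by linarith
  set p := 1 / (1 - 2 * s) with hp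
  have hp0 : 0 < p := by positivity
  set γ := 1 / (2 * s) with hγ
  have hγ0 : 0 < γ := by positivity
  set q := (1 - 2 * s) / (2 * s) with hq
  have hq0 : 0 < q := by positivity
  have hqγ : q + 1 = γ := by rw [hq, hγ]; field_simp; ring
  have hqp : q * p = γ := by rw [hq, hγ, hp]; field_simp
  set K := r + 1 + 1 / q with hK
  have hK0 : 0 < K := by positivity
  set D := Real.log (1 + d) with hD
  have hD0 : 0 ≤ D := Real.log_nonneg (by linarith [d.cast_nonneg (α := ℝ)])
  refine ⟨(2 ^ p * K ^ p)⁻¹, Real.exp ((K ^ p)⁻¹ * D ^ p), by positivity,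
    fun c F M hF hM hFM α => ?_⟩
  set n : ℝ := (α.length : ℝ) with hn
  have hn0 : 0 ≤ n := by positivity
  set T := K * n ^ q with hT
  have hT0 : 0 ≤ T := by positivity
  have hTp : T ^ p = K ^ p * n ^ γ := by
    rw [hT, Real.mul_rpow hK0.le (by positivity), ← Real.rpow_mul hn0, hqp]
  have hnT : n * n ^ q = n ^ γ := by
    rw [← hqγ, Real.rpow_add_one' hn0 (by positivity), mul_comm]
  have hKp : 0 < K ^ p := by positivity
  have hW : ∀ z : CSpace d, (∀ i, ‖z i‖ = Real.exp T) →
      ‖F z‖ ≤ M * Real.exp ((K ^ p)⁻¹ * D ^ p + n ^ γ) := fun z hz => by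
    refine (hFM z).trans (mul_le_mul_of_nonneg_left ?_ hM)
    rw [entireWeight, if_pos hs, Real.exp_le_exp, ← hp]
    have hz2 : ‖z‖ ^ 2 = d * Real.exp (2 * T) := by
      rw [EuclideanSpace.norm_sq_eq]
      simp [hz, sq_exp]
    have h1 : Real.log (Real.sqrt (1 + ‖z‖ ^ 2)) ≤ D + T := by
      rw [Real.log_sqrt (by positivity), hz2]
      have h2 : (1 : ℝ) + d * Real.exp (2 * T) ≤ (1 + d) * Real.exp (2 * T) := by
        linarith [Real.one_le_exp (show 0 ≤ 2 * T by positivity)]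
      have h3 := Real.log_le_log (by positivity) h2
      rw [Real.log_mul (by positivity) (by positivity), Real.log_exp, ← hD] at h3
      linarith
    have h0 : 0 ≤ Real.log (Real.sqrt (1 + ‖z‖ ^ 2)) :=
      Real.log_nonneg (Real.one_le_sqrt.2 (by linarith [sq_nonneg ‖z‖]))
    have h4 : (D + T) ^ p ≤ 2 ^ p * (D ^ p + T ^ p) := by
      rcases le_total D T with h | h
      · calc (D + T) ^ p ≤ (2 * T) ^ p := by gcongr; linarith
          _ = 2 ^ p * T ^ p := Real.mul_rpow (by norm_num) hT0
          _ ≤ _ := by gcongr; linarith [Real.rpow_nonneg hD0 p]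
      · calc (D + T) ^ p ≤ (2 * D) ^ p := by gcongr; linarith
          _ = 2 ^ p * D ^ p := Real.mul_rpow (by norm_num) hD0
          _ ≤ _ := by gcongr; linarith [Real.rpow_nonneg hT0 p]
    calc _ ≤ (2 ^ p * K ^ p)⁻¹ * (2 ^ p * (D ^ p + T ^ p)) :=
          mul_le_mul_of_nonneg_left ((Real.rpow_le_rpow h0 h1 hp0.le).trans h4) (by positivity)
      _ = _ := by rw [hTp]; field_simp
  have hfact : Real.sqrt α.fact ≤ Real.exp (n ^ γ / q) := by
    have h1 : Real.sqrt n ≤ Real.exp (n ^ q / q) := by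
      rcases hn0.eq_or_lt with h | h
      · rw [← h, Real.sqrt_zero]; exact (Real.exp_pos _).le
      · rw [← Real.log_le_iff_le_exp (Real.sqrt_pos.2 h), Real.log_sqrt hn0]
        have h2 := Real.log_le_rpow_div hn0 hq0
        have h3 : 0 ≤ n ^ q / q := by positivity
        linarith
    calc _ ≤ ∏ i, Real.sqrt (α i) ^ α i := sqrt_fact_le α
      _ ≤ ∏ i, Real.sqrt n ^ α i := by
          refine Finset.prod_le_prod (fun i _ => by positivity) fun i _ => ?_
          have : (α i : ℝ) ≤ n := by
            rw [hn, MultiIndex.length]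
            exact_mod_cast Finset.single_le_sum (f := fun i => α i) (fun _ _ => Nat.zero_le _)
              (Finset.mem_univ i)
          gcongr
      _ ≤ Real.exp (n ^ q / q) ^ α.length := by
          rw [prod_pow_coord]; gcongr
      _ = _ := by rw [← Real.exp_nat_mul, ← hn, ← hnT, mul_div_assoc]
  have h1 := norm_coeff_mul_le_sqrt_fact hF (fun i => (Real.exp_pos T).le) hW α
  rw [prod_pow_coord, ← Real.exp_nat_mul, ← hn, ← le_div_iff₀ (Real.exp_pos _)] at h1
  refine h1.trans ?_
  calc _ ≤ Real.exp (n ^ γ / q) * (M * Real.exp ((K ^ p)⁻¹ * D ^ p + n ^ γ)) /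
        Real.exp (n * T) := by gcongr
    _ = Real.exp ((K ^ p)⁻¹ * D ^ p) * M * decay s r α := by
        have e : n * T = r * n ^ γ + n ^ γ + n ^ γ / q := by
          rw [hT, mul_left_comm, hnT, hK]; ring
        rw [decay, ← hn, ← hγ, div_eq_iff (Real.exp_pos _).ne', e]
        have : ∀ a b c d : ℝ, a * (M * b) = M * (a * b) ∧ c * M * d = M * (c * d) :=
          fun a b c d => ⟨by ring, by ring⟩
        rw [(this _ _ 0 0).1, (this 0 0 _ _).2, mul_assoc M, ← Real.exp_add, ← Real.exp_add,
          ← Real.exp_add]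
        congr 2
        ring

lemma exists_coeff_le (d : ℕ) {s r : ℝ} (hs : 0 < s) (hr : 0 < r) :
    ∃ r' C : ℝ, 0 < r' ∧ ∀ (c : FormalHermiteSeries d) (F : CSpace d → ℂ) (M : ℝ),
      HasSumOnSpace (formalBargmann c) F → 0 ≤ M → (∀ z, ‖F z‖ ≤ M * entireWeight s r' z) →
        ∀ α, ‖c α‖ ≤ C * M * decay s r α := by
  rcases lt_trichotomy s (1 / 2) with h | h | h
  · exact exists_coeff_le_of_lt_half hs h hr
  · exact exists_coeff_le_of_eq_half h
  · exact exists_coeff_le_of_half_lt h hr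

/-! ### The Bargmann transform -/

lemma summable_pow_mul_monoNorm {d : ℕ} (k : ℕ) (z : CSpace d) :
    Summable fun α => ((α.length : ℝ) + 1) ^ k * monoNorm z α := by
  have hs : (0 : ℝ) < 1 / 2 := by norm_num
  obtain ⟨C, hC, h⟩ := exists_pow_mul_decay_le d hs one_pos k
  have e : ∀ (r : ℝ) (α : MultiIndex d), decay (1 / 2) r α = Real.exp (-r * α.length) :=
    fun r α => by rw [decay]; norm_num
  have hsum : Summable fun α =>
      C / 2 * (decay (1 / 2) 2 α + Real.exp 4 ^ α.length * expTerm z α) :=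
    ((summable_decay d hs two_pos).add (hasSum_pow_mul_expTerm z _).summable).mul_left _
  refine Summable.of_nonneg_of_le (fun α => mul_nonneg (by positivity) (monoNorm_nonneg z α))
    (fun α => ?_) hsum
  have h1 := h α
  rw [e, ← le_div_iff₀ (Real.exp_pos _), div_eq_mul_inv, ← Real.exp_neg, neg_mul, neg_neg,
    one_mul] at h1
  refine (mul_le_mul_of_nonneg_right h1 (monoNorm_nonneg z α)).trans ?_
  have e2 : Real.exp α.length =
      Real.exp (-α.length) * Real.exp (2 * α.length) := by rw [← Real.exp_add]; ring_nf
  have e3 : decay (1 / 2) 2 α = Real.exp (-α.length) ^ 2 := by rw [e, sq_exp]; ring_nf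
  have e4 : Real.exp 4 ^ α.length * expTerm z α =
      (Real.exp (2 * α.length) * monoNorm z α) ^ 2 := by
    rw [mul_pow, monoNorm_sq, sq_exp, ← Real.exp_nat_mul]; ring_nf
  rw [e2, e3, e4]
  nlinarith [sq_nonneg (Real.exp (-α.length) - Real.exp (2 * α.length) * monoNorm z α)]

lemma norm_coeff_formalBargmann {d : ℕ} (c : FormalHermiteSeries d) (z : CSpace d)
    (α : MultiIndex d) : ‖MvPowerSeries.coeff α (formalBargmann c) * ∏ i, z i ^ α i‖ =
      ‖c α‖ * monoNorm z α := by
  have h : MvPowerSeries.coeff α (formalBargmann c) = c α / (Real.sqrt α.fact : ℂ) := rfl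
  rw [h, norm_mul, norm_div, Complex.norm_real, Real.norm_eq_abs,
    abs_of_nonneg (Real.sqrt_nonneg _), norm_prod, monoNorm]
  simp only [norm_pow]
  ring

lemma integrable_mul_chermite {d : ℕ} {f : RSpace d → ℂ} (hf : Continuous f) {M : ℝ}
    (hM : ∀ x, ‖f x‖ ≤ M) (α : MultiIndex d) :
    MeasureTheory.Integrable fun x => f x * (hermiteFun α x : ℂ) :=
  (integrable_hermiteFun α).ofReal.bdd_mul hf.aestronglyMeasurable (.of_forall hM)

lemma hasSumOnSpace_bargmannIntegral {d : ℕ} {f : RSpace d → ℂ} (hf : Continuous f) {M : ℝ}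
    (hM : ∀ x, ‖f x‖ ≤ M) :
    HasSumOnSpace (formalBargmann (hermiteSeries f)) (bargmannIntegral f) := by
  intro z
  obtain ⟨C, hC, hL1⟩ := exists_integral_abs_hermiteFun_le d
  have hM0 : 0 ≤ M := (norm_nonneg _).trans (hM 0)
  set m : MultiIndex d → ℂ := fun α => (∏ i, z i ^ α i) / (Real.sqrt α.fact : ℂ) with hm
  have hmn : ∀ α, ‖m α‖ = monoNorm z α := fun α => by
    rw [hm, norm_div, Complex.norm_real, Real.norm_eq_abs,
      abs_of_nonneg (Real.sqrt_nonneg _), norm_prod, monoNorm]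
    simp only [norm_pow]
  have hint : ∀ α, MeasureTheory.Integrable fun y => f y * (hermiteFun α y : ℂ) * m α :=
    fun α => (integrable_mul_chermite hf hM α).mul_const _
  have hsum : Summable fun α => ∫ y, ‖f y * (hermiteFun α y : ℂ) * m α‖ := by
    refine Summable.of_nonneg_of_le (fun α => MeasureTheory.integral_nonneg fun y => norm_nonneg _)
      (fun α => ?_) ((summable_pow_mul_monoNorm (d * 3) z).mul_left (M * C))
    calc _ ≤ ∫ y, M * monoNorm z α * |hermiteFun α y| := by
          refine MeasureTheory.integral_mono (hint α).norm
            ((integrable_hermiteFun α).abs.const_mul _) fun y => ?_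
          change ‖f y * (hermiteFun α y : ℂ) * m α‖ ≤ _
          rw [norm_mul, norm_mul, hmn, Complex.norm_real, Real.norm_eq_abs]
          have h1 := mul_le_mul_of_nonneg_right (hM y)
            (mul_nonneg (abs_nonneg (hermiteFun α y)) (monoNorm_nonneg z α))
          linarith
      _ = M * monoNorm z α * ∫ y, |hermiteFun α y| := MeasureTheory.integral_const_mul _ _
      _ ≤ M * monoNorm z α * (C * ((α.length : ℝ) + 1) ^ (d * 3)) :=
          mul_le_mul_of_nonneg_left (hL1 α) (mul_nonneg hM0 (monoNorm_nonneg z α))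
      _ = _ := by ring
  have h := MeasureTheory.hasSum_integral_of_summable_integral_norm hint hsum
  have e1 : ∀ α : MultiIndex d, MvPowerSeries.coeff α (formalBargmann (hermiteSeries f)) * ∏ i, z i ^ α i =
      ∫ y, f y * (hermiteFun α y : ℂ) * m α := fun α => by
    rw [MeasureTheory.integral_mul_const]
    have h0 : MvPowerSeries.coeff α (formalBargmann (hermiteSeries f)) =
      hermiteSeries f α / (Real.sqrt α.fact : ℂ) := rfl
    rw [h0, hm, hermiteSeries]
    ring
  have e2 : bargmannIntegral f z = ∫ y, ∑' α, f y * (hermiteFun α y : ℂ) * m α := by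
    rw [bargmannIntegral, ← MeasureTheory.integral_const_mul]
    refine congrArg _ (funext fun y => ?_)
    have h2 := ((hasSum_chermite_kernel z y).mul_left (f y)).tsum_eq
    simp only [mul_assoc, hm]
    rw [← mul_assoc, mul_comm _ (f y)]
    exact h2.symm
  simp only [e1]
  rw [e2]
  exact h

lemma PilipovicSpace.contDiff {d : ℕ} {s : ℝ} (g : PilipovicSpace d s) : ContDiff ℝ ∞ g.toFun :=
  g.2.1

lemma PilipovicSpace.exists_norm_le {d : ℕ} {s : ℝ} (g : PilipovicSpace d s) :
    ∃ M, ∀ x, ‖g.toFun x‖ ≤ M :=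
  ⟨_, norm_harmOsc_iterate_le g ⟨1, Set.mem_Ioi.2 one_pos⟩ 0⟩

lemma PilipovicSpace.hasSumOnSpace {d : ℕ} {s : ℝ} (g : PilipovicSpace d s) :
    HasSumOnSpace (formalBargmann (hermiteSeries g.toFun)) (bargmannIntegral g.toFun) :=
  have ⟨_, hM⟩ := g.exists_norm_le
  hasSumOnSpace_bargmannIntegral g.contDiff.continuous hM

lemma hermiteSeries_add {d : ℕ} {s : ℝ} (f g : PilipovicSpace d s) :
    hermiteSeries (f + g).toFun = hermiteSeries f.toFun + hermiteSeries g.toFun := by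
  obtain ⟨M, hM⟩ := f.exists_norm_le
  obtain ⟨M', hM'⟩ := g.exists_norm_le
  funext α
  rw [Pi.add_apply, hermiteSeries, hermiteSeries, hermiteSeries, ← MeasureTheory.integral_add
    (integrable_mul_chermite f.contDiff.continuous hM α)
    (integrable_mul_chermite g.contDiff.continuous hM' α)]
  refine congrArg _ (funext fun x => ?_)
  exact add_mul _ _ _

lemma hermiteSeries_smul {d : ℕ} {s : ℝ} (a : ℂ) (f : PilipovicSpace d s) :
    hermiteSeries (a • f).toFun = a • hermiteSeries f.toFun := by
  funext α
  rw [Pi.smul_apply, hermiteSeries, hermiteSeries, smul_eq_mul, ← MeasureTheory.integral_const_mul]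
  refine congrArg _ (funext fun x => ?_)
  exact mul_assoc _ _ _

lemma formalBargmann_add {d : ℕ} (c c' : FormalHermiteSeries d) :
    formalBargmann (c + c') = formalBargmann c + formalBargmann c' :=
  funext fun _ => add_div _ _ _

lemma formalBargmann_smul {d : ℕ} (a : ℂ) (c : FormalHermiteSeries d) :
    formalBargmann (a • c) = a • formalBargmann c :=
  funext fun _ => mul_div_assoc _ _ _

lemma HasSumOnSpace.unique {d : ℕ} {P : MvPowerSeries (Fin d) ℂ} {F G : CSpace d → ℂ}
    (hF : HasSumOnSpace P F) (hG : HasSumOnSpace P G) : F = G :=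
  funext fun z => (hF z).unique (hG z)

lemma HasSumOnSpace.add {d : ℕ} {P Q : MvPowerSeries (Fin d) ℂ} {F G : CSpace d → ℂ}
    (hF : HasSumOnSpace P F) (hG : HasSumOnSpace Q G) : HasSumOnSpace (P + Q) (F + G) :=
  fun z => ((hF z).add (hG z)).congr_fun fun α => by rw [map_add, add_mul]

lemma HasSumOnSpace.smul {d : ℕ} {P : MvPowerSeries (Fin d) ℂ} {F : CSpace d → ℂ}
    (hF : HasSumOnSpace P F) (a : ℂ) : HasSumOnSpace (a • P) (a • F) :=
  fun z => ((hF z).mul_left a).congr_fun fun α => by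
    rw [MvPowerSeries.coeff_smul, mul_assoc]

lemma mem_entireSubmodule {d : ℕ} {s : ℝ} {P : MvPowerSeries (Fin d) ℂ} {F : CSpace d → ℂ}
    (hP : HasSumOnSpace P F) (hF : ∀ r : ℝ, 0 < r → ∃ C, ∀ z, ‖F z‖ ≤ C * entireWeight s r z) :
    F ∈ entireSubmodule d s := by
  refine ⟨differentiable_of_hasSumOnSpace hP, fun r hr => ?_⟩
  obtain ⟨C, hC⟩ := hF r hr
  refine ⟨C, ?_⟩
  rintro _ ⟨z, rfl⟩
  exact (div_le_iff₀ (entireWeight_pos s r z)).2 (hC z)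

lemma EntireSpace.norm_le {d : ℕ} {s : ℝ} (F : EntireSpace d s) (r : Set.Ioi (0 : ℝ))
    (z : CSpace d) : ‖F.toFun z‖ ≤ entireSeminorm d s r F * entireWeight s r z :=
  (div_le_iff₀ (entireWeight_pos s r z)).1 (le_ciSup (F.2.2 r r.2) z)

lemma exists_norm_le_of_hasSumOnSpace (d : ℕ) {s r : ℝ} (hs : 0 < s) (hr : 0 < r) :
    ∃ r' C : ℝ, 0 < r' ∧ 0 ≤ C ∧ ∀ (c : FormalHermiteSeries d) (F : CSpace d → ℂ) (M : ℝ),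
      HasSumOnSpace (formalBargmann c) F → 0 ≤ M → (∀ α, ‖c α‖ ≤ M * decay s r' α) →
        ∀ z, ‖F z‖ ≤ C * M * entireWeight s r z := by
  obtain ⟨r', C, hr', hC, h⟩ := exists_tsum_norm_le d hs hr
  refine ⟨r', C, hr', hC, fun c F M hF hM hc z => ?_⟩
  obtain ⟨h1, h2⟩ := h c M hM hc z
  refine le_trans ?_ h2
  rw [← (hF z).tsum_eq]
  simp only [← norm_coeff_formalBargmann] at h1 ⊢
  exact norm_tsum_le_tsum_norm h1

lemma exists_norm_bargmannIntegral_le (d : ℕ) {s r : ℝ} (hs : 0 < s) (hr : 0 < r) :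
    ∃ (h : Set.Ioi (0 : ℝ)) (C : ℝ), 0 ≤ C ∧ ∀ (g : PilipovicSpace d s) (z : CSpace d),
      ‖bargmannIntegral g.toFun z‖ ≤ C * pilSeminorm d s h g * entireWeight s r z := by
  obtain ⟨r', C, hr', hC, h1⟩ := exists_norm_le_of_hasSumOnSpace d hs hr
  obtain ⟨h, C', hC', h2⟩ := exists_norm_hermiteSeries_le d hs hr'
  refine ⟨h, C * C', by positivity, fun g z => ?_⟩
  rw [mul_assoc C C']
  exact h1 _ _ _ g.hasSumOnSpace (mul_nonneg hC' (apply_nonneg _ _)) (h2 g) z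

/-- The Bargmann transform as a linear map between the two spaces. -/
def bargmannLinear (d : ℕ) {s : ℝ} (hs : 0 < s) : PilipovicSpace d s →ₗ[ℂ] EntireSpace d s where
  toFun g := ⟨bargmannIntegral g.toFun, mem_entireSubmodule g.hasSumOnSpace fun _ hr =>
    have ⟨_, _, _, h⟩ := exists_norm_bargmannIntegral_le d hs hr
    ⟨_, h g⟩⟩
  map_add' f g := Subtype.ext <| by
    refine (f + g).hasSumOnSpace.unique ?_
    rw [hermiteSeries_add, formalBargmann_add]
    exact f.hasSumOnSpace.add g.hasSumOnSpace
  map_smul' a f := Subtype.ext <| by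
    refine (a • f).hasSumOnSpace.unique ?_
    rw [hermiteSeries_smul, formalBargmann_smul]
    exact f.hasSumOnSpace.smul a

lemma continuous_bargmannLinear (d : ℕ) {s : ℝ} (hs : 0 < s) :
    Continuous (bargmannLinear d hs) := by
  refine WithSeminorms.continuous_of_isBounded (withSeminorms_pilipovicSpace d s)
    (withSeminorms_entireSpace d s) _ fun r => ?_
  obtain ⟨h, C, hC, hb⟩ := exists_norm_bargmannIntegral_le d hs r.2
  refine ⟨{h}, ⟨C, hC⟩, fun g => ?_⟩
  rw [Finset.sup_singleton]
  change (⨆ z, entireQuot s r (bargmannIntegral g.toFun) z) ≤ C * pilSeminorm d s h g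
  exact ciSup_le fun z => (div_le_iff₀ (entireWeight_pos s r z)).2 (hb g z)

/-! ### Bijectivity -/

lemma fourier_eq_bargmannIntegral {d : ℕ} (f : RSpace d → ℂ) (ξ : RSpace d) :
    ∃ (a : ℂ) (z : CSpace d),
      FourierTransform.fourier
        (fun y : RSpace d => Complex.exp (-(1 / 2) * ((‖y‖ ^ 2 : ℝ) : ℂ)) * f y) ξ =
          a * bargmannIntegral f z := by
  set z : CSpace d := WithLp.toLp 2 fun i => ((-(Real.sqrt 2 * Real.pi * ξ i) : ℝ) : ℂ) * Complex.I
    with hz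
  have hpi : ((Real.pi ^ (-(d : ℝ) / 4) : ℝ) : ℂ) ≠ 0 :=
    Complex.ofReal_ne_zero.2 (Real.rpow_pos_of_pos Real.pi_pos _).ne'
  refine ⟨Complex.exp (1 / 2 * ∑ i, z i * z i) * (((Real.pi ^ (-(d : ℝ) / 4) : ℝ) : ℂ))⁻¹, z, ?_⟩
  rw [bargmannIntegral, mul_assoc, inv_mul_cancel_left₀ hpi, ← MeasureTheory.integral_const_mul,
    Real.fourier_eq']
  refine congrArg _ (funext fun y => ?_)
  simp only [smul_eq_mul]
  rw [← mul_assoc, ← mul_assoc, ← Complex.exp_add, ← Complex.exp_add]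
  congr 2
  have e : ((Real.sqrt 2 : ℝ) : ℂ) * ∑ i, z i * (y i : ℂ) =
      ((-2 * Real.pi * inner ℝ y ξ : ℝ) : ℂ) * Complex.I := by
    rw [PiLp.inner_apply, Finset.mul_sum, Finset.mul_sum, Complex.ofReal_sum, Finset.sum_mul]
    refine Finset.sum_congr rfl fun i _ => ?_
    have h2 : ((Real.sqrt 2 : ℝ) : ℂ) * ((Real.sqrt 2 : ℝ) : ℂ) = 2 := by
      rw [← Complex.ofReal_mul, Real.mul_self_sqrt (by norm_num)]; norm_num
    simp only [hz, RCLike.inner_apply, conj_trivial]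
    push_cast
    linear_combination (-(Real.pi : ℂ) * ξ i * y i * Complex.I) * h2
  rw [e]
  ring

lemma eq_zero_of_bargmannIntegral_eq_zero {d : ℕ} {f : RSpace d → ℂ} (hf : Continuous f) {M : ℝ}
    (hM : ∀ x, ‖f x‖ ≤ M) (h : bargmannIntegral f = 0) : f = 0 := by
  set φ : RSpace d → ℂ := fun y => Complex.exp (-(1 / 2) * ((‖y‖ ^ 2 : ℝ) : ℂ)) * f y with hφ
  have hF : FourierTransform.fourier φ = 0 := by
    funext ξ
    obtain ⟨a, z, e⟩ := fourier_eq_bargmannIntegral f ξ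
    rw [hφ, e, h, Pi.zero_apply, mul_zero, Pi.zero_apply]
  have hφc : Continuous φ := by fun_prop
  have hg : MeasureTheory.Integrable
      fun y : RSpace d => Complex.exp (-(1 / 2) * ((‖y‖ ^ 2 : ℝ) : ℂ)) := by
    have := GaussianFourier.integrable_cexp_neg_mul_sq_norm_add (V := RSpace d)
      (b := 1 / 2) (by norm_num) 0 0
    simpa using this
  have hφi : MeasureTheory.Integrable φ :=
    hg.mul_bdd hf.aestronglyMeasurable (.of_forall hM)
  have h1 := hφc.fourierInv_fourier_eq hφi (by rw [hF]; exact MeasureTheory.integrable_zero _ _ _)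
  rw [hF] at h1
  funext y
  have h2 := congrFun h1 y
  rw [Real.fourierInv_eq] at h2
  simp only [Pi.zero_apply, smul_zero, MeasureTheory.integral_zero] at h2
  exact (mul_eq_zero.1 h2.symm).resolve_left (Complex.exp_ne_zero _)

lemma injective_bargmannLinear (d : ℕ) {s : ℝ} (hs : 0 < s) :
    Function.Injective (bargmannLinear d hs) := by
  refine (injective_iff_map_eq_zero _).2 fun g hg => Subtype.ext ?_
  obtain ⟨M, hM⟩ := g.exists_norm_le
  exact eq_zero_of_bargmannIntegral_eq_zero g.contDiff.continuous hM (congrArg Subtype.val hg)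

lemma exists_hermiteSeries_eq {d : ℕ} {s : ℝ} (hs : 0 < s) {c : FormalHermiteSeries d}
    (hc : ∀ r : ℝ, 0 < r → ∃ C : ℝ, ∀ α, ‖c α‖ ≤ C * decay s r α) :
    ∃ g : PilipovicSpace d s, hermiteSeries g.toFun = c :=
  ⟨⟨hermiteSum c, hermiteSum_mem hs hc⟩,
    hermiteSeries_hermiteSum (polySummable_of_decay hs (hc 2 two_pos))⟩

lemma EntireSpace.exists_coeff_le {d : ℕ} {s : ℝ} (hs : 0 < s) {c : FormalHermiteSeries d}
    {F : EntireSpace d s} (h : HasSumOnSpace (formalBargmann c) F.toFun) (r : ℝ) (hr : 0 < r) :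
    ∃ C : ℝ, ∀ α, ‖c α‖ ≤ C * decay s r α := by
  obtain ⟨r', C, hr', hC⟩ := Pilipovic.exists_coeff_le d hs hr
  exact ⟨_, hC c F.toFun _ h (apply_nonneg (entireSeminorm d s ⟨r', hr'⟩) F) (F.norm_le ⟨r', hr'⟩)⟩

lemma EntireSpace.exists_formalBargmann {d : ℕ} {s : ℝ} (F : EntireSpace d s) :
    ∃ c : FormalHermiteSeries d, HasSumOnSpace (formalBargmann c) F.toFun := by
  obtain ⟨P, hP⟩ := exists_hasSumOnSpace F.2.1
  refine ⟨fun α => P α * (Real.sqrt α.fact : ℂ), ?_⟩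
  have e : formalBargmann (fun α => P α * (Real.sqrt α.fact : ℂ)) = P := funext fun α =>
    mul_div_cancel_right₀ _ (Complex.ofReal_ne_zero.2 (Real.sqrt_pos.2 (fact_pos α)).ne')
  rw [e]
  exact hP

lemma surjective_bargmannLinear (d : ℕ) {s : ℝ} (hs : 0 < s) :
    Function.Surjective (bargmannLinear d hs) := fun F => by
  obtain ⟨c, hc⟩ := F.exists_formalBargmann
  obtain ⟨g, rfl⟩ := exists_hermiteSeries_eq hs (EntireSpace.exists_coeff_le hs hc)
  exact ⟨g, Subtype.ext (g.hasSumOnSpace.unique hc)⟩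

end Pilipovic

end

theorem mainTheorem3 (d : ℕ) (s : ℝ) (hs : 0 < s) :
    -- equivalence of the three conditions, for every formal Hermite series `f`
    (∀ f : Pilipovic.FormalHermiteSeries d,
      List.TFAE [
        ∃ g : Pilipovic.PilipovicSpace d s, Pilipovic.hermiteSeries g.toFun = f,
        ∃ F : Pilipovic.EntireSpace d s,
          Pilipovic.HasSumOnSpace (Pilipovic.formalBargmann f) F.toFun,
        ∀ r : ℝ, 0 < r → ∃ C : ℝ, ∀ α : Pilipovic.MultiIndex d,
          ‖f α‖ ≤ C * Real.exp (-r * (α.length : ℝ) ^ (1 / (2 * s)))]) ∧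
    -- the Bargmann transform is a continuous bijection between the two spaces
    (∃ B : Pilipovic.PilipovicSpace d s →L[ℂ] Pilipovic.EntireSpace d s,
      (∀ g : Pilipovic.PilipovicSpace d s,
        (B g).toFun = Pilipovic.bargmannIntegral g.toFun ∧
        Pilipovic.HasSumOnSpace
          (Pilipovic.formalBargmann (Pilipovic.hermiteSeries g.toFun)) (B g).toFun) ∧
      Function.Bijective B) := by
  refine ⟨fun f => ?_, ⟨Pilipovic.bargmannLinear d hs, Pilipovic.continuous_bargmannLinear d hs⟩,
    fun g => ⟨rfl, g.hasSumOnSpace⟩, Pilipovic.injective_bargmannLinear d hs,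
    Pilipovic.surjective_bargmannLinear d hs⟩
  tfae_have 1 → 2 := by
    rintro ⟨g, rfl⟩
    exact ⟨Pilipovic.bargmannLinear d hs g, g.hasSumOnSpace⟩
  tfae_have 2 → 3 := fun ⟨_, hF⟩ => Pilipovic.EntireSpace.exists_coeff_le hs hF
  tfae_have 3 → 1 := fun hf => Pilipovic.exists_hermiteSeries_eq hs hf
  tfae_finish
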